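/- Let $G$ be a unimodular, locally compact, Hausdorff topological group with Haar measure $\mu$, and let $K\subseteq G$ be a compact subgroup. Let $\lambda$ be the left regular representation of $G$ on $L^2(G)$, and let $C^*_r(G)$ be the reduced group $C^*$-algebra, i.e. the $C^*$-algebra of operators on $L^2(G)$ generated by the operators $\lambda(f)=\int_G f(g)\lambda(g)\,d\mu(g)$, $f\in C_c(G)$. The spectrum $\widehat A$ of a $C^*$-algebra $A$ is the set of unitary equivalence classes of its (nonzero) irreducible $*$-representations on Hilbert spaces, with the hull-kernel topology, whose closed sets are the sets of classes that vanish on a given two-sided ideal; the reduced dual of $G$ is $\widehat{C^*_r(G)}$. For a finite-dimensional unitary representation $V$ of $K$ put $L^2(G/K;V)=[L^2(G)\otimes V]^K$, where $K$ acts on $L^2(G)$ by right translation; $C^*_r(G)$ acts on this space through the first tensor factor. The compact ideal $C^*_{\mathrm{cpt}}(G)\triangleleft C^*_r(G)$ consists of all $a\in C^*_r(G)$ that act as a compact operator on $L^2(G/K;V)$ for every finite-dimensional unitary representation $V$ of $K$. An irreducible unitary (strongly continuous) representation $\pi$ of $G$ is $K$-admissible if every irreducible unitary representation $V$ of $K$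 occurs in $\pi|_K$ with finite multiplicity, i.e. $\dim \mathrm{Hom}_K(V,H_\pi)<\infty$. It is a topological discrete series representation if it integrates to an irreducible representation $\rho$ of $C^*_r(G)$, meaning $\rho(\lambda(f))=\int_G f(g)\pi(g)\,d\mu(g)$ for all $f\in C_c(G)$, and the singleton $\{[\rho]\}$ is open and closed in the reduced dual. Say that an irreducible representation $\sigma$ of $C^*_{\mathrm{cpt}}(G)$ corresponds to an irreducible unitary representation $\pi$ of $G$ if, up to unitary equivalence, $\sigma$ extends to an irreducible representation of $C^*_r(G)$ that is the integrated form of $\pi$. Theorem. This correspondence defines an injective map from the spectrum of $C^*_{\mathrm{cpt}}(G)$ to the set of unitary equivalence classes of irreducible unitary representations of $G$, and its image consists exactly of the classes of those $\pi$ such that (i) $\pi$ is a topological discrete series representation, and (ii) $\pi$ is $K$-admissible. -/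

import Mathlib

open MeasureTheory
open scoped TensorProduct CompactlySupported ENNReal

universe u


noncomputable section

/-! ### Unitary representations of topological groups -/

/-- A (strongly continuous) unitary representation of the topological group `G` on `H`. -/
structure UnitaryRep (G : Type*) [Group G] [TopologicalSpace G]
    (H : Type*) [NormedAddCommGroup H] [InnerProductSpace ℂ H] where
  toHom : G →* (H ≃ₗᵢ[ℂ] H)
  strongly_continuous : ∀ ξ : H, Continuous fun g => toHom g ξ

namespace UnitaryRep

variable {G : Type*} [Group G] [TopologicalSpace G]
variable {H : Type*} [NormedAddCommGroup H] [InnerProductSpace ℂ H]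
variable {H' : Type*} [NormedAddCommGroup H'] [InnerProductSpace ℂ H']

/-- Topological irreducibility: `H ≠ 0`, and the only closed invariant subspaces are `0` and `H`. -/
def IsIrreducible (π : UnitaryRep G H) : Prop :=
  Nontrivial H ∧ ∀ W : Submodule ℂ H, IsClosed (W : Set H) →
    (∀ g, ∀ ξ ∈ W, π.toHom g ξ ∈ W) → W = ⊥ ∨ W = ⊤

/-- Restriction to a subgroup. -/
def restrict (π : UnitaryRep G H) (K : Subgroup G) : UnitaryRep K H where
  toHom := π.toHom.comp K.subtype
  strongly_continuous ξ := (π.strongly_continuous ξ).comp continuous_subtype_val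

/-- The space of bounded intertwining operators from `τ` to `π`. -/
def intertwiners (τ : UnitaryRep G H) (π : UnitaryRep G H') : Submodule ℂ (H →L[ℂ] H') where
  carrier := {T | ∀ g ξ, T (τ.toHom g ξ) = π.toHom g (T ξ)}
  add_mem' {S T} hS hT g ξ := by simp [hS g ξ, hT g ξ]
  zero_mem' g ξ := by simp
  smul_mem' c T hT g ξ := by simp [hT g ξ]

/-- `K`-admissibility: each irreducible unitary representation `V` of `K` has finite multiplicity
`dim Hom_K(V, H)` in `H`. -/
def IsAdmissible {G : Type u} [Group G] [TopologicalSpace G]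
    {H : Type u} [NormedAddCommGroup H] [InnerProductSpace ℂ H]
    (K : Subgroup G) (π : UnitaryRep G H) : Prop :=
  ∀ (V : Type u) [NormedAddCommGroup V] [InnerProductSpace ℂ V] [CompleteSpace V]
    (τ : UnitaryRep K V), τ.IsIrreducible →
      FiniteDimensional ℂ (τ.intertwiners (π.restrict K))

variable [MeasurableSpace G] [BorelSpace G]

theorem integrable_smul (μ : Measure G) [IsFiniteMeasureOnCompacts μ] (π : UnitaryRep G H)
    (f : C_c(G, ℂ)) (ξ : H) : Integrable (fun g => f g • π.toHom g ξ) μ :=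
  (f.continuous.smul (π.strongly_continuous ξ)).integrable_of_hasCompactSupport
    f.hasCompactSupport.smul_right

/-- The integrated form `π(f) ξ = ∫ f(g) π(g) ξ dg`, for `f` continuous with compact support. -/
def integrated [CompleteSpace H] (μ : Measure G) [IsFiniteMeasureOnCompacts μ]
    (π : UnitaryRep G H) (f : C_c(G, ℂ)) : H →L[ℂ] H :=
  LinearMap.mkContinuous
    { toFun := fun ξ => ∫ g, f g • π.toHom g ξ ∂μ
      map_add' := fun ξ η => by
        simp only [map_add, smul_add]
        exact integral_add (π.integrable_smul μ f ξ) (π.integrable_smul μ f η)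
      map_smul' := fun c ξ => by
        simp only [map_smul, RingHom.id_apply, ← integral_smul, smul_comm c] }
    (∫ g, ‖f g‖ ∂μ) (fun ξ => by
      refine (norm_integral_le_integral_norm _).trans (le_of_eq ?_)
      simp only [norm_smul, LinearIsometryEquiv.norm_map]
      exact integral_mul_const _ _)

end UnitaryRep

/-- An irreducible unitary representation of `G` on a Hilbert space. -/
structure IrrUnitaryRep (G : Type u) [Group G] [TopologicalSpace G] where
  H : Type u
  [normed : NormedAddCommGroup H]
  [innerProduct : InnerProductSpace ℂ H]
  [complete : CompleteSpace H]
  rep : UnitaryRep G H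
  irreducible : rep.IsIrreducible

attribute [instance] IrrUnitaryRep.normed IrrUnitaryRep.innerProduct IrrUnitaryRep.complete

/-- Unitary equivalence. -/
instance IrrUnitaryRep.setoid (G : Type u) [Group G] [TopologicalSpace G] :
    Setoid (IrrUnitaryRep G) where
  r π π' := ∃ U : π.H ≃ₗᵢ[ℂ] π'.H, ∀ g ξ, U (π.rep.toHom g ξ) = π'.rep.toHom g (U ξ)
  iseqv :=
    { refl := fun π => ⟨LinearIsometryEquiv.refl ℂ π.H, fun _ _ => rfl⟩
      symm := by
        rintro π π' ⟨U, hU⟩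
        refine ⟨U.symm, fun g ξ => ?_⟩
        rw [LinearIsometryEquiv.symm_apply_eq, hU, LinearIsometryEquiv.apply_symm_apply]
      trans := by
        rintro π π' π'' ⟨U, hU⟩ ⟨W, hW⟩
        exact ⟨U.trans W, fun g ξ => by simp [hU, hW]⟩ }

/-- The unitary dual of `G`. -/
abbrev UnitaryDual (G : Type u) [Group G] [TopologicalSpace G] : Type (u + 1) :=
  Quotient (IrrUnitaryRep.setoid G)

/-! ### The spectrum of a C*-algebra -/

/-- An irreducible `*`-representation of `A` on a Hilbert space: it is not the zero representation
and the only closed invariant subspaces are `0` and `H`. -/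
structure IrrRep (A : Type u) [NonUnitalRing A] [StarRing A] [Module ℂ A] where
  H : Type u
  [normed : NormedAddCommGroup H]
  [innerProduct : InnerProductSpace ℂ H]
  [complete : CompleteSpace H]
  rep : A →⋆ₙₐ[ℂ] (H →L[ℂ] H)
  ne_zero : ∃ a, rep a ≠ 0
  irreducible : ∀ W : Submodule ℂ H, IsClosed (W : Set H) →
    (∀ a, ∀ ξ ∈ W, rep a ξ ∈ W) → W = ⊥ ∨ W = ⊤

attribute [instance] IrrRep.normed IrrRep.innerProduct IrrRep.complete

section Spectrum

variable {A : Type u} [NonUnitalRing A] [StarRing A] [Module ℂ A]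

/-- Unitary equivalence. -/
instance IrrRep.setoid (A : Type u) [NonUnitalRing A] [StarRing A] [Module ℂ A] :
    Setoid (IrrRep A) where
  r ρ ρ' := ∃ U : ρ.H ≃ₗᵢ[ℂ] ρ'.H, ∀ a ξ, U (ρ.rep a ξ) = ρ'.rep a (U ξ)
  iseqv :=
    { refl := fun ρ => ⟨LinearIsometryEquiv.refl ℂ ρ.H, fun _ _ => rfl⟩
      symm := by
        rintro ρ ρ' ⟨U, hU⟩
        refine ⟨U.symm, fun g ξ => ?_⟩
        rw [LinearIsometryEquiv.symm_apply_eq, hU, LinearIsometryEquiv.apply_symm_apply]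
      trans := by
        rintro ρ ρ' ρ'' ⟨U, hU⟩ ⟨W, hW⟩
        exact ⟨U.trans W, fun g ξ => by simp [hU, hW]⟩ }

/-- The spectrum `Â`: the set of unitary equivalence classes of irreducible representations. -/
def CStarDual (A : Type u) [NonUnitalRing A] [StarRing A] [Module ℂ A] : Type (u + 1) :=
  Quotient (IrrRep.setoid A)

/-- The class of an irreducible representation in the spectrum. -/
def IrrRep.toDual (ρ : IrrRep A) : CStarDual A := Quotient.mk _ ρ

/-- The kernel of an irreducible representation, a two-sided ideal. -/
def IrrRep.ker (ρ : IrrRep A) : TwoSidedIdeal A := TwoSidedIdeal.ker ρ.rep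

/-- The (primitive) ideal attached to a point of the spectrum. -/
def CStarDual.ker (x : CStarDual A) : TwoSidedIdeal A :=
  Quotient.lift IrrRep.ker (by
    rintro ρ ρ' ⟨U, hU⟩
    ext a
    simp only [IrrRep.ker, TwoSidedIdeal.mem_ker]
    constructor
    · intro h
      ext ξ
      have := hU a (U.symm ξ)
      simpa [h] using this.symm
    · intro h
      ext ξ
      have := hU a ξ
      simpa [h] using this) x

/-- Kernels of irreducible representations are prime ideals. -/
theorem IrrRep.ker_prime (ρ : IrrRep A) (I J : TwoSidedIdeal A) (h : I ⊓ J ≤ ρ.ker) :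
    I ≤ ρ.ker ∨ J ≤ ρ.ker := by
  by_contra! hc
  obtain ⟨hI, hJ⟩ := hc
  obtain ⟨a, haI, ha⟩ := Set.not_subset.1 hI
  obtain ⟨b, hbJ, hb⟩ := Set.not_subset.1 hJ
  have ha' : ρ.rep a ≠ 0 := fun h0 => ha ((TwoSidedIdeal.mem_ker _).2 h0)
  have hb' : ρ.rep b ≠ 0 := fun h0 => hb ((TwoSidedIdeal.mem_ker _).2 h0)
  obtain ⟨ξ, hξ⟩ : ∃ ξ, ρ.rep b ξ ≠ 0 := by
    by_contra! h0
    exact hb' (ContinuousLinearMap.ext h0)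
  have key : ∀ c, ρ.rep a (ρ.rep c (ρ.rep b ξ)) = 0 := by
    intro c
    have hm : a * c * b ∈ I ⊓ J :=
      (TwoSidedIdeal.mem_inf _).2 ⟨I.mul_mem_right _ _ (I.mul_mem_right _ _ haI),
        J.mul_mem_left _ _ hbJ⟩
    have h1 : ρ.rep (a * c * b) = 0 := (TwoSidedIdeal.mem_ker _).1 (h hm)
    have h2 := congrArg (fun T : ρ.H →L[ℂ] ρ.H => T ξ) h1
    simpa [map_mul] using h2
  let W : Submodule ℂ ρ.H :=
    { carrier := {η | ∀ c, ρ.rep a (ρ.rep c η) = 0}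
      add_mem' := fun {x y} hx hy c => by simp [hx c, hy c]
      zero_mem' := fun c => by simp
      smul_mem' := fun r x hx c => by simp [hx c] }
  have hWc : IsClosed (W : Set ρ.H) := by
    have : (W : Set ρ.H) = ⋂ c, {η | ρ.rep a (ρ.rep c η) = 0} := by
      ext η; simp [W]
    rw [this]
    exact isClosed_iInter fun c => isClosed_eq (by fun_prop) continuous_const
  have hWi : ∀ c, ∀ η ∈ W, ρ.rep c η ∈ W := fun c η hη d => by
    have := hη (d * c)
    simpa [map_mul] using this
  rcases ρ.irreducible W hWc hWi with hW | hW
  · have : ρ.rep b ξ ∈ W := key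
    rw [hW] at this
    exact hξ (by simpa using this)
  · let Z : Submodule ℂ ρ.H :=
      { carrier := {η | ∀ c, ρ.rep c η = 0}
        add_mem' := fun {x y} hx hy c => by simp [hx c, hy c]
        zero_mem' := fun c => by simp
        smul_mem' := fun r x hx c => by simp [hx c] }
    have hZc : IsClosed (Z : Set ρ.H) := by
      have : (Z : Set ρ.H) = ⋂ c, {η | ρ.rep c η = 0} := by
        ext η; simp [Z]
      rw [this]
      exact isClosed_iInter fun c => isClosed_eq (by fun_prop) continuous_const
    have hZi : ∀ c, ∀ η ∈ Z, ρ.rep c η ∈ Z := fun c η hη d => by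
      rw [hη c]; simp
    rcases ρ.irreducible Z hZc hZi with hZ | hZ
    · apply ha'
      have hs : ρ.rep (star a) = 0 := by
        ext η
        have hmem : ρ.rep (star a) η ∈ Z := by
          intro c
          have hperp : ∀ ζ, inner ℂ (ρ.rep c (ρ.rep (star a) η)) ζ = 0 := by
            intro ζ
            have hζ : ζ ∈ W := by rw [hW]; trivial
            have h3 := hζ (star c)
            rw [map_star, ContinuousLinearMap.star_eq_adjoint] at h3
            rw [map_star, ContinuousLinearMap.star_eq_adjoint,
              ← ContinuousLinearMap.adjoint_inner_right,
              ContinuousLinearMap.adjoint_inner_left, h3, inner_zero_right]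
          exact inner_self_eq_zero.1 (hperp _)
        rw [hZ] at hmem
        simpa using hmem
      rw [map_star, star_eq_zero] at hs
      exact hs
    · obtain ⟨c, hc⟩ := ρ.ne_zero
      apply hc
      ext η
      have : η ∈ Z := by rw [hZ]; trivial
      exact this c

/-- The hull-kernel topology of the spectrum: the closed sets are the hulls
`{x | x vanishes on I}` of two-sided ideals `I`. (An ideal and its closure have the same hull.) -/
instance CStarDual.topology : TopologicalSpace (CStarDual A) :=
  TopologicalSpace.ofClosed {S | ∃ I : TwoSidedIdeal A, S = {x | I ≤ x.ker}}
    (by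
      refine ⟨⊤, ?_⟩
      ext x
      simp only [Set.mem_empty_iff_false, Set.mem_ofPred_eq, false_iff]
      induction x using Quotient.inductionOn with
      | h ρ =>
        intro h
        obtain ⟨a, ha⟩ := ρ.ne_zero
        exact ha ((TwoSidedIdeal.mem_ker _).1 (h (TwoSidedIdeal.mem_top (x := a)))))
    (by
      intro F hF
      refine ⟨sSup {I | ∃ S ∈ F, S = {x | I ≤ x.ker}}, ?_⟩
      ext x
      simp only [Set.mem_sInter, Set.mem_ofPred_eq, sSup_le_iff]
      constructor
      · rintro h I ⟨S, hS, rfl⟩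
        exact h _ hS
      · intro h S hS
        obtain ⟨I, rfl⟩ := hF hS
        exact h I ⟨_, hS, rfl⟩)
    (by
      rintro _ ⟨I, rfl⟩ _ ⟨J, rfl⟩
      refine ⟨I ⊓ J, ?_⟩
      ext x
      simp only [Set.mem_union, Set.mem_ofPred_eq]
      constructor
      · rintro (h | h)
        · exact inf_le_left.trans h
        · exact inf_le_right.trans h
      · induction x using Quotient.inductionOn with
        | h ρ => exact ρ.ker_prime I J)

end Spectrum

/-! ### The regular representation and the reduced group C*-algebra -/

section Reduced

variable {G : Type u} [Group G] [TopologicalSpace G] [IsTopologicalGroup G]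
  [MeasurableSpace G] [BorelSpace G]
variable (μ : Measure G)

/-- The operator `(λ(g) ξ)(x) = ξ(g⁻¹ x)` on `L²(G)`. -/
def leftTranslation [μ.IsMulLeftInvariant] (g : G) : Lp ℂ 2 μ →ₗᵢ[ℂ] Lp ℂ 2 μ :=
  Lp.compMeasurePreservingₗᵢ ℂ (fun x => g⁻¹ * x) (measurePreserving_mul_left μ g⁻¹)

/-- The operator `(r(g) ξ)(x) = ξ(x g)` on `L²(G)`. -/
def rightTranslation [μ.IsMulRightInvariant] (g : G) : Lp ℂ 2 μ →ₗᵢ[ℂ] Lp ℂ 2 μ :=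
  Lp.compMeasurePreservingₗᵢ ℂ (fun x => x * g) (measurePreserving_mul_right μ g)

theorem leftTranslation_one [μ.IsMulLeftInvariant] (ξ : Lp ℂ 2 μ) :
    leftTranslation μ 1 ξ = ξ := by
  apply Lp.ext
  filter_upwards [Lp.coeFn_compMeasurePreserving ξ (measurePreserving_mul_left μ (1 : G)⁻¹)]
    with x hx
  refine hx.trans ?_
  simp

theorem leftTranslation_mul [μ.IsMulLeftInvariant] (g h : G) (ξ : Lp ℂ 2 μ) :
    leftTranslation μ (g * h) ξ = leftTranslation μ g (leftTranslation μ h ξ) := by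
  apply Lp.ext
  have h1 := Lp.coeFn_compMeasurePreserving ξ (measurePreserving_mul_left μ (g * h)⁻¹)
  have h2 := Lp.coeFn_compMeasurePreserving (leftTranslation μ h ξ)
    (measurePreserving_mul_left μ g⁻¹)
  have h3 := (measurePreserving_mul_left μ g⁻¹).quasiMeasurePreserving.ae_eq_comp
    (Lp.coeFn_compMeasurePreserving ξ (measurePreserving_mul_left μ h⁻¹))
  filter_upwards [h1, h2, h3] with x hx1 hx2 hx3
  refine hx1.trans (Eq.trans ?_ hx2.symm)
  refine Eq.trans ?_ hx3.symm
  simp [mul_assoc]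

theorem leftTranslation_right [μ.IsMulLeftInvariant] [μ.IsMulRightInvariant] (g h : G)
    (ξ : Lp ℂ 2 μ) :
    leftTranslation μ g (rightTranslation μ h ξ) = rightTranslation μ h (leftTranslation μ g ξ) := by
  apply Lp.ext
  have h1 := Lp.coeFn_compMeasurePreserving (rightTranslation μ h ξ)
    (measurePreserving_mul_left μ g⁻¹)
  have h2 := (measurePreserving_mul_left μ g⁻¹).quasiMeasurePreserving.ae_eq_comp
    (Lp.coeFn_compMeasurePreserving ξ (measurePreserving_mul_right μ h))
  have h3 := Lp.coeFn_compMeasurePreserving (leftTranslation μ g ξ)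
    (measurePreserving_mul_right μ h)
  have h4 := (measurePreserving_mul_right μ h).quasiMeasurePreserving.ae_eq_comp
    (Lp.coeFn_compMeasurePreserving ξ (measurePreserving_mul_left μ g⁻¹))
  filter_upwards [h1, h2, h3, h4] with x hx1 hx2 hx3 hx4
  refine (hx1.trans hx2).trans (Eq.trans ?_ (hx3.trans hx4).symm)
  simp [mul_assoc]

theorem rightTranslation_inv [μ.IsMulRightInvariant] (g : G) (ξ : Lp ℂ 2 μ) :
    rightTranslation μ g (rightTranslation μ g⁻¹ ξ) = ξ := by
  apply Lp.ext
  have h1 := Lp.coeFn_compMeasurePreserving (rightTranslation μ g⁻¹ ξ)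
    (measurePreserving_mul_right μ g)
  have h2 := (measurePreserving_mul_right μ g).quasiMeasurePreserving.ae_eq_comp
    (Lp.coeFn_compMeasurePreserving ξ (measurePreserving_mul_right μ g⁻¹))
  filter_upwards [h1, h2] with x hx1 hx2
  refine (hx1.trans hx2).trans ?_
  simp

variable [LocallyCompactSpace G]

/-- The left regular representation of `G` on `L²(G)`. -/
def leftRegular [μ.IsHaarMeasure] [μ.Regular] : UnitaryRep G (Lp ℂ 2 μ) where
  toHom :=
    { toFun := fun g =>
        { (leftTranslation μ g).toLinearMap with
          invFun := leftTranslation μ g⁻¹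
          left_inv := fun ξ => by
            change leftTranslation μ g⁻¹ (leftTranslation μ g ξ) = ξ
            rw [← leftTranslation_mul, inv_mul_cancel, leftTranslation_one]
          right_inv := fun ξ => by
            change leftTranslation μ g (leftTranslation μ g⁻¹ ξ) = ξ
            rw [← leftTranslation_mul, mul_inv_cancel, leftTranslation_one]
          norm_map' := (leftTranslation μ g).norm_map }
      map_one' := by
        ext1 ξ
        exact leftTranslation_one μ ξ
      map_mul' := fun g h => by
        ext1 ξ
        exact leftTranslation_mul μ g h ξ }
  strongly_continuous ξ := by
    have : Fact ((2 : ℝ≥0∞) ≠ ∞) := ⟨by simp⟩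
    have h : Continuous fun g : G => DomMulAct.mk g⁻¹ • ξ :=
      (DomMulAct.continuous_mk.comp continuous_inv).smul continuous_const
    exact h

/-- The reduced group C*-algebra `C*_r(G)`: the C*-algebra of operators on `L²(G)` generated by the
left convolution operators `λ(f)`, `f` continuous with compact support. -/
def reducedCStar [μ.IsHaarMeasure] [μ.Regular] :
    NonUnitalStarSubalgebra ℂ (Lp ℂ 2 μ →L[ℂ] Lp ℂ 2 μ) :=
  (NonUnitalStarAlgebra.adjoin ℂ (Set.range ((leftRegular μ).integrated μ))).topologicalClosure

/-- The left convolution operator `λ(f)`, as an element of `C*_r(G)`. -/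
def leftConv [μ.IsHaarMeasure] [μ.Regular] (f : C_c(G, ℂ)) : reducedCStar μ :=
  ⟨(leftRegular μ).integrated μ f, NonUnitalStarSubalgebra.le_topologicalClosure _
    (NonUnitalStarAlgebra.subset_adjoin ℂ _ ⟨f, rfl⟩)⟩

/-- `ρ` is (unitarily equivalent to) the representation of `C*_r(G)` obtained by integrating the
irreducible unitary representation `π` of `G`. -/
def IsIntegratedForm [μ.IsHaarMeasure] [μ.Regular]
    (ρ : IrrRep (reducedCStar μ)) (π : IrrUnitaryRep G) : Prop :=
  ∃ U : π.H ≃ₗᵢ[ℂ] ρ.H, ∀ (f : C_c(G, ℂ)) (ξ : π.H),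
    U (π.rep.integrated μ f ξ) = ρ.rep (leftConv μ f) (U ξ)

/-- `π` is a topological discrete series representation: it is a point of the reduced dual (the
spectrum of `C*_r(G)`) and the corresponding singleton is open and closed there. -/
def IsTopologicalDiscreteSeries [μ.IsHaarMeasure] [μ.Regular] (π : IrrUnitaryRep G) : Prop :=
  ∃ ρ : IrrRep (reducedCStar μ), IsIntegratedForm μ ρ π ∧ IsClopen {ρ.toDual}

end Reduced

/-! ### Sections of homogeneous bundles and the compact ideal -/

section Tensor

variable {E V : Type*} [NormedAddCommGroup E] [InnerProductSpace ℂ E]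
  [NormedAddCommGroup V] [InnerProductSpace ℂ V] [FiniteDimensional ℂ V]

theorem tensor_complete [CompleteSpace E] : CompleteSpace (E ⊗[ℂ] V) := by
  let b := stdOrthonormalBasis ℂ V
  let p : ∀ i, E ⊗[ℂ] V →L[ℂ] E := fun i =>
    (TensorProduct.ridIsometry ℂ E).toContinuousLinearEquiv.toContinuousLinearMap.comp
      ((innerSL ℂ (b i)).lTensor E)
  let e : (E ⊗[ℂ] V) ≃L[ℂ] (Fin (Module.finrank ℂ V) → E) :=
    { toFun := fun x i => p i x
      invFun := fun y => ∑ i, y i ⊗ₜ[ℂ] b i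
      map_add' := fun x y => by ext i; simp
      map_smul' := fun c x => by ext i; simp
      left_inv := fun x => by
        induction x using TensorProduct.induction_on with
        | zero => simp
        | add x y hx hy =>
          simp only [map_add, TensorProduct.add_tmul, Finset.sum_add_distrib] at hx hy ⊢
          rw [hx, hy]
        | tmul x v =>
          conv_rhs => rw [← b.sum_repr v]
          simp [p, TensorProduct.tmul_sum, TensorProduct.smul_tmul, b.repr_apply_apply]
      right_inv := fun y => by
        ext i
        simp [p, orthonormal_iff_ite.1 b.orthonormal]
      continuous_toFun := by
        change Continuous fun x i => p i x
        fun_prop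
      continuous_invFun := by
        change Continuous fun y : Fin (Module.finrank ℂ V) → E => ∑ i, y i ⊗ₜ[ℂ] b i
        fun_prop }
  exact (completeSpace_congr (e := e.toEquiv) e.isUniformEmbedding).2 inferInstance

/-- If `S` is a formal adjoint of a compact operator, then `S` is compact. -/
theorem compact_of_adjoint {F : Type*} [NormedAddCommGroup F] [InnerProductSpace ℂ F]
    [CompleteSpace F] (S T : F →L[ℂ] F) (h : ∀ x y, inner ℂ (T x) y = inner ℂ x (S y))
    (hT : IsCompactOperator T) : IsCompactOperator S := by
  have hTS : IsCompactOperator (T ∘L S) := hT.comp_clm S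
  have htb : TotallyBounded ((T ∘L S) '' Metric.closedBall 0 1) :=
    ((hTS.isCompact_closure_image_closedBall (𝕜₁ := ℂ) (f := (T ∘L S).toLinearMap) 1
      ).totallyBounded).subset subset_closure
  refine (isCompactOperator_iff_isCompact_closure_image_closedBall (𝕜₁ := ℂ) S.toLinearMap
    zero_lt_one).2 ?_
  refine TotallyBounded.isCompact_of_isClosed (TotallyBounded.closure ?_) isClosed_closure
  refine Metric.totallyBounded_iff.2 fun ε hε => ?_
  obtain ⟨t, hts, htf, hcov⟩ := Metric.finite_approx_of_totallyBounded htb (ε ^ 2 / 4) (by positivity)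
  lift t to Finset F using htf
  classical
  obtain ⟨u, hu, rfl⟩ := Finset.subset_set_image_iff.1 hts
  refine ⟨S '' (u : Set F), u.finite_toSet.image _, ?_⟩
  rintro _ ⟨x, hx, rfl⟩
  obtain ⟨_, hy, hxy⟩ := Set.mem_iUnion₂.1 (hcov ⟨x, hx, rfl⟩)
  obtain ⟨z, hz, rfl⟩ := Finset.mem_image.1 (Finset.mem_coe.1 hy)
  refine Set.mem_iUnion₂.2 ⟨S z, ⟨z, hz, rfl⟩, ?_⟩
  have hz1 : ‖z‖ ≤ 1 := by simpa using hu hz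
  have hx1 : ‖x‖ ≤ 1 := by simpa using hx
  have hd : ‖x - z‖ ≤ 2 := (norm_sub_le _ _).trans (by linarith)
  rw [mem_ball_iff_norm] at hxy ⊢
  have h1 : ‖T (S (x - z))‖ < ε ^ 2 / 4 := by simpa using hxy
  have h2 : ‖S (x - z)‖ ^ 2 ≤ ‖T (S (x - z))‖ * ‖x - z‖ := by
    have h3 := norm_inner_le_norm (𝕜 := ℂ) (T (S (x - z))) (x - z)
    rw [h, inner_self_eq_norm_sq_to_K, norm_pow] at h3
    simpa using h3
  have h4 : ‖S (x - z)‖ < ε := by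
    nlinarith [norm_nonneg (T (S (x - z))), norm_nonneg (S (x - z))]
  simpa using h4

end Tensor

section CompactIdeal

variable {G : Type u} [Group G] [TopologicalSpace G] [IsTopologicalGroup G]
  [LocallyCompactSpace G] [MeasurableSpace G] [BorelSpace G]
variable (μ : Measure G) [μ.IsHaarMeasure] [μ.Regular] [μ.IsMulRightInvariant]
variable {K : Subgroup G} {V : Type*} [NormedAddCommGroup V] [InnerProductSpace ℂ V]

/-- Elements of `C*_r(G)` commute with right translations. -/
theorem reducedCStar_commute (a : reducedCStar μ) (k : G) (ξ : Lp ℂ 2 μ) :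
    (a : Lp ℂ 2 μ →L[ℂ] Lp ℂ 2 μ) (rightTranslation μ k ξ)
      = rightTranslation μ k ((a : Lp ℂ 2 μ →L[ℂ] Lp ℂ 2 μ) ξ) := by
  obtain ⟨T, hT⟩ := a
  change T (rightTranslation μ k ξ) = rightTranslation μ k (T ξ)
  have hcl : IsClosed {T : Lp ℂ 2 μ →L[ℂ] Lp ℂ 2 μ |
      ∀ ξ, T (rightTranslation μ k ξ) = rightTranslation μ k (T ξ)} := by
    have hi : {T : Lp ℂ 2 μ →L[ℂ] Lp ℂ 2 μ |
        ∀ ξ, T (rightTranslation μ k ξ) = rightTranslation μ k (T ξ)}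
        = ⋂ ξ, {T | T (rightTranslation μ k ξ) = rightTranslation μ k (T ξ)} := by
      ext T
      rw [Set.mem_iInter]
      exact Iff.rfl
    rw [hi]
    refine isClosed_iInter fun ξ => isClosed_eq (by fun_prop) ?_
    exact (rightTranslation μ k).continuous.comp (by fun_prop)
  refine closure_minimal (fun T hT => ?_) hcl hT ξ
  change ∀ ξ, T (rightTranslation μ k ξ) = rightTranslation μ k (T ξ)
  induction hT using NonUnitalStarAlgebra.adjoin_induction with
  | mem T hT =>
    obtain ⟨f, rfl⟩ := hT
    intro ξ
    change ∫ g, f g • leftTranslation μ g (rightTranslation μ k ξ) ∂μ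
      = rightTranslation μ k (∫ g, f g • leftTranslation μ g ξ ∂μ)
    have h := (rightTranslation μ k).toContinuousLinearMap.integral_comp_comm
      ((leftRegular μ).integrable_smul μ f ξ)
    refine Eq.trans ?_ h
    refine integral_congr_ae (Filter.Eventually.of_forall fun g => ?_)
    change f g • leftTranslation μ g (rightTranslation μ k ξ)
      = rightTranslation μ k (f g • leftTranslation μ g ξ)
    rw [map_smul, leftTranslation_right]
  | add S T _ _ hS hT => intro ξ; simp [hS ξ, hT ξ]
  | zero => intro ξ; simp
  | mul S T _ _ hS hT => intro ξ; simp [hS, hT ξ]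
  | smul c T _ hT => intro ξ; simp [hT ξ]
  | star T _ hT =>
    intro ξ
    refine ext_inner_right ℂ fun ζ => ?_
    rw [← rightTranslation_inv μ k ζ, ContinuousLinearMap.star_eq_adjoint,
      ContinuousLinearMap.adjoint_inner_left, hT, LinearIsometry.inner_map_map,
      LinearIsometry.inner_map_map, ContinuousLinearMap.adjoint_inner_left]

/-- `L²(G/K; V) = [L²(G) ⊗ V]^K`, where `K` acts on `L²(G)` by right translation. As `V` will be
finite-dimensional, the algebraic tensor product with its Hilbert norm is the Hilbert tensor
product. -/
def bundleL2 (τ : UnitaryRep K V) : Submodule ℂ (Lp ℂ 2 μ ⊗[ℂ] V) where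
  carrier := {x | ∀ k : K,
    TensorProduct.map (rightTranslation μ (k : G)).toLinearMap
      (τ.toHom k).toLinearEquiv.toLinearMap x = x}
  add_mem' {x y} hx hy k := by rw [map_add, hx k, hy k]
  zero_mem' k := map_zero _
  smul_mem' c x hx k := by rw [map_smul, hx k]

/-- The action of `C*_r(G)` on `L²(G/K; V)`, by `a ⊗ 1`. -/
def bundleAction (τ : UnitaryRep K V) (a : reducedCStar μ) :
    bundleL2 μ τ →L[ℂ] bundleL2 μ τ :=
  (((a : Lp ℂ 2 μ →L[ℂ] Lp ℂ 2 μ).rTensor V).comp (bundleL2 μ τ).subtypeL).codRestrict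
    (bundleL2 μ τ) (fun x k => by
      have hx := x.2 k
      conv_rhs => rw [ContinuousLinearMap.comp_apply, Submodule.subtypeL_apply, ← hx]
      rw [ContinuousLinearMap.comp_apply, Submodule.subtypeL_apply,
        ContinuousLinearMap.rTensor_apply, ContinuousLinearMap.rTensor_apply]
      rw [LinearMap.rTensor, ← LinearMap.comp_apply, ← LinearMap.comp_apply,
        ← TensorProduct.map_comp, ← TensorProduct.map_comp]
      congr 2
      ext ξ : 1
      exact (reducedCStar_commute μ a k ξ).symm)

theorem coe_bundleAction (τ : UnitaryRep K V) (a : reducedCStar μ) (x : bundleL2 μ τ) :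
    (bundleAction μ τ a x : Lp ℂ 2 μ ⊗[ℂ] V)
      = (a : Lp ℂ 2 μ →L[ℂ] Lp ℂ 2 μ).rTensor V (x : Lp ℂ 2 μ ⊗[ℂ] V) := rfl

theorem bundleAction_star (τ : UnitaryRep K V) (a : reducedCStar μ) (x y : bundleL2 μ τ) :
    inner ℂ (bundleAction μ τ a x) y = inner ℂ x (bundleAction μ τ (star a) y) := by
  rw [Submodule.coe_inner, Submodule.coe_inner, coe_bundleAction, coe_bundleAction]
  generalize (x : Lp ℂ 2 μ ⊗[ℂ] V) = x
  generalize (y : Lp ℂ 2 μ ⊗[ℂ] V) = y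
  induction x using TensorProduct.induction_on with
  | zero => simp
  | add x x' hx hx' => rw [map_add, inner_add_left, inner_add_left, hx, hx']
  | tmul ξ v =>
    induction y using TensorProduct.induction_on with
    | zero => simp
    | add y y' hy hy' => rw [map_add, inner_add_right, inner_add_right, hy, hy']
    | tmul η w =>
      rw [ContinuousLinearMap.rTensor_tmul, ContinuousLinearMap.rTensor_tmul,
        TensorProduct.inner_tmul, TensorProduct.inner_tmul]
      congr 1
      exact (ContinuousLinearMap.adjoint_inner_right _ _ _).symm

theorem bundleL2_complete [FiniteDimensional ℂ V] (τ : UnitaryRep K V) :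
    CompleteSpace (bundleL2 μ τ) := by
  have := tensor_complete (E := Lp ℂ 2 μ) (V := V)
  have hc : IsClosed (bundleL2 μ τ : Set (Lp ℂ 2 μ ⊗[ℂ] V)) := by
    have h : (bundleL2 μ τ : Set (Lp ℂ 2 μ ⊗[ℂ] V)) = ⋂ k : K,
        {x | TensorProduct.mapIsometry (rightTranslation μ (k : G))
          (τ.toHom k).toLinearIsometry x = x} := by
      ext x
      rw [Set.mem_iInter]
      exact Iff.rfl
    rw [h]
    exact isClosed_iInter fun k => isClosed_eq (LinearIsometry.continuous _) continuous_id
  exact hc.completeSpace_coe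

theorem bundleAction_compact_star [FiniteDimensional ℂ V] (τ : UnitaryRep K V)
    (a : reducedCStar μ) (ha : IsCompactOperator (bundleAction μ τ a)) :
    IsCompactOperator (bundleAction μ τ (star a)) := by
  have := bundleL2_complete μ τ
  refine compact_of_adjoint (F := bundleL2 μ τ) (bundleAction μ τ (star a)) (bundleAction μ τ a)
    (fun x y => ?_) ha
  exact bundleAction_star μ τ a x y

theorem bundleAction_add (τ : UnitaryRep K V) (a b : reducedCStar μ) :
    bundleAction μ τ (a + b) = bundleAction μ τ a + bundleAction μ τ b := by
  ext x : 2
  simp [coe_bundleAction]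

theorem bundleAction_zero (τ : UnitaryRep K V) : bundleAction μ τ 0 = 0 := by
  ext x : 2
  simp [coe_bundleAction]

theorem bundleAction_smul (τ : UnitaryRep K V) (c : ℂ) (a : reducedCStar μ) :
    bundleAction μ τ (c • a) = c • bundleAction μ τ a := by
  ext x : 2
  simp [coe_bundleAction]

theorem bundleAction_mul (τ : UnitaryRep K V) (a b : reducedCStar μ) :
    bundleAction μ τ (a * b) = (bundleAction μ τ a).comp (bundleAction μ τ b) := by
  ext x : 2
  simp [coe_bundleAction, LinearMap.rTensor_mul]

/-- The compact ideal `C*_cpt(G)` in `C*_r(G)`: the elements that act as compact operators on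
`L²(G/K; V)` for every finite-dimensional unitary representation `V` of `K`. -/
def compactIdeal (K : Subgroup G) : NonUnitalStarSubalgebra ℂ (reducedCStar μ) where
  carrier := {a | ∀ (V : Type u) [NormedAddCommGroup V] [InnerProductSpace ℂ V]
    [FiniteDimensional ℂ V] (τ : UnitaryRep K V), IsCompactOperator (bundleAction μ τ a)}
  add_mem' {a b} ha hb V _ _ _ τ := by
    rw [bundleAction_add]
    exact (ha V τ).add (hb V τ)
  zero_mem' V _ _ _ τ := by
    rw [bundleAction_zero]
    exact isCompactOperator_zero
  mul_mem' {a b} ha _ V _ _ _ τ := by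
    rw [bundleAction_mul]
    exact (ha V τ).comp_clm _
  smul_mem' c a ha V _ _ _ τ := by
    rw [bundleAction_smul]
    exact (ha V τ).smul c
  star_mem' {a} ha V _ _ _ τ := bundleAction_compact_star μ τ a (ha V τ)

end CompactIdeal

section Identification

variable {G : Type u} [Group G] [TopologicalSpace G] [IsTopologicalGroup G]
  [LocallyCompactSpace G] [MeasurableSpace G] [BorelSpace G]

/-- `ρ` is (unitarily equivalent to) an extension to `A` of the representation `σ` of the
subalgebra `J`. -/
def IsExtension {A : Type u} [NonUnitalRing A] [StarRing A] [Module ℂ A]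
    (J : NonUnitalStarSubalgebra ℂ A) (ρ : IrrRep A) (σ : IrrRep J) : Prop :=
  ∃ U : σ.H ≃ₗᵢ[ℂ] ρ.H, ∀ (a : J) (ξ : σ.H), U (σ.rep a ξ) = ρ.rep (a : A) (U ξ)

/-- The identification of points of the spectrum of an ideal `J` of `C*_r(G)` with irreducible
unitary representations of `G`: `σ` extends to an irreducible representation of `C*_r(G)`, and
the extension is the integrated form of `π`. -/
def CorrespondsTo (μ : Measure G) [μ.IsHaarMeasure] [μ.Regular]
    (J : NonUnitalStarSubalgebra ℂ (reducedCStar μ)) (σ : IrrRep J) (π : IrrUnitaryRep G) : Prop :=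
  ∃ ρ : IrrRep (reducedCStar μ), IsExtension J ρ σ ∧ IsIntegratedForm μ ρ π

end Identification
end

/-!
An irreducible representation `σ` of a closed two-sided ideal `J` extends uniquely to an
irreducible representation `ρ` of `C*_r(G)`, and `ρ` is the integrated form of a unique `π`, so
the point is to decide which `ρ` are non-zero on the compact ideal.

For `φ` a matrix coefficient of a finite-dimensional representation of `K`, write `λ(φ)` for the
corresponding multiplier of `A = C*_r(G)`. Slicing `[L²(G) ⊗ V]^K` by vectors of `V`, and
exchanging left and right translations in products `λ(f) h = f * h`, one sees that `c ∈ A` acts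
by finite rank on every `L²(G/K; V)` if and only if all the corners `c A λ(φ)` are
finite-dimensional. Cutting down by functional calculus, `ρ` is non-zero on the compact ideal if
and only if it is non-zero on such a `c`.

If `ρ(c) ≠ 0` with finite-dimensional corners `c A λ(φ)`, then every `ρ(λ(φ)) = π(φ)` has finite
rank, so `π` is `K`-admissible; then `ρ(A)` contains compact operators, which makes `{ρ}` closed,
and a minimal projection inside a corner makes `{ρ}` open. Conversely, if `{ρ}` is open, the
intersection of the kernels of all the other irreducible representations is an ideal on which
`ρ` is faithful, and admissibility makes its corners finite-dimensional.
-/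

noncomputable section

/-! ### Corners of C*-algebras -/

section IrreducibleRepresentations

theorem exists_linearIsometryEquiv_of_norm_eq {E H H' : Type*} [AddCommGroup E] [Module ℂ E]
    [NormedAddCommGroup H] [InnerProductSpace ℂ H] [CompleteSpace H]
    [NormedAddCommGroup H'] [InnerProductSpace ℂ H'] [CompleteSpace H']
    (e : E →ₗ[ℂ] H) (f : E →ₗ[ℂ] H') (he : DenseRange e) (hf : DenseRange f)
    (h : ∀ x, ‖e x‖ = ‖f x‖) : ∃ U : H ≃ₗᵢ[ℂ] H', ∀ x, U (e x) = f x := by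
  have extend_e : ∀ x, f.extendOfNorm e (e x) = f x := fun x =>
    LinearMap.extendOfNorm_eq he ⟨1, fun x => by simp [h]⟩ x
  have extend_f : ∀ x, e.extendOfNorm f (f x) = e x := fun x =>
    LinearMap.extendOfNorm_eq hf ⟨1, fun x => by simp [h]⟩ x
  have left_inv : ∀ y, e.extendOfNorm f (f.extendOfNorm e y) = y := fun y =>
    congrFun (he.equalizer (g := fun y => e.extendOfNorm f (f.extendOfNorm e y)) (h := id)
      (by fun_prop) continuous_id (by ext x; simp [extend_e, extend_f])) y
  have right_inv : ∀ y, f.extendOfNorm e (e.extendOfNorm f y) = y := fun y =>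
    congrFun (hf.equalizer (g := fun y => f.extendOfNorm e (e.extendOfNorm f y)) (h := id)
      (by fun_prop) continuous_id (by ext x; simp [extend_e, extend_f])) y
  have norm_map : ∀ y, ‖f.extendOfNorm e y‖ = ‖y‖ := fun y =>
    congrFun (he.equalizer (g := fun y => ‖f.extendOfNorm e y‖) (h := fun y => ‖y‖)
      (by fun_prop) continuous_norm (by ext x; simp [extend_e, h])) y
  exact ⟨⟨LinearEquiv.ofLinearMap (f.extendOfNorm e).toLinearMap (e.extendOfNorm f).toLinearMap
    (by ext y; exact right_inv y) (by ext y; exact left_inv y), norm_map⟩, extend_e⟩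

namespace IrrRep

variable {A : Type u} [NonUnitalRing A] [StarRing A] [Module ℂ A] (ρ ρ' : IrrRep A)

/-- The orbit map `a ↦ ρ(a) ξ`. -/
def orbit (ξ : ρ.H) : A →ₗ[ℂ] ρ.H where
  toFun a := ρ.rep a ξ
  map_add' a b := by simp
  map_smul' c a := by simp

theorem orbit_apply (ξ : ρ.H) (a : A) : ρ.orbit ξ a = ρ.rep a ξ := rfl

theorem mul_apply (a b : A) (ξ : ρ.H) : ρ.rep (a * b) ξ = ρ.rep a (ρ.rep b ξ) := by
  rw [map_mul]; rfl

theorem inner_star (a : A) (ξ η : ρ.H) :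
    inner ℂ (ρ.rep (star a) ξ) η = inner ℂ ξ (ρ.rep a η) := by
  rw [map_star, ContinuousLinearMap.star_eq_adjoint, ContinuousLinearMap.adjoint_inner_left]

theorem inner_star_right (a : A) (ξ η : ρ.H) :
    inner ℂ ξ (ρ.rep (star a) η) = inner ℂ (ρ.rep a ξ) η := by
  rw [← inner_star, star_star]

theorem eq_zero_of_forall_apply_eq_zero {ξ : ρ.H} (h : ∀ a, ρ.rep a ξ = 0) : ξ = 0 := by
  let Z : Submodule ℂ ρ.H := ⨅ a, LinearMap.ker (ρ.rep a).toLinearMap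
  have mem_Z : ∀ η, η ∈ Z ↔ ∀ a, ρ.rep a η = 0 := fun η => by simp [Z]
  have hZc : IsClosed (Z : Set ρ.H) := by
    rw [Submodule.coe_iInf]
    exact isClosed_iInter fun a => (ρ.rep a).isClosed_ker
  have hZi : ∀ a, ∀ η ∈ Z, ρ.rep a η ∈ Z := fun a η hη => by
    rw [(mem_Z η).1 hη a]; exact Z.zero_mem
  rcases ρ.irreducible Z hZc hZi with hZ | hZ
  · exact (Submodule.mem_bot ℂ).1 (hZ ▸ (mem_Z ξ).2 h)
  · obtain ⟨a, ha⟩ := ρ.ne_zero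
    exact absurd (ContinuousLinearMap.ext fun η =>
      (mem_Z η).1 (hZ ▸ Submodule.mem_top) a) ha

theorem denseRange_orbit {ξ : ρ.H} (hξ : ξ ≠ 0) : DenseRange (ρ.orbit ξ) := by
  let W := (LinearMap.range (ρ.orbit ξ)).topologicalClosure
  have hW : W = ⊥ ∨ W = ⊤ := by
    refine ρ.irreducible W (Submodule.isClosed_topologicalClosure _) fun a η hη => ?_
    refine map_mem_closure (ρ.rep a).continuous hη ?_
    rintro _ ⟨b, rfl⟩
    exact ⟨a * b, by simp only [orbit_apply, mul_apply]⟩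
  rcases hW with hW | hW
  · refine absurd (ρ.eq_zero_of_forall_apply_eq_zero fun a => ?_) hξ
    have hmem : ρ.orbit ξ a ∈ W := Submodule.le_topologicalClosure _ ⟨a, rfl⟩
    exact (Submodule.mem_bot ℂ).1 (hW ▸ hmem)
  · have hdense := Submodule.dense_iff_topologicalClosure_eq_top.2 hW
    rwa [LinearMap.coe_range] at hdense

theorem exists_apply_ne_zero {a : A} (ha : ρ.rep a ≠ 0) : ∃ ξ, ρ.rep a ξ ≠ 0 := by
  by_contra! h
  exact ha (ContinuousLinearMap.ext h)

theorem exists_clm_apply_ne_zero {E : Type*} [NormedAddCommGroup E] [NormedSpace ℂ E]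
    {T : ρ.H →L[ℂ] E} (hT : T ≠ 0) {ξ : ρ.H} (hξ : ξ ≠ 0) : ∃ a, T (ρ.rep a ξ) ≠ 0 := by
  by_contra! h
  refine hT (ContinuousLinearMap.ext fun η => ?_)
  exact congrFun ((ρ.denseRange_orbit hξ).equalizer T.continuous continuous_const (funext h)) η

theorem exists_mul_mul_ne_zero {a b : A} (ha : ρ.rep a ≠ 0) (hb : ρ.rep b ≠ 0) :
    ∃ c, ρ.rep (a * c * b) ≠ 0 := by
  obtain ⟨ξ, hξ⟩ := ρ.exists_apply_ne_zero hb
  obtain ⟨c, hc⟩ := ρ.exists_clm_apply_ne_zero ha hξ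
  refine ⟨c, fun h => hc ?_⟩
  rw [← ρ.mul_apply, ← ρ.mul_apply, h, zero_apply]

variable {ρ ρ'}

theorem equiv_of_norm_eq {ξ : ρ.H} {η : ρ'.H} (hξ : ξ ≠ 0) (hη : η ≠ 0)
    (h : ∀ a, ‖ρ.rep a ξ‖ = ‖ρ'.rep a η‖) : ρ ≈ ρ' := by
  obtain ⟨U, hU⟩ := exists_linearIsometryEquiv_of_norm_eq (ρ.orbit ξ) (ρ'.orbit η)
    (ρ.denseRange_orbit hξ) (ρ'.denseRange_orbit hη) h
  simp only [orbit_apply] at hU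
  refine ⟨U, fun a ζ => ?_⟩
  refine congrFun ((ρ.denseRange_orbit hξ).equalizer (g := fun ζ => U (ρ.rep a ζ))
    (h := fun ζ => ρ'.rep a (U ζ)) (by fun_prop) (by fun_prop) (funext fun b => ?_)) ζ
  simp only [Function.comp_apply, orbit_apply, hU, ← mul_apply]

theorem exists_norm_sq_eq_of_corner {y : A} {s : A → ℂ} (hy : ρ.rep y ≠ 0)
    (hs : ∀ b, ρ.rep (y * b * y) = s b • ρ.rep y) :
    ∃ ξ : ρ.H, ξ ≠ 0 ∧ ∀ a, ((‖ρ.rep a ξ‖ ^ 2 : ℝ) : ℂ) = s (star y * star a * a) := by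
  obtain ⟨ζ₀, hζ₀⟩ := ρ.exists_apply_ne_zero (a := star y) (by rwa [map_star, star_ne_zero])
  obtain ⟨ζ, hζ⟩ : ∃ ζ, ‖ρ.rep (star y) ζ‖ = 1 :=
    ⟨((‖ρ.rep (star y) ζ₀‖⁻¹ : ℝ) : ℂ) • ζ₀, by
      rw [map_smul, norm_smul, Complex.norm_real, norm_inv, norm_norm,
        inv_mul_cancel₀ (norm_ne_zero_iff.2 hζ₀)]⟩
  have inner_ζ : inner ℂ ζ (ρ.rep y (ρ.rep (star y) ζ)) = (1 : ℂ) := by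
    rw [← inner_star, inner_self_eq_norm_sq_to_K, hζ]; norm_num
  refine ⟨ρ.rep y (ρ.rep (star y) ζ), fun h0 => ?_, fun a => ?_⟩
  · rw [h0, inner_zero_right] at inner_ζ
    exact zero_ne_one inner_ζ
  · set ξ := ρ.rep y (ρ.rep (star y) ζ) with hξ
    calc ((‖ρ.rep a ξ‖ ^ 2 : ℝ) : ℂ)
        = inner ℂ (ρ.rep a ξ) (ρ.rep a ξ) := by
          rw [inner_self_eq_norm_sq_to_K]; push_cast; rfl
      _ = inner ℂ ξ (ρ.rep (star a) (ρ.rep a ξ)) := by rw [inner_star_right]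
      _ = inner ℂ (ρ.rep (star y) ζ) (ρ.rep (star y) (ρ.rep (star a) (ρ.rep a ξ))) := by
          rw [inner_star_right _ y, ← hξ]
      _ = inner ℂ ζ (ρ.rep (y * (star y * star a * a) * y) (ρ.rep (star y) ζ)) := by
          simp only [inner_star, mul_apply, hξ]
      _ = s (star y * star a * a) := by
          rw [hs, smul_apply, inner_smul_right, inner_ζ, mul_one]

theorem equiv_of_corner {y : A} {s : A → ℂ} (hy : ρ.rep y ≠ 0) (hy' : ρ'.rep y ≠ 0)
    (hs : ∀ b, ρ.rep (y * b * y) = s b • ρ.rep y)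
    (hs' : ∀ b, ρ'.rep (y * b * y) = s b • ρ'.rep y) : ρ ≈ ρ' := by
  obtain ⟨ξ, hξ, norm_ξ⟩ := exists_norm_sq_eq_of_corner hy hs
  obtain ⟨η, hη, norm_η⟩ := exists_norm_sq_eq_of_corner hy' hs'
  refine equiv_of_norm_eq hξ hη fun a => ?_
  have norm_sq : ‖ρ.rep a ξ‖ ^ 2 = ‖ρ'.rep a η‖ ^ 2 := by
    exact_mod_cast (norm_ξ a).trans (norm_η a).symm
  exact (sq_eq_sq₀ (norm_nonneg _) (norm_nonneg _)).1 norm_sq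

end IrrRep

end IrreducibleRepresentations

section Corners

theorem exists_ne_zero_eigenvector {X : Type*} [AddCommGroup X] [Module ℂ X]
    [FiniteDimensional ℂ X] {N : Module.End ℂ X} (hN : N ≠ 0)
    (hker : ∀ v, N (N v) = 0 → N v = 0) : ∃ r ≠ (0 : ℂ), ∃ v ≠ 0, N v = r • v := by
  let N' : Module.End ℂ (LinearMap.range N) := N.restrict fun v _ => ⟨v, rfl⟩
  have : Nontrivial (LinearMap.range N) :=
    Submodule.nontrivial_iff_ne_bot.2 fun h => hN (LinearMap.range_eq_bot.1 h)
  obtain ⟨r, hr⟩ := Module.End.exists_eigenvalue N'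
  obtain ⟨⟨_, u, rfl⟩, hu⟩ := hr.exists_hasEigenvector
  have apply_u : N (N u) = r • N u := congrArg Subtype.val hu.apply_eq_smul
  have hu0 : N u ≠ 0 := fun h => hu.2 (Subtype.ext h)
  refine ⟨r, ?_, N u, hu0, apply_u⟩
  rintro rfl
  exact hu0 (hker u (by rw [apply_u, zero_smul]))

variable {A : Type u} [NonUnitalRing A] [StarRing A] [Module ℂ A] [IsScalarTower ℂ A A]
  [SMulCommClass ℂ A A] {B : Type*} [NonUnitalCStarAlgebra B]

/-- The linear map `a ↦ θ(t a d)`, whose range is the corner of `θ(A)` cut out by `t` and `d`. -/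
def cornerMap (θ : A →⋆ₙₐ[ℂ] B) (t d : A) : A →ₗ[ℂ] B where
  toFun a := θ (t * a * d)
  map_add' a b := by rw [mul_add, add_mul, map_add]
  map_smul' c a := by rw [mul_smul_comm, smul_mul_assoc, map_smul]; rfl

theorem cornerMap_apply (θ : A →⋆ₙₐ[ℂ] B) (t d a : A) : cornerMap θ t d a = θ (t * a * d) := rfl

/-- Left multiplication by `θ(t u)`, as an endomorphism of the corner `θ(t A d)`. -/
def cornerEnd (θ : A →⋆ₙₐ[ℂ] B) (t d u : A) :
    Module.End ℂ (LinearMap.range (cornerMap θ t d)) :=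
  (LinearMap.mulLeft ℂ (θ (t * u))).restrict (by
    rintro _ ⟨a, rfl⟩
    exact ⟨u * t * a, by
      simp only [cornerMap_apply, LinearMap.mulLeft_apply, ← map_mul, mul_assoc]⟩)

theorem coe_cornerEnd (θ : A →⋆ₙₐ[ℂ] B) (t d u : A) (v : LinearMap.range (cornerMap θ t d)) :
    (cornerEnd θ t d u v : B) = θ (t * u) * v := rfl

theorem range_cornerMap_sub_smul (θ : A →⋆ₙₐ[ℂ] B) (t d u : A) (r : ℂ) :
    LinearMap.range (cornerMap θ (t * u * t - r • t) d)
      = (LinearMap.range (cornerEnd θ t d u - r • 1)).map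
        (LinearMap.range (cornerMap θ t d)).subtype := by
  have apply_eq : ∀ a, cornerMap θ (t * u * t - r • t) d a
      = (cornerEnd θ t d u - r • 1) ⟨cornerMap θ t d a, ⟨a, rfl⟩⟩ := fun a => by
    simp [coe_cornerEnd, cornerMap_apply, sub_mul, mul_assoc, smul_mul_assoc]
  ext v
  constructor
  · rintro ⟨a, rfl⟩
    exact ⟨_, ⟨⟨_, a, rfl⟩, rfl⟩, (apply_eq a).symm⟩
  · rintro ⟨_, ⟨⟨_, a, rfl⟩, rfl⟩, rfl⟩
    exact ⟨a, apply_eq a⟩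

theorem finrank_range_cornerMap_sub_smul_lt {θ : A →⋆ₙₐ[ℂ] B} {t d u : A} {r : ℂ}
    [FiniteDimensional ℂ (LinearMap.range (cornerMap θ t d))]
    (hr : (cornerEnd θ t d u).HasEigenvalue r) :
    Module.finrank ℂ (LinearMap.range (cornerMap θ (t * u * t - r • t) d)) <
      Module.finrank ℂ (LinearMap.range (cornerMap θ t d)) := by
  rw [range_cornerMap_sub_smul, (Submodule.equivMapOfInjective _
    (Submodule.injective_subtype _) _).symm.finrank_eq]
  have hker : 0 < Module.finrank ℂ (LinearMap.ker (cornerEnd θ t d u - r • 1)) :=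
    Module.finrank_pos_iff.2 (Submodule.nontrivial_iff_ne_bot.2
      (Module.End.eigenspace_def (f := cornerEnd θ t d u) (μ := r) ▸ hr))
  have := LinearMap.finrank_range_add_finrank_ker (cornerEnd θ t d u - r • 1)
  omega

namespace IrrRep

/-- `θ(t A d)` is finite-dimensional, `x(t) ≠ 0`, and no corner `θ(t' A d)` with these two
properties has a smaller dimension. -/
structure IsMinimalCorner (x : IrrRep A) (θ : A →⋆ₙₐ[ℂ] B) (t d : A) : Prop where
  apply_ne_zero : x.rep t ≠ 0
  finiteDimensional : FiniteDimensional ℂ (LinearMap.range (cornerMap θ t d))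
  finrank_le : ∀ t', x.rep t' ≠ 0 → FiniteDimensional ℂ (LinearMap.range (cornerMap θ t' d)) →
    Module.finrank ℂ (LinearMap.range (cornerMap θ t d))
      ≤ Module.finrank ℂ (LinearMap.range (cornerMap θ t' d))

variable {x : IrrRep A} {θ : A →⋆ₙₐ[ℂ] B} {t d : A}

theorem exists_isMinimalCorner (ht : x.rep t ≠ 0)
    (hfin : FiniteDimensional ℂ (LinearMap.range (cornerMap θ t d))) :
    ∃ t', x.IsMinimalCorner θ t' d := by
  classical
  have hex : ∃ n, ∃ t, x.rep t ≠ 0 ∧ FiniteDimensional ℂ (LinearMap.range (cornerMap θ t d)) ∧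
      Module.finrank ℂ (LinearMap.range (cornerMap θ t d)) = n := ⟨_, t, ht, hfin, rfl⟩
  obtain ⟨t', ht', hfin', hn⟩ := Nat.find_spec hex
  exact ⟨t', ht', hfin', fun t'' h1 h2 => hn ▸ Nat.find_min' hex ⟨t'', h1, h2, rfl⟩⟩

namespace IsMinimalCorner

theorem apply_eq_smul (h : x.IsMinimalCorner θ t d) {u : A} {r : ℂ}
    (hr : (cornerEnd θ t d u).HasEigenvalue r) : x.rep (t * u * t) = r • x.rep t := by
  have := h.finiteDimensional
  by_contra hne
  have hfin : FiniteDimensional ℂ (LinearMap.range (cornerMap θ (t * u * t - r • t) d)) := by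
    rw [range_cornerMap_sub_smul]
    infer_instance
  refine absurd (h.finrank_le (t * u * t - r • t) ?_ hfin)
    (not_le.2 (finrank_range_cornerMap_sub_smul_lt hr))
  rwa [map_sub, map_smul, sub_ne_zero]

/-- Otherwise `w = y y*` with `y = t z d` would act on the corner as a nonzero self-adjoint
operator, whose nonzero eigenvalue `r` gives `0 = x(w t) = r x(t)`. -/
theorem eq_zero_of_apply_eq_zero (h : x.IsMinimalCorner θ t d) {z : A}
    (hz : x.rep (t * z * d) = 0) : θ (t * z * d) = 0 := by
  have := h.finiteDimensional
  by_contra hne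
  set y := t * z * d with hy
  let N := cornerEnd θ t d (z * d * star y)
  have coe_N : ∀ v, (N v : B) = θ y * star (θ y) * v := fun v => by
    simp only [N, coe_cornerEnd, hy, map_mul, map_star, mul_assoc]
  have hN : N ≠ 0 := fun hN0 => by
    have hyy : θ y * star (θ y) * θ y = 0 := by
      rw [← coe_N ⟨θ y, z, rfl⟩, hN0]; rfl
    have hsq : star (star (θ y) * θ y) * (star (θ y) * θ y) = 0 := by
      rw [star_mul, star_star, mul_assoc, ← mul_assoc (θ y), hyy, mul_zero]
    exact hne (CStarRing.star_mul_self_eq_zero_iff _ |>.1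
      (CStarRing.star_mul_self_eq_zero_iff _ |>.1 hsq))
  have hker : ∀ v, N (N v) = 0 → N v = 0 := fun v hv => by
    refine Subtype.ext (CStarRing.star_mul_self_eq_zero_iff _ |>.1 ?_)
    have hv' : θ y * star (θ y) * (θ y * star (θ y) * v) = 0 := by
      rw [← coe_N, ← coe_N, hv]; rfl
    rw [coe_N, star_mul, star_mul, star_star, mul_assoc, hv', mul_zero]
  obtain ⟨r, hr0, v, hv0, hv⟩ := exists_ne_zero_eigenvector hN hker
  have hr := h.apply_eq_smul (Module.End.hasEigenvalue_of_hasEigenvector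
    (Module.End.hasEigenvector_iff.2 ⟨Module.End.mem_eigenspace_iff.2 hv, hv0⟩))
  have hyt : t * (z * d * star y) * t = y * (star y * t) := by simp only [hy, mul_assoc]
  rw [hyt, map_mul, hz, zero_mul] at hr
  exact smul_ne_zero hr0 h.apply_ne_zero hr.symm

theorem exists_mul_eq_smul (h : x.IsMinimalCorner θ t d)
    [Nontrivial (LinearMap.range (cornerMap θ t d))] (u : A) :
    ∃ r : ℂ, ∀ z, θ (t * u * t * z * d) = r • θ (t * z * d) := by
  have := h.finiteDimensional
  obtain ⟨r, hr⟩ := Module.End.exists_eigenvalue (cornerEnd θ t d u)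
  refine ⟨r, fun z => ?_⟩
  have hsub : t * (u * t * z - r • z) * d = t * u * t * z * d - r • (t * z * d) := by
    simp only [mul_sub, sub_mul, mul_assoc, mul_smul_comm, smul_mul_assoc]
  have hx : x.rep (t * (u * t * z - r • z) * d) = 0 := by
    rw [hsub, map_sub, map_smul, mul_assoc _ z, mul_assoc t z, map_mul, map_mul x.rep t,
      h.apply_eq_smul hr, smul_mul_assoc, sub_self]
  rw [← sub_eq_zero, ← map_smul, ← map_sub, ← hsub, h.eq_zero_of_apply_eq_zero hx]

end IsMinimalCorner

theorem exists_rankOne_corner (hθ : ∀ a, θ a = 0 → x.rep a = 0) (ht : x.rep t ≠ 0)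
    (hd : x.rep d ≠ 0) (hfin : FiniteDimensional ℂ (LinearMap.range (cornerMap θ t d))) :
    ∃ (y : A) (s : A → ℂ), x.rep y ≠ 0 ∧ ∀ b, θ (y * b * y) = s b • θ y := by
  obtain ⟨t', hmin⟩ := exists_isMinimalCorner ht hfin
  obtain ⟨z, hz⟩ := x.exists_mul_mul_ne_zero hmin.apply_ne_zero hd
  have : Nontrivial (LinearMap.range (cornerMap θ t' d)) :=
    Submodule.nontrivial_iff_ne_bot.2 ((Submodule.ne_bot_iff _).2
      ⟨_, ⟨z, rfl⟩, fun h => hz (hθ _ h)⟩)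
  choose s hs using hmin.exists_mul_eq_smul
  refine ⟨t' * z * d, fun b => s (z * d * b), hz, fun b => ?_⟩
  rw [← hs]
  simp only [mul_assoc]

theorem equiv_of_ker_le {ρ : IrrRep A} (h : ρ.ker ≤ x.ker) (ht : x.rep t ≠ 0) (hd : x.rep d ≠ 0)
    (hfin : FiniteDimensional ℂ (LinearMap.range (cornerMap ρ.rep t d))) : ρ ≈ x := by
  have hker : ∀ a, ρ.rep a = 0 → x.rep a = 0 := fun a ha =>
    (TwoSidedIdeal.mem_ker _).1 (h ((TwoSidedIdeal.mem_ker _).2 ha))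
  obtain ⟨y, s, hy, hs⟩ := exists_rankOne_corner hker ht hd hfin
  refine equiv_of_corner (fun h0 => hy (hker _ h0)) hy hs fun b => ?_
  rw [← sub_eq_zero, ← map_smul, ← map_sub]
  apply hker
  rw [map_sub, map_smul, hs, sub_self]

theorem exists_isolating_element {A : Type u} [NonUnitalCStarAlgebra A] {ρ : IrrRep A} {t d : A}
    (ht : ρ.rep t ≠ 0) (hd : ρ.rep d ≠ 0)
    (hfin : FiniteDimensional ℂ (LinearMap.range (cornerMap (NonUnitalStarAlgHom.id ℂ A) t d))) :
    ∃ y, ρ.rep y ≠ 0 ∧ ∀ x : IrrRep A, x.rep y ≠ 0 → ρ ≈ x := by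
  obtain ⟨y, s, hy, hs⟩ := exists_rankOne_corner (x := ρ)
    (fun a (ha : a = 0) => by rw [ha, map_zero]) ht hd hfin
  have hs : ∀ b, y * b * y = s b • y := hs
  exact ⟨y, hy, fun x hx => equiv_of_corner hy hx (fun b => by rw [hs, map_smul])
    fun b => by rw [hs, map_smul]⟩

end IrrRep

end Corners

/-! ### Idealizers and ideals -/

section Idealizer

variable {B : Type u} [NonUnitalCStarAlgebra B] {S : NonUnitalStarSubalgebra ℂ B}

/-- The idealizer of a `*`-subalgebra `S` of `B`: the elements of `B` that multiply `S` into itself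
from both sides. It is the largest `*`-subalgebra of `B` in which `S` is an ideal. -/
def idealizer (S : NonUnitalStarSubalgebra ℂ B) : NonUnitalStarSubalgebra ℂ B where
  carrier := {T | ∀ a ∈ S, T * a ∈ S ∧ a * T ∈ S}
  add_mem' hT hT' a ha := by
    rw [add_mul, mul_add]
    exact ⟨add_mem (hT a ha).1 (hT' a ha).1, add_mem (hT a ha).2 (hT' a ha).2⟩
  zero_mem' a _ := by simp
  mul_mem' {T T'} hT hT' a ha := by
    rw [mul_assoc, ← mul_assoc a]
    exact ⟨(hT _ (hT' a ha).1).1, (hT' _ (hT a ha).2).2⟩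
  smul_mem' c T hT a ha := by
    rw [smul_mul_assoc, mul_smul_comm]
    exact ⟨SMulMemClass.smul_mem c (hT a ha).1, SMulMemClass.smul_mem c (hT a ha).2⟩
  star_mem' {T} hT a ha := by
    have h := hT (star a) (star_mem ha)
    exact ⟨by simpa using star_mem h.2, by simpa using star_mem h.1⟩

theorem le_idealizer : S ≤ idealizer S := fun _ hT _ ha => ⟨mul_mem hT ha, mul_mem ha hT⟩

/-- Left multiplication by an element of the idealizer of `S`, as a linear map on `S`. -/
def idealizerMulLeft (T : idealizer S) : S →ₗ[ℂ] S where
  toFun a := ⟨T * a, (T.2 a a.2).1⟩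
  map_add' _ _ := Subtype.ext (mul_add _ _ _)
  map_smul' _ _ := Subtype.ext (mul_smul_comm _ _ _)

theorem coe_idealizerMulLeft (T : idealizer S) (a : S) :
    (idealizerMulLeft T a : B) = T * a := rfl

theorem idealizerMulLeft_mul (T : idealizer S) (a b : S) :
    idealizerMulLeft T (a * b) = idealizerMulLeft T a * b :=
  Subtype.ext (mul_assoc _ _ _).symm

theorem star_mul_idealizerMulLeft (T : idealizer S) (a b : S) :
    star a * idealizerMulLeft T b = star (idealizerMulLeft (star T) a) * b :=
  Subtype.ext (by simp [coe_idealizerMulLeft, mul_assoc])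

namespace IrrRep

theorem exists_ne_zero {A : Type u} [NonUnitalRing A] [StarRing A] [Module ℂ A] (ρ : IrrRep A) :
    ∃ ξ : ρ.H, ξ ≠ 0 := by
  obtain ⟨a, ha⟩ := ρ.ne_zero
  obtain ⟨ξ, hξ⟩ := ρ.exists_apply_ne_zero ha
  exact ⟨_, hξ⟩

theorem continuous_rep {A : Type u} [NonUnitalCStarAlgebra A] (ρ : IrrRep A) :
    Continuous ρ.rep :=
  AddMonoidHomClass.continuous_of_bound ρ.rep 1 fun a => by
    simpa using NonUnitalStarAlgHom.norm_apply_le ρ.rep a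

theorem clm_ext {A : Type u} [NonUnitalRing A] [StarRing A] [Module ℂ A] {ρ : IrrRep A}
    {E : Type*} [NormedAddCommGroup E] [NormedSpace ℂ E] {T T' : ρ.H →L[ℂ] E}
    (h : ∀ a η, T (ρ.rep a η) = T' (ρ.rep a η)) : T = T' := by
  obtain ⟨ξ, hξ⟩ := ρ.exists_ne_zero
  exact ContinuousLinearMap.ext fun η => congrFun ((ρ.denseRange_orbit hξ).equalizer
    T.continuous T'.continuous (funext fun a => h a ξ)) η

variable [IsClosed (S : Set B)] (σ : IrrRep S)

/-- With `e` an approximate unit of `S`, `σ(T e a) = σ(T e) σ(a)` converges to `σ(T a)`. -/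
theorem norm_idealizerMulLeft_apply_le (T : idealizer S) (a : S) (ξ : σ.H) :
    ‖σ.rep (idealizerMulLeft T a) ξ‖ ≤ ‖T‖ * ‖σ.rep a ξ‖ := by
  let _ := CStarAlgebra.spectralOrder S
  have _ := CStarAlgebra.spectralOrderedRing S
  have hunit := CStarAlgebra.increasingApproximateUnit S
  have hcont : Continuous fun b : S => ‖σ.rep (idealizerMulLeft T b) ξ‖ := by
    have hT : Continuous (idealizerMulLeft T) :=
      Continuous.subtype_mk (continuous_const.mul continuous_subtype_val) _
    exact ((σ.continuous_rep.comp hT).clm_apply continuous_const).norm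
  refine le_of_tendsto ((hcont.tendsto a).comp (hunit.tendsto_mul_right a)) ?_
  filter_upwards [hunit.eventually_norm] with e he
  have norm_Te : ‖σ.rep (idealizerMulLeft T e)‖ ≤ ‖T‖ := calc
    _ ≤ ‖(T : B) * (e : B)‖ := NonUnitalStarAlgHom.norm_apply_le σ.rep _
    _ ≤ ‖T‖ * ‖e‖ := norm_mul_le _ _
    _ ≤ ‖T‖ := mul_le_of_le_one_right (norm_nonneg _) he
  calc ‖σ.rep (idealizerMulLeft T (e * a)) ξ‖
      = ‖σ.rep (idealizerMulLeft T e) (σ.rep a ξ)‖ := by rw [idealizerMulLeft_mul, σ.mul_apply]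
    _ ≤ ‖σ.rep (idealizerMulLeft T e)‖ * ‖σ.rep a ξ‖ := ContinuousLinearMap.le_opNorm _ _
    _ ≤ ‖T‖ * ‖σ.rep a ξ‖ := by gcongr

theorem exists_clm_idealizer (T : idealizer S) :
    ∃ T' : σ.H →L[ℂ] σ.H, ∀ a η, T' (σ.rep a η) = σ.rep (idealizerMulLeft T a) η := by
  obtain ⟨ξ, hξ⟩ := σ.exists_ne_zero
  let T' := ((σ.orbit ξ).comp (idealizerMulLeft T)).extendOfNorm (σ.orbit ξ)
  have hT' : ∀ a, T' (σ.rep a ξ) = σ.rep (idealizerMulLeft T a) ξ := fun a =>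
    LinearMap.extendOfNorm_eq (σ.denseRange_orbit hξ)
      ⟨‖T‖, fun a => σ.norm_idealizerMulLeft_apply_le T a ξ⟩ a
  refine ⟨T', fun a η => ?_⟩
  refine congrFun ((σ.denseRange_orbit hξ).equalizer (g := fun η => T' (σ.rep a η))
    (h := fun η => σ.rep (idealizerMulLeft T a) η) (by fun_prop) (by fun_prop)
    (funext fun b => ?_)) η
  simp only [Function.comp_apply, orbit_apply, ← σ.mul_apply, hT', idealizerMulLeft_mul]

/-- The action on an irreducible representation of `S` of an element of the idealizer of `S`,
characterized by `idealizerClm_apply`. -/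
def idealizerClm (T : idealizer S) : σ.H →L[ℂ] σ.H :=
  (σ.exists_clm_idealizer T).choose

theorem idealizerClm_apply (T : idealizer S) (a : S) (η : σ.H) :
    σ.idealizerClm T (σ.rep a η) = σ.rep (idealizerMulLeft T a) η :=
  (σ.exists_clm_idealizer T).choose_spec a η

theorem idealizerClm_star (T : idealizer S) :
    σ.idealizerClm (star T) = star (σ.idealizerClm T) := clm_ext fun a η => by
  refine ext_inner_right ℂ fun ζ => ?_
  refine DFunLike.congr_fun (clm_ext (ρ := σ) (T := innerSL ℂ _) (T' := innerSL ℂ _)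
    fun b ζ => ?_) ζ
  rw [innerSL_apply_apply, innerSL_apply_apply, ContinuousLinearMap.star_eq_adjoint,
    ContinuousLinearMap.adjoint_inner_left, idealizerClm_apply, idealizerClm_apply,
    ← σ.inner_star_right, ← σ.inner_star_right, ← σ.mul_apply, ← σ.mul_apply,
    star_mul_idealizerMulLeft]

/-- The extension to the idealizer of an irreducible representation of a closed `*`-subalgebra. -/
def idealizerRep : idealizer S →⋆ₙₐ[ℂ] (σ.H →L[ℂ] σ.H) where
  toFun := σ.idealizerClm
  map_smul' c T := clm_ext fun a η => by
    have h : idealizerMulLeft (c • T) a = c • idealizerMulLeft T a :=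
      Subtype.ext (smul_mul_assoc _ _ _)
    simp [idealizerClm_apply, h]
  map_zero' := clm_ext fun a η => by
    have h : idealizerMulLeft (0 : idealizer S) a = 0 := Subtype.ext (zero_mul _)
    simp [idealizerClm_apply, h]
  map_add' T T' := clm_ext fun a η => by
    have h : idealizerMulLeft (T + T') a = idealizerMulLeft T a + idealizerMulLeft T' a :=
      Subtype.ext (add_mul _ _ _)
    simp [idealizerClm_apply, h]
  map_mul' T T' := clm_ext fun a η => by
    have h : idealizerMulLeft (T * T') a = idealizerMulLeft T (idealizerMulLeft T' a) :=
      Subtype.ext (mul_assoc _ _ _)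
    simp [idealizerClm_apply, h]
  map_star' := σ.idealizerClm_star

theorem idealizerRep_apply (T : idealizer S) (a : S) (η : σ.H) :
    σ.idealizerRep T (σ.rep a η) = σ.rep (idealizerMulLeft T a) η :=
  σ.idealizerClm_apply T a η

theorem idealizerRep_of_mem (a : S) : σ.idealizerRep ⟨a, le_idealizer a.2⟩ = σ.rep a :=
  clm_ext fun b η => by rw [idealizerRep_apply, ← σ.mul_apply]; rfl

end IrrRep

end Idealizer

section Ideals

variable {A : Type u} [NonUnitalCStarAlgebra A] {J : NonUnitalStarSubalgebra ℂ A}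

/-- A `*`-subalgebra that is a left, hence by taking adjoints a two-sided, ideal. -/
def IsStarIdeal (J : NonUnitalStarSubalgebra ℂ A) : Prop :=
  ∀ a : A, ∀ j ∈ J, a * j ∈ J

theorem IsStarIdeal.mul_mem_right (hJ : IsStarIdeal J) (a : A) {j : A} (hj : j ∈ J) :
    j * a ∈ J := by
  simpa using star_mem (hJ (star a) (star j) (star_mem hj))

theorem IsStarIdeal.mem_idealizer (hJ : IsStarIdeal J) (a : A) : a ∈ idealizer J :=
  fun j hj => ⟨hJ a j hj, hJ.mul_mem_right a hj⟩

namespace IrrRep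

/-- The restriction of an irreducible representation to an ideal on which it does not vanish. -/
def restrictIdeal (ρ : IrrRep A) (hJ : IsStarIdeal J) (h : ∃ j ∈ J, ρ.rep j ≠ 0) : IrrRep J where
  H := ρ.H
  rep := ρ.rep.comp (NonUnitalStarSubalgebraClass.subtype J)
  ne_zero := by
    obtain ⟨j, hj, h⟩ := h
    exact ⟨⟨j, hj⟩, h⟩
  irreducible W hW hinv := by
    refine or_iff_not_imp_left.2 fun hne => eq_top_iff.2 fun v _ => ?_
    obtain ⟨w, hw, hw0⟩ := (Submodule.ne_bot_iff _).1 hne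
    obtain ⟨j, hj, hj0⟩ := h
    obtain ⟨a, ha⟩ := ρ.exists_clm_apply_ne_zero hj0 hw0
    refine hW.closure_subset_iff.2 ?_ (ρ.denseRange_orbit ha v)
    rintro _ ⟨b, rfl⟩
    rw [ρ.orbit_apply, ← ρ.mul_apply, ← ρ.mul_apply]
    exact hinv ⟨b * j * a, hJ.mul_mem_right a (hJ b j hj)⟩ w hw

theorem isExtension_restrictIdeal (ρ : IrrRep A) (hJ : IsStarIdeal J)
    (h : ∃ j ∈ J, ρ.rep j ≠ 0) : IsExtension J ρ (ρ.restrictIdeal hJ h) :=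
  ⟨LinearIsometryEquiv.refl ℂ ρ.H, fun _ _ => rfl⟩

theorem exists_isExtension [IsClosed (J : Set A)] (σ : IrrRep J) (hJ : IsStarIdeal J) :
    ∃ ρ : IrrRep A, IsExtension J ρ σ := by
  let toIdealizer : A →⋆ₙₐ[ℂ] idealizer J :=
    NonUnitalStarAlgHom.codRestrict (NonUnitalStarAlgHom.id ℂ A) _ hJ.mem_idealizer
  let rep := σ.idealizerRep.comp toIdealizer
  have rep_coe : ∀ j : J, rep j = σ.rep j := σ.idealizerRep_of_mem
  refine ⟨⟨σ.H, rep, ?_, fun W hW h => σ.irreducible W hW fun j η hη => ?_⟩,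
    LinearIsometryEquiv.refl ℂ σ.H, fun j η => ?_⟩
  · obtain ⟨j, hj⟩ := σ.ne_zero
    exact ⟨j, (rep_coe j).symm ▸ hj⟩
  · exact rep_coe j ▸ h j η hη
  · exact (DFunLike.congr_fun (rep_coe j) η).symm

end IrrRep

namespace IsExtension

variable {ρ ρ' : IrrRep A} {σ σ' : IrrRep J}

theorem exists_apply_ne_zero (h : IsExtension J ρ σ) : ∃ j ∈ J, ρ.rep j ≠ 0 := by
  obtain ⟨U, hU⟩ := h
  obtain ⟨j, hj⟩ := σ.ne_zero
  obtain ⟨ξ, hξ⟩ := σ.exists_apply_ne_zero hj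
  refine ⟨j, j.2, fun h0 => hξ (U.map_eq_zero_iff.1 ?_)⟩
  rw [hU, h0, zero_apply]

theorem congr_left (h : IsExtension J ρ σ) (hρ : ρ ≈ ρ') : IsExtension J ρ' σ := by
  obtain ⟨U, hU⟩ := h
  obtain ⟨W, hW⟩ := hρ
  exact ⟨U.trans W, fun a ξ => by simp [hU, hW]⟩

theorem congr_right (h : IsExtension J ρ σ) (hσ : σ ≈ σ') : IsExtension J ρ σ' := by
  obtain ⟨U, hU⟩ := h
  obtain ⟨W, hW⟩ := Setoid.symm hσ
  exact ⟨W.trans U, fun a ξ => by simp [hU, hW]⟩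

theorem equiv_right (h : IsExtension J ρ σ) (h' : IsExtension J ρ σ') : σ ≈ σ' := by
  obtain ⟨U, hU⟩ := h
  obtain ⟨W, hW⟩ := h'
  refine ⟨U.trans W.symm, fun a ξ => ?_⟩
  rw [LinearIsometryEquiv.trans_apply, LinearIsometryEquiv.symm_apply_eq, hU, hW]
  simp

theorem equiv_left (hJ : IsStarIdeal J) (h : IsExtension J ρ σ) (h' : IsExtension J ρ' σ) :
    ρ ≈ ρ' := by
  obtain ⟨U, hU⟩ := h
  obtain ⟨W, hW⟩ := h'
  obtain ⟨j, hj⟩ := σ.ne_zero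
  obtain ⟨ξ, hξ⟩ := σ.exists_apply_ne_zero hj
  have hUξ : ρ.rep (j : A) (U ξ) ≠ 0 := by rwa [← hU, U.map_eq_zero_iff.ne]
  have hWξ : ρ'.rep (j : A) (W ξ) ≠ 0 := by rwa [← hW, W.map_eq_zero_iff.ne]
  refine IrrRep.equiv_of_norm_eq hUξ hWξ fun a => ?_
  have hUa := hU ⟨a * j, hJ a j j.2⟩ ξ
  have hWa := hW ⟨a * j, hJ a j j.2⟩ ξ
  rw [← ρ.mul_apply, ← ρ'.mul_apply, ← hUa, ← hWa, U.norm_map, W.norm_map]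

end IsExtension

end Ideals

section Truncation

/-- The functional calculus for `c` uses a function that vanishes on `[-ε, ε]`, and that for `g`
one that is `1 / t` outside of `[-ε, ε]`. -/
theorem exists_truncation_of_isSelfAdjoint {A : Type*} [NonUnitalCStarAlgebra A] {b : A}
    (hb : IsSelfAdjoint b) {ε : ℝ} (hε : 0 < ε) :
    ∃ c g : A, ‖c - b‖ ≤ ε ∧ g * b * c = c ∧ ∀ x, Commute b x → Commute c x := by
  let f : ℝ → ℝ := fun t => t - max (-ε) (min ε t)
  let g : ℝ → ℝ := fun t => t / max (t ^ 2) (ε ^ 2)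
  have hf : Continuous f := by fun_prop
  have hg : Continuous g := Continuous.div (by fun_prop) (by fun_prop) fun t =>
    (lt_max_of_lt_right (by positivity)).ne'
  have hf0 : f 0 = 0 := by simp [f, hε.le]
  have hg0 : g 0 = 0 := by simp [g]
  have g_mul_f : ∀ t, g t * t * f t = f t := fun t => by
    by_cases ht : |t| ≤ ε
    · rw [abs_le] at ht
      simp only [f, min_eq_right ht.2, max_eq_right ht.1, sub_self, mul_zero]
    · have hεt : ε ^ 2 ≤ t ^ 2 := by
        rw [← sq_abs t]
        exact pow_le_pow_left₀ hε.le (not_le.1 ht).le 2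
      have ht0 : t ≠ 0 := by
        rintro rfl
        simp [hε.le] at ht
      simp only [g, max_eq_left hεt, div_mul_eq_mul_div, ← sq, div_self (pow_ne_zero 2 ht0),
        one_mul]
  refine ⟨cfcₙ f b, cfcₙ g b, ?_, ?_, fun x hx => hx.cfcₙ_real f⟩
  · nth_rw 2 [← cfcₙ_id ℝ b]
    rw [← cfcₙ_sub f id b hf.continuousOn hf0 continuousOn_id rfl]
    refine norm_cfcₙ_le fun t _ => ?_
    simp only [f, id, sub_sub_cancel_left, norm_neg, Real.norm_eq_abs, abs_le]
    exact ⟨le_max_left _ _, max_le (by linarith) (min_le_left _ _)⟩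
  · nth_rw 2 [← cfcₙ_id ℝ b]
    rw [← cfcₙ_mul g id b hg.continuousOn hg0 continuousOn_id rfl,
      ← cfcₙ_mul (fun t => g t * id t) f b (hg.mul continuous_id).continuousOn (by simp [hg0])
        hf.continuousOn hf0]
    exact congrArg (cfcₙ · b) (funext g_mul_f)

theorem finiteDimensional_range_of_compact_fixing {H : Type*} [NormedAddCommGroup H]
    [NormedSpace ℂ H] {E : Type*} [AddCommGroup E] [Module ℂ E]
    {T : H →L[ℂ] H} (hT : IsCompactOperator T) {S : E →ₗ[ℂ] H} (h : ∀ x, T (S x) = S x) :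
    FiniteDimensional ℂ (LinearMap.range S) := by
  let F : Submodule ℂ H := LinearMap.ker (T - ContinuousLinearMap.id ℂ H).toLinearMap
  have hF : IsClosed (F : Set H) := (T - ContinuousLinearMap.id ℂ H).isClosed_ker
  have hfix : ∀ v ∈ F, T v = v := fun v hv => sub_eq_zero.1 hv
  have hTF : ∀ v ∈ F, T.toLinearMap v ∈ F := fun v hv => (hfix v hv).symm ▸ hv
  have restrict_eq : (T.toLinearMap.restrict hTF : F → F) = id := by
    ext v
    exact hfix v v.2
  have hid := hT.restrict hTF hF
  rw [restrict_eq] at hid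
  have := FiniteDimensional.of_isCompactOperator_id (𝕜 := ℂ) hid
  refine Submodule.finiteDimensional_of_le (S₂ := F) ?_
  rintro _ ⟨x, rfl⟩
  exact sub_eq_zero.2 (h x)

end Truncation

/-! ### Pure states and the GNS construction -/

section PureStates

open scoped ComplexOrder

section GNS

variable {A : Type u} [NonUnitalCStarAlgebra A] [PartialOrder A] [StarOrderedRing A]
  (f : A →ₚ[ℂ] ℂ)

/-- The canonical map from `A` to the Hilbert space of its GNS representation. -/
def gnsMap : A →ₗ[ℂ] f.GNS :=
  (UniformSpace.Completion.toComplₗᵢ (𝕜 := ℂ) (E := f.PreGNS)).toLinearMap.comp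
    f.toPreGNS.toLinearMap

theorem denseRange_gnsMap : DenseRange (gnsMap f) :=
  (UniformSpace.Completion.denseRange_coe (α := f.PreGNS)).comp
    f.toPreGNS.surjective.denseRange (UniformSpace.Completion.continuous_coe _)

theorem inner_gnsMap (a b : A) : inner ℂ (gnsMap f a) (gnsMap f b) = f (star a * b) :=
  UniformSpace.Completion.inner_coe _ _

theorem gnsNonUnitalStarAlgHom_apply_gnsMap (a b : A) :
    f.gnsNonUnitalStarAlgHom a (gnsMap f b) = gnsMap f (a * b) :=
  f.gnsNonUnitalStarAlgHom_apply_coe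

variable {f}

theorem norm_gnsMap_le (hf : ∀ a, ‖f a‖ ≤ ‖a‖) (a : A) : ‖gnsMap f a‖ ≤ ‖a‖ := by
  refine le_of_sq_le_sq ?_ (norm_nonneg a)
  rw [← inner_self_eq_norm_sq (𝕜 := ℂ), inner_gnsMap]
  calc RCLike.re (f (star a * a)) ≤ ‖f (star a * a)‖ := Complex.re_le_norm _
    _ ≤ ‖star a * a‖ := hf _
    _ = ‖a‖ ^ 2 := by rw [CStarRing.norm_star_mul_self, sq]

/-- With `e` an approximate unit, `f(ea)` is the inner product of the images of `e*` and `a`. -/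
theorem norm_apply_le_norm_gnsMap (hf : ∀ a, ‖f a‖ ≤ ‖a‖) (a : A) : ‖f a‖ ≤ ‖gnsMap f a‖ := by
  have hunit := CStarAlgebra.increasingApproximateUnit A
  have hcont : Continuous f :=
    AddMonoidHomClass.continuous_of_bound f 1 fun x => by simpa using hf x
  refine le_of_tendsto ((hcont.tendsto a).norm.comp (hunit.tendsto_mul_right a)) ?_
  filter_upwards [hunit.eventually_norm] with e he
  calc ‖f (e * a)‖ = ‖inner ℂ (gnsMap f (star e)) (gnsMap f a)‖ := by
        rw [inner_gnsMap, star_star]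
    _ ≤ ‖gnsMap f (star e)‖ * ‖gnsMap f a‖ := norm_inner_le_norm _ _
    _ ≤ ‖gnsMap f a‖ := mul_le_of_le_one_left (norm_nonneg _) <|
        (norm_gnsMap_le hf _).trans ((norm_star e).trans_le he)

theorem exists_cyclic_vector (hf : ∀ a, ‖f a‖ ≤ ‖a‖) :
    ∃ ξ : f.GNS, ‖ξ‖ ≤ 1 ∧ (∀ a, inner ℂ ξ (gnsMap f a) = f a) ∧
      ∀ a, f.gnsNonUnitalStarAlgHom a ξ = gnsMap f a := by
  have hbound : ∀ a, ‖(f : A →ₗ[ℂ] ℂ) a‖ ≤ 1 * ‖gnsMap f a‖ := fun a =>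
    (norm_apply_le_norm_gnsMap hf a).trans_eq (one_mul _).symm
  let g : StrongDual ℂ f.GNS := (f : A →ₗ[ℂ] ℂ).extendOfNorm (gnsMap f)
  have hg : ∀ a, g (gnsMap f a) = f a := fun a =>
    LinearMap.extendOfNorm_eq (denseRange_gnsMap f) ⟨1, hbound⟩ a
  let ξ : f.GNS := (InnerProductSpace.toDual ℂ f.GNS).symm g
  have inner_ξ : ∀ a, inner ℂ ξ (gnsMap f a) = f a := fun a =>
    InnerProductSpace.toDual_symm_apply.trans (hg a)
  refine ⟨ξ, ?_, inner_ξ, fun a => ext_inner_left ℂ fun v => ?_⟩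
  · rw [LinearIsometryEquiv.norm_map]
    exact ContinuousLinearMap.opNorm_le_bound _ zero_le_one
      (LinearMap.norm_extendOfNorm_apply_le (denseRange_gnsMap f) 1 hbound)
  · refine congrFun ((denseRange_gnsMap f).equalizer
      (g := fun v => inner ℂ v (f.gnsNonUnitalStarAlgHom a ξ))
      (h := fun v => inner ℂ v (gnsMap f a)) (by fun_prop) (by fun_prop) (funext fun b => ?_)) v
    simp only [Function.comp_apply]
    rw [← star_star a, map_star f.gnsNonUnitalStarAlgHom, ContinuousLinearMap.star_eq_adjoint,
      ContinuousLinearMap.adjoint_inner_right, gnsNonUnitalStarAlgHom_apply_gnsMap,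
      ← inner_conj_symm, inner_ξ, star_star, ← inner_gnsMap, inner_conj_symm]

end GNS

variable {A : Type u} [NonUnitalCStarAlgebra A]

/-- The functional `a ↦ ⟨w, θ(a) w⟩`. -/
def vectorFunctional {H : Type*} [NormedAddCommGroup H] [InnerProductSpace ℂ H] [CompleteSpace H]
    (θ : A →⋆ₙₐ[ℂ] (H →L[ℂ] H)) (w : H) : StrongDual ℂ A :=
  LinearMap.mkContinuous
    { toFun := fun a => inner ℂ w (θ a w)
      map_add' := fun a b => by simp
      map_smul' := fun c a => by simp }
    (‖w‖ ^ 2) fun a => calc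
      ‖inner ℂ w (θ a w)‖ ≤ ‖w‖ * ‖θ a w‖ := norm_inner_le_norm _ _
      _ ≤ ‖w‖ * (‖a‖ * ‖w‖) := by
        gcongr
        exact (θ a).le_of_opNorm_le (NonUnitalStarAlgHom.norm_apply_le θ a) w
      _ = ‖w‖ ^ 2 * ‖a‖ := by ring

variable (A) in
/-- Positive functionals of norm at most one. -/
def quasiStates : Set (WeakDual ℂ A) :=
  WeakDual.toStrongDual ⁻¹' Metric.closedBall 0 1 ∩ {φ | ∀ a, 0 ≤ φ (star a * a)}

variable (A) in
theorem isCompact_quasiStates : IsCompact (quasiStates A) := by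
  refine (WeakDual.isCompact_closedBall (0 : StrongDual ℂ A) 1).inter_right ?_
  rw [Set.ofPred_forall]
  exact isClosed_iInter fun a => isClosed_le continuous_const (WeakDual.eval_continuous _)

variable (A) in
theorem nonempty_quasiStates : (quasiStates A).Nonempty := by
  refine ⟨0, ?_, fun _ => le_refl (0 : ℂ)⟩
  rw [Set.mem_preimage, map_zero]
  exact Metric.mem_closedBall_self zero_le_one

/-- The functionals that maximize the value at `b* b` form an exposed face, which has an extreme
point by the Krein–Milman theorem. -/
theorem exists_extreme_quasiState (b : A) : ∃ φ ∈ (quasiStates A).extremePoints ℝ,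
    ∀ ψ ∈ quasiStates A, (ψ (star b * b)).re ≤ (φ (star b * b)).re := by
  have : LocallyConvexSpace ℝ (WeakDual ℂ A) :=
    inferInstanceAs (LocallyConvexSpace ℝ (WeakBilin (topDualPairing ℂ A)))
  let evalRe : StrongDual ℝ (WeakDual ℂ A) :=
    { toFun := fun φ => (φ (star b * b)).re
      map_add' := fun φ ψ => Complex.add_re _ _
      map_smul' := fun r φ => Complex.smul_re r _
      cont := Complex.continuous_re.comp (WeakDual.eval_continuous _) }
  have hface : IsExposed ℝ (quasiStates A) (evalRe.toExposed (quasiStates A)) :=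
    ContinuousLinearMap.toExposed.isExposed
  obtain ⟨φ₀, hφ₀⟩ := (isCompact_quasiStates A).exists_isMaxOn (nonempty_quasiStates A)
    evalRe.continuous.continuousOn
  obtain ⟨φ, hφ⟩ := (hface.isCompact (isCompact_quasiStates A)).extremePoints_nonempty ⟨φ₀, hφ₀⟩
  exact ⟨φ, hface.isExtreme.extremePoints_subset_extremePoints hφ, hφ.1.2⟩

section Cyclic

variable {H : Type*} [NormedAddCommGroup H] [InnerProductSpace ℂ H] [CompleteSpace H]
  (θ : A →⋆ₙₐ[ℂ] (H →L[ℂ] H))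

theorem vectorFunctional_apply (w : H) (a : A) :
    vectorFunctional θ w a = inner ℂ w (θ a w) := rfl

theorem norm_vectorFunctional_le (w : H) : ‖vectorFunctional θ w‖ ≤ ‖w‖ ^ 2 :=
  LinearMap.mkContinuous_norm_le _ (by positivity) _

theorem vectorFunctional_star_mul_self (w : H) (a : A) :
    vectorFunctional θ w (star a * a) = ((‖θ a w‖ ^ 2 : ℝ) : ℂ) := by
  rw [vectorFunctional_apply, map_mul, map_star, mul_apply_eq_comp,
    ContinuousLinearMap.star_eq_adjoint, ContinuousLinearMap.adjoint_inner_right,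
    inner_self_eq_norm_sq_to_K, RCLike.ofReal_eq_complex_ofReal, ← Complex.ofReal_pow]

theorem vectorFunctional_smul (r : ℝ) (w : H) :
    vectorFunctional θ ((r : ℂ) • w) = r ^ 2 • vectorFunctional θ w := by
  ext a
  rw [smul_apply, Complex.real_smul, vectorFunctional_apply, vectorFunctional_apply, map_smul,
    inner_smul_left, inner_smul_right, Complex.conj_ofReal]
  push_cast
  ring

variable {θ}

theorem vectorFunctional_mem_quasiStates {w : H} (hw : ‖w‖ ≤ 1) :
    StrongDual.toWeakDual (vectorFunctional θ w) ∈ quasiStates A := by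
  refine ⟨mem_closedBall_zero_iff.2 ?_, fun a => ?_⟩
  · exact (norm_vectorFunctional_le θ w).trans (pow_le_one₀ (norm_nonneg _) hw)
  · change 0 ≤ vectorFunctional θ w (star a * a)
    rw [vectorFunctional_star_mul_self]
    exact Complex.zero_le_real.2 (sq_nonneg _)

theorem vectorFunctional_eq_smul_of_extreme {ξ v w : H}
    (hext : StrongDual.toWeakDual (vectorFunctional θ ξ) ∈ (quasiStates A).extremePoints ℝ)
    (hadd : vectorFunctional θ ξ = vectorFunctional θ v + vectorFunctional θ w)
    (hv : v ≠ 0) (hw : w ≠ 0) (hvw : ‖v‖ ^ 2 + ‖w‖ ^ 2 ≤ 1) :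
    vectorFunctional θ v = ‖v‖ ^ 2 • vectorFunctional θ ξ := by
  have hv0 : 0 < ‖v‖ := norm_pos_iff.2 hv
  have hw0 : 0 < ‖w‖ := norm_pos_iff.2 hw
  have hs : 0 < 1 - ‖v‖ ^ 2 := by nlinarith
  have norm_le_sqrt : ‖w‖ ≤ √(1 - ‖v‖ ^ 2) := Real.le_sqrt_of_sq_le (by linarith)
  let p : H := ((‖v‖⁻¹ : ℝ) : ℂ) • v
  let q : H := (((√(1 - ‖v‖ ^ 2))⁻¹ : ℝ) : ℂ) • w
  have hp : ‖p‖ ≤ 1 := by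
    rw [norm_smul, Complex.norm_real, norm_inv, norm_norm, inv_mul_cancel₀ hv0.ne']
  have hq : ‖q‖ ≤ 1 := by
    rw [norm_smul, Complex.norm_real, norm_inv, Real.norm_of_nonneg (Real.sqrt_nonneg _)]
    exact inv_mul_le_one_of_le₀ norm_le_sqrt (Real.sqrt_nonneg _)
  have eq_p : ‖v‖ ^ 2 • vectorFunctional θ p = vectorFunctional θ v := by
    rw [vectorFunctional_smul, smul_smul, inv_pow, mul_inv_cancel₀ (pow_pos hv0 2).ne', one_smul]
  have eq_q : (1 - ‖v‖ ^ 2) • vectorFunctional θ q = vectorFunctional θ w := by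
    rw [vectorFunctional_smul, smul_smul, inv_pow, Real.sq_sqrt hs.le, mul_inv_cancel₀ hs.ne',
      one_smul]
  have hsegment : StrongDual.toWeakDual (vectorFunctional θ ξ) ∈ openSegment ℝ
      (StrongDual.toWeakDual (vectorFunctional θ p))
      (StrongDual.toWeakDual (vectorFunctional θ q)) := by
    refine ⟨‖v‖ ^ 2, 1 - ‖v‖ ^ 2, pow_pos hv0 2, hs, by ring, ?_⟩
    rw [hadd, ← eq_p, ← eq_q]
    rfl
  have p_eq_ξ := ((mem_extremePoints.1 hext).2 _ (vectorFunctional_mem_quasiStates hp) _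
    (vectorFunctional_mem_quasiStates hq) hsegment).1
  rw [← eq_p, StrongDual.toWeakDual.injective p_eq_ξ]

theorem eq_smul_of_extreme {ξ v w : H} (hξ : ‖ξ‖ ≤ 1) (hcyc : DenseRange fun a => θ a ξ)
    (hext : StrongDual.toWeakDual (vectorFunctional θ ξ) ∈ (quasiStates A).extremePoints ℝ)
    (hadd : ξ = v + w) (hvw : ∀ a, inner ℂ v (θ a w) = 0) (hwv : ∀ a, inner ℂ w (θ a v) = 0)
    (h_orth : inner ℂ v w = 0) (hv : v ≠ 0) (hw : w ≠ 0) :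
    v = ((‖v‖ ^ 2 : ℝ) : ℂ) • ξ := by
  have hsum : vectorFunctional θ ξ = vectorFunctional θ v + vectorFunctional θ w := by
    ext a
    simp only [vectorFunctional_apply, hadd, map_add, inner_add_left, inner_add_right, hvw, hwv,
      add_apply, add_zero, zero_add]
  have hpyth : ‖v‖ ^ 2 + ‖w‖ ^ 2 ≤ 1 := by
    have h := norm_add_sq_eq_norm_sq_add_norm_sq_of_inner_eq_zero v w h_orth
    rw [← hadd] at h
    nlinarith [norm_nonneg ξ]
  have hprop := vectorFunctional_eq_smul_of_extreme hext hsum hv hw hpyth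
  refine ext_inner_right ℂ fun η => congrFun (hcyc.equalizer (g := fun η => inner ℂ v η)
    (h := fun η => inner ℂ (((‖v‖ ^ 2 : ℝ) : ℂ) • ξ) η) (by fun_prop) (by fun_prop)
    (funext fun a => ?_)) η
  simp only [Function.comp_apply]
  calc inner ℂ v (θ a ξ) = vectorFunctional θ v a := by
        rw [hadd, map_add, inner_add_right, hvw, add_zero, vectorFunctional_apply]
    _ = ((‖v‖ ^ 2 : ℝ) : ℂ) * vectorFunctional θ ξ a := by
        rw [hprop, smul_apply, Complex.real_smul]
    _ = inner ℂ (((‖v‖ ^ 2 : ℝ) : ℂ) • ξ) (θ a ξ) := by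
        rw [inner_smul_left, Complex.conj_ofReal, vectorFunctional_apply]

theorem eq_bot_or_eq_top_of_extreme {ξ : H} (hξ : ‖ξ‖ ≤ 1) (hcyc : DenseRange fun a => θ a ξ)
    (hext : StrongDual.toWeakDual (vectorFunctional θ ξ) ∈ (quasiStates A).extremePoints ℝ)
    {W : Submodule ℂ H} (hW : IsClosed (W : Set H)) (hinv : ∀ a, ∀ η ∈ W, θ a η ∈ W) :
    W = ⊥ ∨ W = ⊤ := by
  have : CompleteSpace W := hW.completeSpace_coe
  have hinv_orth : ∀ a, ∀ η ∈ Wᗮ, θ a η ∈ Wᗮ := fun a η hη w hw => by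
    rw [← star_star a, map_star, ContinuousLinearMap.star_eq_adjoint,
      ContinuousLinearMap.adjoint_inner_right]
    exact hη _ (hinv _ _ hw)
  have eq_top_of_mem : ∀ W' : Submodule ℂ H, IsClosed (W' : Set H) →
      (∀ a, ∀ η ∈ W', θ a η ∈ W') → ξ ∈ W' → W' = ⊤ := fun W' hW' hinv' hξ' =>
    eq_top_iff.2 fun x _ => hW'.closure_subset_iff.2
      (Set.range_subset_iff.2 fun a => hinv' a ξ hξ') (hcyc x)
  let v : H := W.starProjection ξ
  let w : H := ξ - v
  have hv : v ∈ W := Submodule.starProjection_apply_mem _ _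
  have hw : w ∈ Wᗮ := Submodule.sub_starProjection_mem_orthogonal _
  by_cases hv0 : v = 0
  · have hξ' : ξ ∈ Wᗮ := by simpa only [w, hv0, sub_zero] using hw
    exact .inl ((Submodule.orthogonal_eq_top_iff W).1
      (eq_top_of_mem Wᗮ W.isClosed_orthogonal hinv_orth hξ'))
  refine .inr (eq_top_of_mem W hW hinv ?_)
  by_cases hw0 : w = 0
  · exact sub_eq_zero.1 hw0 ▸ hv
  have hsmul := eq_smul_of_extreme hξ hcyc hext (add_sub_cancel v ξ).symm
    (fun a => hinv_orth a w hw v hv)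
    (fun a => Submodule.inner_left_of_mem_orthogonal (hinv a v hv) hw) (hw v hv) hv0 hw0
  have hv2 : ((‖v‖ ^ 2 : ℝ) : ℂ) ≠ 0 :=
    Complex.ofReal_ne_zero.2 (pow_ne_zero 2 (norm_ne_zero_iff.2 hv0))
  exact (W.smul_mem_iff hv2).1 (hsmul ▸ hv)

end Cyclic

theorem exists_irrRep_eq_vectorFunctional {φ : WeakDual ℂ A}
    (hφ : φ ∈ (quasiStates A).extremePoints ℝ) (hφ0 : φ ≠ 0) :
    ∃ (ρ : IrrRep A) (ξ : ρ.H), WeakDual.toStrongDual φ = vectorFunctional ρ.rep ξ := by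
  let _ := CStarAlgebra.spectralOrder A
  have _ := CStarAlgebra.spectralOrderedRing A
  have hpos : ∀ x : A, 0 ≤ x → 0 ≤ (WeakDual.toStrongDual φ).toLinearMap x := fun x hx => by
    obtain ⟨s, rfl⟩ := CStarAlgebra.nonneg_iff_eq_star_mul_self.1 hx
    exact hφ.1.2 s
  let f : A →ₚ[ℂ] ℂ := PositiveLinearMap.mk₀ (WeakDual.toStrongDual φ).toLinearMap hpos
  have hf : ∀ a, ‖f a‖ ≤ ‖a‖ := fun a =>
    (WeakDual.toStrongDual φ).le_of_opNorm_le (mem_closedBall_zero_iff.1 hφ.1.1) a |>.trans_eq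
      (one_mul _)
  obtain ⟨ξ, hξ, inner_ξ, hcyc⟩ := exists_cyclic_vector hf
  have hdense : DenseRange fun a => f.gnsNonUnitalStarAlgHom a ξ := by
    simpa only [hcyc] using denseRange_gnsMap f
  have hφξ : WeakDual.toStrongDual φ = vectorFunctional f.gnsNonUnitalStarAlgHom ξ := by
    ext a
    rw [vectorFunctional_apply, hcyc, inner_ξ]
    rfl
  have hne : ∃ a, f.gnsNonUnitalStarAlgHom a ≠ 0 := by
    by_contra! h
    refine hφ0 (WeakDual.toStrongDual.injective (hφξ.trans ?_))
    ext a
    rw [vectorFunctional_apply, h, zero_apply, inner_zero_right, map_zero, zero_apply]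
  exact ⟨⟨f.GNS, f.gnsNonUnitalStarAlgHom, hne, fun W hW hinv =>
    eq_bot_or_eq_top_of_extreme hξ hdense (hφξ ▸ hφ) hW hinv⟩, ξ, hφξ⟩

/-- An extreme quasi-state that is maximal at `b* b` does not vanish there. -/
theorem exists_irrRep_apply_ne_zero {H : Type*} [NormedAddCommGroup H] [InnerProductSpace ℂ H]
    [CompleteSpace H] (θ : A →⋆ₙₐ[ℂ] (H →L[ℂ] H)) {b : A} (hb : θ b ≠ 0) :
    ∃ ρ : IrrRep A, ρ.rep b ≠ 0 := by
  obtain ⟨φ, hφ, hmax⟩ := exists_extreme_quasiState b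
  have hpos : 0 < (φ (star b * b)).re := by
    obtain ⟨w, hw⟩ := DFunLike.ne_iff.1 hb
    let w₁ : H := ((‖w‖⁻¹ : ℝ) : ℂ) • w
    have hw0 : ‖w‖ ≠ 0 := norm_ne_zero_iff.2 fun h => hw (by rw [h, map_zero, map_zero])
    have norm_w₁ : ‖w₁‖ ≤ 1 := by
      rw [norm_smul, Complex.norm_real, norm_inv, norm_norm, inv_mul_cancel₀ hw0]
    have hw₁ : θ b w₁ ≠ 0 := by
      rw [map_smul]
      exact smul_ne_zero (Complex.ofReal_ne_zero.2 (inv_ne_zero hw0)) hw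
    refine lt_of_lt_of_le ?_ (hmax _ (vectorFunctional_mem_quasiStates (θ := θ) norm_w₁))
    change 0 < (vectorFunctional θ w₁ (star b * b)).re
    rw [vectorFunctional_star_mul_self, Complex.ofReal_re]
    positivity
  have hφ0 : φ ≠ 0 := by
    rintro rfl
    exact hpos.ne' rfl
  obtain ⟨ρ, ξ, hφξ⟩ := exists_irrRep_eq_vectorFunctional hφ hφ0
  refine ⟨ρ, fun h => hpos.ne' ?_⟩
  change (WeakDual.toStrongDual φ (star b * b)).re = 0
  rw [hφξ, vectorFunctional_apply, map_mul, h, mul_zero, zero_apply, inner_zero_right,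
    Complex.zero_re]

end PureStates

/-! ### Integrated forms of unitary representations -/

theorem integral_mem_of_isClosed {X E : Type*} [MeasurableSpace X] {μ : Measure X}
    [NormedAddCommGroup E] [NormedSpace ℂ E] [CompleteSpace E] (S : Submodule ℂ E)
    (hS : IsClosed (S : Set E)) {f : X → E} (hf : Integrable f μ) (h : ∀ x, f x ∈ S) :
    ∫ x, f x ∂μ ∈ S := by
  have : IsClosed (S : Set E) := hS
  have mkQL_apply_eq_zero (x : X) : S.mkQL (f x) = 0 := (Submodule.Quotient.mk_eq_zero S).2 (h x)
  have mkQL_integral : S.mkQL (∫ x, f x ∂μ) = ∫ x, S.mkQL (f x) ∂μ :=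
    (S.mkQL.integral_comp_comm hf).symm
  simp only [mkQL_apply_eq_zero, integral_zero] at mkQL_integral
  exact (Submodule.Quotient.mk_eq_zero S).1 mkQL_integral

theorem inner_integral_left {X E : Type*} [MeasurableSpace X] {μ : Measure X}
    [NormedAddCommGroup E] [InnerProductSpace ℂ E] [CompleteSpace E] {f : X → E}
    (hf : Integrable f μ) (c : E) : inner ℂ (∫ x, f x ∂μ) c = ∫ x, inner ℂ (f x) c ∂μ := by
  rw [← inner_conj_symm, ← integral_inner hf, ← integral_conj]
  simp only [inner_conj_symm]

namespace UnitaryRep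

section Basic

variable {G : Type*} [Group G] [TopologicalSpace G]
  {H : Type*} [NormedAddCommGroup H] [InnerProductSpace ℂ H]

theorem map_mul_apply (π : UnitaryRep G H) (g h : G) (ξ : H) :
    π.toHom (g * h) ξ = π.toHom g (π.toHom h ξ) := by
  rw [map_mul]
  rfl

theorem map_one_apply (π : UnitaryRep G H) (ξ : H) : π.toHom 1 ξ = ξ := by
  rw [map_one]
  rfl

theorem map_inv_map (π : UnitaryRep G H) (g : G) (ξ : H) :
    π.toHom g⁻¹ (π.toHom g ξ) = ξ := by
  rw [← map_mul_apply, inv_mul_cancel, map_one_apply]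

theorem map_map_inv (π : UnitaryRep G H) (g : G) (ξ : H) :
    π.toHom g (π.toHom g⁻¹ ξ) = ξ := by
  rw [← map_mul_apply, mul_inv_cancel, map_one_apply]

theorem inner_map_left (π : UnitaryRep G H) (g : G) (ξ η : H) :
    inner ℂ (π.toHom g ξ) η = inner ℂ ξ (π.toHom g⁻¹ η) := by
  rw [← LinearIsometryEquiv.inner_map_map (π.toHom g⁻¹), map_inv_map]

/-- The unitary representation on an invariant subspace. -/
def subrep (π : UnitaryRep G H) (W : Submodule ℂ H)
    (hW : ∀ g, ∀ ξ ∈ W, π.toHom g ξ ∈ W) : UnitaryRep G W where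
  toHom :=
    { toFun := fun g =>
        { (π.toHom g).toLinearEquiv.toLinearMap.restrict (hW g) with
          invFun := fun ξ => ⟨π.toHom g⁻¹ ξ, hW g⁻¹ ξ ξ.2⟩
          left_inv := fun ξ => Subtype.ext (π.map_inv_map g ξ)
          right_inv := fun ξ => Subtype.ext (π.map_map_inv g ξ)
          norm_map' := fun ξ => (π.toHom g).norm_map ξ }
      map_one' := LinearIsometryEquiv.ext fun ξ => Subtype.ext (π.map_one_apply ξ)
      map_mul' := fun g h => LinearIsometryEquiv.ext fun ξ => Subtype.ext (π.map_mul_apply g h ξ) }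
  strongly_continuous ξ := (π.strongly_continuous (ξ : H)).subtype_mk _

theorem map_mem_orthogonal {π : UnitaryRep G H} {W : Submodule ℂ H}
    (hW : ∀ g, ∀ ξ ∈ W, π.toHom g ξ ∈ W) (g : G) {ξ : H} (hξ : ξ ∈ Wᗮ) : π.toHom g ξ ∈ Wᗮ :=
  fun w hw => by
    rw [← inner_conj_symm, π.inner_map_left, inner_conj_symm]
    exact hξ _ (hW _ _ hw)

end Basic

section Integrated

variable {G : Type*} [Group G] [TopologicalSpace G] [MeasurableSpace G] [BorelSpace G]
  {H : Type*} [NormedAddCommGroup H] [InnerProductSpace ℂ H] [CompleteSpace H]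
  (μ : Measure G) [IsFiniteMeasureOnCompacts μ]

theorem integrated_apply (π : UnitaryRep G H) (f : C_c(G, ℂ)) (ξ : H) :
    π.integrated μ f ξ = ∫ g, f g • π.toHom g ξ ∂μ := rfl

/-- `UnitaryRep.integrated` as a linear map in the function. -/
def integratedₗ (π : UnitaryRep G H) : C_c(G, ℂ) →ₗ[ℂ] (H →L[ℂ] H) where
  toFun := π.integrated μ
  map_add' f g := by
    ext ξ
    simp only [integrated_apply, CompactlySupportedContinuousMap.add_apply, add_smul, add_apply]
    exact integral_add (π.integrable_smul μ f ξ) (π.integrable_smul μ g ξ)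
  map_smul' c f := by
    ext ξ
    simp only [integrated_apply, CompactlySupportedContinuousMap.smul_apply, smul_assoc,
      smul_apply, RingHom.id_apply]
    exact integral_smul _ _

theorem integratedₗ_apply (π : UnitaryRep G H) (f : C_c(G, ℂ)) :
    π.integratedₗ μ f = π.integrated μ f := rfl

theorem norm_integrated_le (π : UnitaryRep G H) (f : C_c(G, ℂ)) :
    ‖π.integrated μ f‖ ≤ ∫ g, ‖f g‖ ∂μ :=
  LinearMap.mkContinuous_norm_le _ (integral_nonneg fun _ => norm_nonneg _) _

theorem inner_integrated_left [IsTopologicalGroup G] [μ.IsInvInvariant] (π : UnitaryRep G H)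
    {f f' : C_c(G, ℂ)} (hf : ∀ g, f' g = starRingEnd ℂ (f g⁻¹)) (ξ η : H) :
    inner ℂ (π.integrated μ f ξ) η = inner ℂ ξ (π.integrated μ f' η) := by
  rw [integrated_apply, integrated_apply, inner_integral_left (π.integrable_smul μ f ξ),
    ← integral_inner (π.integrable_smul μ f' η), ← integral_inv_eq_self _ μ]
  simp only [inner_smul_left, inner_smul_right, hf, inner_map_left, inv_inv]

theorem map_integrated {H' : Type*} [NormedAddCommGroup H'] [InnerProductSpace ℂ H']
    [CompleteSpace H'] {π : UnitaryRep G H} {π' : UnitaryRep G H'} {T : H →L[ℂ] H'}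
    (hT : ∀ g ξ, T (π.toHom g ξ) = π'.toHom g (T ξ)) (f : C_c(G, ℂ)) (ξ : H) :
    T (π.integrated μ f ξ) = π'.integrated μ f (T ξ) := by
  rw [integrated_apply, integrated_apply, ← T.integral_comp_comm (π.integrable_smul μ f ξ)]
  simp only [map_smul, hT]

theorem integrated_apply_ne_zero [μ.IsOpenPosMeasure] (π : UnitaryRep G H) {ξ : H} (hξ : ξ ≠ 0)
    {h : G → ℝ} (hcont : Continuous h) (hsupp : HasCompactSupport h) (hnonneg : ∀ g, 0 ≤ h g)
    (hone : h 1 ≠ 0) {f : C_c(G, ℂ)} (hf : ∀ g, f g = h g * inner ℂ (π.toHom g ξ) ξ) :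
    π.integrated μ f ξ ≠ 0 := by
  have hpos : 0 < ∫ g, h g * ‖inner ℂ (π.toHom g ξ) ξ‖ ^ 2 ∂μ :=
    (hcont.mul (((π.strongly_continuous ξ).inner continuous_const).norm.pow
      2)).integral_pos_of_hasCompactSupport_nonneg_nonzero hsupp.mul_right
      (fun g => mul_nonneg (hnonneg g) (by positivity)) (x := 1)
      (by simpa [π.map_one_apply, hone] using hξ)
  have inner_eq : inner ℂ ξ (π.integrated μ f ξ)
      = ((∫ g, h g * ‖inner ℂ (π.toHom g ξ) ξ‖ ^ 2 ∂μ : ℝ) : ℂ) := by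
    rw [integrated_apply, ← integral_inner (π.integrable_smul μ f ξ), ← integral_complex_ofReal]
    refine integral_congr_ae (Filter.Eventually.of_forall fun g => ?_)
    simp only [hf, inner_smul_right]
    rw [← inner_conj_symm ξ, mul_assoc, Complex.mul_conj, Complex.normSq_eq_norm_sq]
    push_cast
    rfl
  intro hzero
  rw [hzero, inner_zero_right] at inner_eq
  exact hpos.ne (by exact_mod_cast inner_eq)

end Integrated

end UnitaryRep

/-! ### Representative functions on a compact group -/

section CompactGroup

variable {K : Type*} [Group K] [TopologicalSpace K] [CompactSpace K]

/-- The matrix coefficient `k ↦ ⟨τ(k) v, w⟩`; the inner product is linear in `w`. -/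
def matrixCoeff {V : Type*} [NormedAddCommGroup V] [InnerProductSpace ℂ V] (τ : UnitaryRep K V)
    (v w : V) : C_c(K, ℂ) where
  toFun k := inner ℂ (τ.toHom k v) w
  continuous_toFun := (τ.strongly_continuous v).inner continuous_const
  hasCompactSupport' := HasCompactSupport.of_compactSpace _

theorem matrixCoeff_apply {V : Type*} [NormedAddCommGroup V] [InnerProductSpace ℂ V]
    (τ : UnitaryRep K V) (v w : V) (k : K) : matrixCoeff τ v w k = inner ℂ (τ.toHom k v) w := rfl

theorem matrixCoeff_swap {V : Type*} [NormedAddCommGroup V] [InnerProductSpace ℂ V]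
    (τ : UnitaryRep K V) (v w : V) (k : K) :
    matrixCoeff τ w v k = starRingEnd ℂ (matrixCoeff τ v w k⁻¹) := by
  rw [matrixCoeff_apply, matrixCoeff_apply, inner_conj_symm, UnitaryRep.inner_map_left]

/-- A representative function: a matrix coefficient of a finite-dimensional unitary
representation. -/
def IsRepresentative {K : Type u} [Group K] [TopologicalSpace K] [CompactSpace K]
    (φ : C_c(K, ℂ)) : Prop :=
  ∃ (V : Type u) (_ : NormedAddCommGroup V) (_ : InnerProductSpace ℂ V)
    (_ : FiniteDimensional ℂ V) (τ : UnitaryRep K V) (v w : V), φ = matrixCoeff τ v w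

theorem continuous_rankOne_map {V H : Type*} [NormedAddCommGroup V] [InnerProductSpace ℂ V]
    [NormedAddCommGroup H] [InnerProductSpace ℂ H] {K : Type*} [Group K] [TopologicalSpace K]
    (τ : UnitaryRep K V) (π : UnitaryRep K H) (v : V) (ξ : H) :
    Continuous fun k => InnerProductSpace.rankOne ℂ (π.toHom k ξ) (τ.toHom k v) :=
  (ContinuousLinearMap.smulRightL ℂ V H).continuous₂.comp
    (((innerSL ℂ).continuous.comp (τ.strongly_continuous v)).prodMk (π.strongly_continuous ξ))

section Average

variable [MeasurableSpace K] [BorelSpace K] (ν : Measure K)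
  {V H : Type*} [NormedAddCommGroup V] [InnerProductSpace ℂ V]
  [NormedAddCommGroup H] [InnerProductSpace ℂ H]
  (τ : UnitaryRep K V) (π : UnitaryRep K H) (v : V) (ξ : H)

/-- The average over `K` of the rank-one operator `w ↦ ⟨v, w⟩ ξ`, an intertwiner from `τ` to
`π`. -/
def averageRankOne : V →L[ℂ] H :=
  ∫ k, InnerProductSpace.rankOne ℂ (π.toHom k ξ) (τ.toHom k v) ∂ν

variable [IsFiniteMeasureOnCompacts ν] [CompleteSpace H]

theorem averageRankOne_apply (w : V) :
    averageRankOne ν τ π v ξ w = π.integrated ν (matrixCoeff τ v w) ξ := by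
  have hint : Integrable
      (fun k => InnerProductSpace.rankOne ℂ (π.toHom k ξ) (τ.toHom k v)) ν :=
    (continuous_rankOne_map τ π v ξ).integrable_of_hasCompactSupport
      (HasCompactSupport.of_compactSpace _)
  rw [averageRankOne, ContinuousLinearMap.integral_apply hint]
  rfl

theorem averageRankOne_map [IsTopologicalGroup K] [ν.IsMulLeftInvariant] (k : K) (w : V) :
    averageRankOne ν τ π v ξ (τ.toHom k w) = π.toHom k (averageRankOne ν τ π v ξ w) := by
  rw [averageRankOne_apply, averageRankOne_apply, π.integrated_apply ν, π.integrated_apply ν]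
  refine Eq.trans ?_ ((π.toHom k).toContinuousLinearEquiv.toContinuousLinearMap.integral_comp_comm
    (π.integrable_smul ν (matrixCoeff τ v w) ξ))
  rw [← integral_mul_left_eq_self _ k]
  refine integral_congr_ae (Filter.Eventually.of_forall fun h => ?_)
  change inner ℂ (τ.toHom (k * h) v) (τ.toHom k w) • π.toHom (k * h) ξ
    = π.toHom k (inner ℂ (τ.toHom h v) w • π.toHom h ξ)
  rw [map_smul, π.map_mul_apply, τ.map_mul_apply, LinearIsometryEquiv.inner_map_map]

theorem isCompactOperator_averageRankOne : IsCompactOperator (averageRankOne ν τ π v ξ) :=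
  integral_mem_of_isClosed (compactOperator (RingHom.id ℂ) V H)
    isClosed_setOfPred_isCompactOperator
    ((continuous_rankOne_map τ π v ξ).integrable_of_hasCompactSupport
      (HasCompactSupport.of_compactSpace _)) fun k => by
      have hspan : IsCompactOperator (ContinuousLinearMap.toSpanSingleton ℂ (π.toHom k ξ)) :=
        isCompactOperator_of_locallyCompactSpace_rng _
      change IsCompactOperator _
      rw [InnerProductSpace.rankOne_def']
      exact hspan.comp_clm (innerSL ℂ (τ.toHom k v))

theorem isSelfAdjoint_averageRankOne : IsSelfAdjoint (averageRankOne ν π π ξ ξ) := by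
  rw [ContinuousLinearMap.isSelfAdjoint_iff_isSymmetric]
  intro x y
  simp only [ContinuousLinearMap.coe_coe]
  rw [averageRankOne_apply, averageRankOne_apply, π.integrated_apply ν, π.integrated_apply ν,
    inner_integral_left (π.integrable_smul ν _ ξ), ← integral_inner (π.integrable_smul ν _ ξ)]
  simp only [matrixCoeff_apply, inner_smul_left, inner_smul_right, inner_conj_symm, mul_comm]

variable {π ξ} in
theorem averageRankOne_self_apply_ne_zero [ν.IsOpenPosMeasure] (hξ : ξ ≠ 0) :
    averageRankOne ν π π ξ ξ ξ ≠ 0 := by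
  rw [averageRankOne_apply]
  exact π.integrated_apply_ne_zero ν hξ (h := 1) continuous_one
    (HasCompactSupport.of_compactSpace _) (fun _ => zero_le_one) one_ne_zero
    fun k => by simp [matrixCoeff_apply]

end Average

theorem exists_finiteRank_intertwiner_apply_ne_zero [IsTopologicalGroup K] {H : Type*}
    [NormedAddCommGroup H] [InnerProductSpace ℂ H] [CompleteSpace H] (π : UnitaryRep K H) {η : H}
    (hη : η ≠ 0) :
    ∃ c : H →L[ℂ] H, (∀ k ξ, c (π.toHom k ξ) = π.toHom k (c ξ)) ∧
      FiniteDimensional ℂ (LinearMap.range c.toLinearMap) ∧ c η ≠ 0 := by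
  borelize K
  let ν : Measure K := Measure.haar
  let T := averageRankOne ν π π η η
  have hT : 0 < ‖T η‖ := norm_pos_iff.2 (averageRankOne_self_apply_ne_zero ν hη)
  obtain ⟨c, g, hc, hgc, hcomm⟩ := exists_truncation_of_isSelfAdjoint
    (isSelfAdjoint_averageRankOne ν π η) (ε := ‖T η‖ / (2 * ‖η‖))
    (div_pos hT (mul_pos two_pos (norm_pos_iff.2 hη)))
  refine ⟨c, fun k ξ => ?_, ?_, fun hzero => ?_⟩
  · have hcommute : Commute c (π.toHom k).toContinuousLinearEquiv.toContinuousLinearMap :=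
      hcomm _ (ContinuousLinearMap.ext fun x => averageRankOne_map ν π π η η k x)
    exact congrArg (fun S : H →L[ℂ] H => S ξ) hcommute
  · exact finiteDimensional_range_of_compact_fixing (T := g * T)
      ((isCompactOperator_averageRankOne ν π π η η).clm_comp g) fun x =>
        congrArg (fun S : H →L[ℂ] H => S x) hgc
  · have hle : ‖(c - T) η‖ ≤ ‖T η‖ / (2 * ‖η‖) * ‖η‖ := (c - T).le_of_opNorm_le hc η
    have half : ‖T η‖ / (2 * ‖η‖) * ‖η‖ = ‖T η‖ / 2 := by
      have := norm_ne_zero_iff.2 hη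
      field_simp
    rw [half, sub_apply, hzero, zero_sub, norm_neg] at hle
    linarith

end CompactGroup

section Admissible

variable {K : Type u} [Group K] [TopologicalSpace K] [CompactSpace K] [IsTopologicalGroup K]
  [MeasurableSpace K] [BorelSpace K] (ν : Measure K) [ν.IsHaarMeasure]
  {H : Type u} [NormedAddCommGroup H] [InnerProductSpace ℂ H]

theorem exists_isRepresentative_apply_ne_zero [CompleteSpace H] (π : UnitaryRep K H) {η : H}
    (hη : η ≠ 0) : ∃ φ, IsRepresentative φ ∧ π.integrated ν φ η ≠ 0 := by
  obtain ⟨c, hcomm, hfin, hc⟩ := exists_finiteRank_intertwiner_apply_ne_zero π hη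
  let V := LinearMap.range c.toLinearMap
  have hV : ∀ k, ∀ ξ ∈ V, π.toHom k ξ ∈ V := by
    rintro k _ ⟨ξ, rfl⟩
    exact ⟨π.toHom k ξ, hcomm k ξ⟩
  let v : V := ⟨c η, η, rfl⟩
  let φ := matrixCoeff (π.subrep V hV) v v
  have average_eq : averageRankOne ν π π (c η) (c η) (c η) = c (π.integrated ν φ η) := by
    rw [averageRankOne_apply, UnitaryRep.map_integrated ν hcomm]
    rfl
  refine ⟨φ, ⟨V, _, _, hfin, _, v, v, rfl⟩, fun hzero => ?_⟩
  refine averageRankOne_self_apply_ne_zero ν (π := π) hc ?_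
  rw [average_eq, hzero, map_zero]

theorem finiteDimensional_intertwiners_of_isIrreducible [CompleteSpace H] {π : UnitaryRep K H}
    (hπ : ∀ φ, IsRepresentative φ →
      FiniteDimensional ℂ (LinearMap.range (π.integrated ν φ).toLinearMap))
    {V : Type u} [NormedAddCommGroup V] [InnerProductSpace ℂ V] [CompleteSpace V]
    {τ : UnitaryRep K V} (hτ : τ.IsIrreducible) :
    FiniteDimensional ℂ (τ.intertwiners π) := by
  obtain ⟨_, hirr⟩ := hτ
  obtain ⟨w, hw⟩ := exists_ne (0 : V)
  obtain ⟨φ, hφ, hφw⟩ := exists_isRepresentative_apply_ne_zero ν τ hw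
  have := hπ φ hφ
  let ev : τ.intertwiners π →ₗ[ℂ] LinearMap.range (π.integrated ν φ).toLinearMap :=
    { toFun := fun T => ⟨(T : V →L[ℂ] H) (τ.integrated ν φ w), (T : V →L[ℂ] H) w,
        (UnitaryRep.map_integrated ν T.2 φ w).symm⟩
      map_add' := fun S T => rfl
      map_smul' := fun c T => rfl }
  refine FiniteDimensional.of_injective ev ((injective_iff_map_eq_zero ev).2 fun T hT => ?_)
  have mem_ker : τ.integrated ν φ w ∈ (T : V →L[ℂ] H).ker := congrArg Subtype.val hT
  have ker_invariant : ∀ k, ∀ ξ ∈ (T : V →L[ℂ] H).ker, τ.toHom k ξ ∈ (T : V →L[ℂ] H).ker :=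
    fun k ξ (hξ : (T : V →L[ℂ] H) ξ = 0) => (T.2 k ξ).trans (by rw [hξ, map_zero])
  rcases hirr _ (T : V →L[ℂ] H).isClosed_ker ker_invariant with hker | hker
  · rw [hker] at mem_ker
    exact absurd mem_ker hφw
  · exact Subtype.ext (ContinuousLinearMap.ext fun x =>
      show x ∈ (T : V →L[ℂ] H).ker from hker ▸ Submodule.mem_top)

theorem finiteDimensional_intertwiners_of_subrep {K V : Type*} [Group K] [TopologicalSpace K]
    [NormedAddCommGroup V] [InnerProductSpace ℂ V] {π : UnitaryRep K H} {τ : UnitaryRep K V}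
    {W : Submodule ℂ V} [W.HasOrthogonalProjection] (hW : ∀ k, ∀ ξ ∈ W, τ.toHom k ξ ∈ W)
    (hW' : ∀ k, ∀ ξ ∈ Wᗮ, τ.toHom k ξ ∈ Wᗮ)
    [FiniteDimensional ℂ ((τ.subrep W hW).intertwiners π)]
    [FiniteDimensional ℂ ((τ.subrep Wᗮ hW').intertwiners π)] :
    FiniteDimensional ℂ (τ.intertwiners π) := by
  let res : τ.intertwiners π →ₗ[ℂ]
      (τ.subrep W hW).intertwiners π × (τ.subrep Wᗮ hW').intertwiners π :=
    { toFun := fun T => (⟨(T : V →L[ℂ] H).comp W.subtypeL, fun k ξ => T.2 k ξ⟩,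
        ⟨(T : V →L[ℂ] H).comp Wᗮ.subtypeL, fun k ξ => T.2 k ξ⟩)
      map_add' := fun S T => rfl
      map_smul' := fun c T => rfl }
  refine FiniteDimensional.of_injective res ((injective_iff_map_eq_zero res).2 fun T hT => ?_)
  ext x
  obtain ⟨y, hy, z, hz, rfl⟩ := W.exists_add_mem_mem_orthogonal x
  have apply_y : (T : V →L[ℂ] H) y = 0 := congrArg (fun p => (p.1 : W →L[ℂ] H) ⟨y, hy⟩) hT
  have apply_z : (T : V →L[ℂ] H) z = 0 := congrArg (fun p => (p.2 : Wᗮ →L[ℂ] H) ⟨z, hz⟩) hT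
  rw [map_add, apply_y, apply_z, add_zero]
  rfl

theorem finiteDimensional_intertwiners_of_forall_isIrreducible {K : Type*} [Group K]
    [TopologicalSpace K] {π : UnitaryRep K H}
    (hπ : ∀ (V : Type u) [NormedAddCommGroup V] [InnerProductSpace ℂ V] [CompleteSpace V]
      (τ : UnitaryRep K V), τ.IsIrreducible → FiniteDimensional ℂ (τ.intertwiners π))
    (V : Type u) [NormedAddCommGroup V] [InnerProductSpace ℂ V] [FiniteDimensional ℂ V]
    (τ : UnitaryRep K V) : FiniteDimensional ℂ (τ.intertwiners π) := by
  induction hn : Module.finrank ℂ V using Nat.strong_induction_on generalizing V with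
  | _ n ih =>
    have : CompleteSpace V := FiniteDimensional.complete ℂ V
    by_cases hτ : τ.IsIrreducible
    · exact hπ V τ hτ
    rcases subsingleton_or_nontrivial V with hV | hV
    · have : Subsingleton (τ.intertwiners π) := ⟨fun S T => by
        ext x
        rw [Subsingleton.elim x 0, map_zero, map_zero]⟩
      infer_instance
    obtain ⟨W, hW, hbot, htop⟩ : ∃ W : Submodule ℂ V,
        (∀ k, ∀ ξ ∈ W, τ.toHom k ξ ∈ W) ∧ W ≠ ⊥ ∧ W ≠ ⊤ := by
      by_contra! h
      exact hτ ⟨hV, fun W _ hW => or_iff_not_imp_left.2 (h W hW)⟩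
    have hW' : ∀ k, ∀ ξ ∈ Wᗮ, τ.toHom k ξ ∈ Wᗮ := fun k ξ => UnitaryRep.map_mem_orthogonal hW k
    have finrank_pos : 0 < Module.finrank ℂ W :=
      Module.finrank_pos_iff.2 (Submodule.nontrivial_iff_ne_bot.2 hbot)
    have finrank_lt : Module.finrank ℂ W < n := hn ▸ Submodule.finrank_lt htop
    have finrank_lt' : Module.finrank ℂ Wᗮ < n := by
      have := W.finrank_add_finrank_orthogonal
      omega
    have := ih _ finrank_lt W (τ.subrep W hW) rfl
    have := ih _ finrank_lt' Wᗮ (τ.subrep Wᗮ hW') rfl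
    exact finiteDimensional_intertwiners_of_subrep hW hW'

theorem finiteDimensional_range_integrated [CompleteSpace H] {π : UnitaryRep K H}
    (hπ : ∀ (V : Type u) [NormedAddCommGroup V] [InnerProductSpace ℂ V] [CompleteSpace V]
      (τ : UnitaryRep K V), τ.IsIrreducible → FiniteDimensional ℂ (τ.intertwiners π))
    {φ : C_c(K, ℂ)} (hφ : IsRepresentative φ) :
    FiniteDimensional ℂ (LinearMap.range (π.integrated ν φ).toLinearMap) := by
  obtain ⟨V, _, _, _, τ, v, w, rfl⟩ := hφ
  have := finiteDimensional_intertwiners_of_forall_isIrreducible hπ V τ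
  let ev : τ.intertwiners π →ₗ[ℂ] H :=
    { toFun := fun T => (T : V →L[ℂ] H) w
      map_add' := fun S T => rfl
      map_smul' := fun c T => rfl }
  refine Submodule.finiteDimensional_of_le (S₂ := LinearMap.range ev) ?_
  rintro _ ⟨ξ, rfl⟩
  exact ⟨⟨averageRankOne ν τ π v ξ, averageRankOne_map ν τ π v ξ⟩,
    averageRankOne_apply ν τ π v ξ w⟩

end Admissible

/-! ### Finite-dimensional corners and the spectrum -/

section FiniteRank

theorem finiteDimensional_range_of_ker_le {E F F' : Type*} [AddCommGroup E] [Module ℂ E]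
    [AddCommGroup F] [Module ℂ F] [AddCommGroup F'] [Module ℂ F'] {L : E →ₗ[ℂ] F}
    {M : E →ₗ[ℂ] F'} (h : LinearMap.ker L ≤ LinearMap.ker M)
    (hL : FiniteDimensional ℂ (LinearMap.range L)) : FiniteDimensional ℂ (LinearMap.range M) := by
  have : FiniteDimensional ℂ (E ⧸ LinearMap.ker L) := L.quotKerEquivRange.symm.finiteDimensional
  rw [← Submodule.range_liftQ _ M h]
  infer_instance

theorem finiteDimensional_range_of_denseRange {E X F : Type*} [AddCommGroup E] [Module ℂ E]
    [AddCommGroup X] [Module ℂ X] [TopologicalSpace X] [AddCommGroup F] [Module ℂ F]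
    [TopologicalSpace F] [IsTopologicalAddGroup F] [ContinuousSMul ℂ F] [T2Space F]
    {e : E →ₗ[ℂ] X} (he : DenseRange e) {T : X →L[ℂ] F}
    (h : FiniteDimensional ℂ (LinearMap.range (T.toLinearMap ∘ₗ e))) :
    FiniteDimensional ℂ (LinearMap.range T.toLinearMap) := by
  refine Submodule.finiteDimensional_of_le (S₂ := LinearMap.range (T.toLinearMap ∘ₗ e)) ?_
  rintro _ ⟨x, rfl⟩
  have isClosed_range : IsClosed (LinearMap.range (T.toLinearMap ∘ₗ e) : Set F) :=
    Submodule.closed_of_finiteDimensional _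
  refine isClosed_range.closure_subset (map_mem_closure T.continuous (he x) ?_)
  rintro _ ⟨a, rfl⟩
  exact ⟨a, rfl⟩

theorem finiteDimensional_range_mul {H : Type*} [NormedAddCommGroup H] [NormedSpace ℂ H]
    (T : H →L[ℂ] H) {D : H →L[ℂ] H} (hD : FiniteDimensional ℂ (LinearMap.range D.toLinearMap)) :
    FiniteDimensional ℂ (LinearMap.range (T * D).toLinearMap) := by
  change FiniteDimensional ℂ (LinearMap.range (T.toLinearMap ∘ₗ D.toLinearMap))
  rw [LinearMap.range_comp]
  infer_instance

theorem finiteDimensional_range_sandwich {E H : Type*} [AddCommGroup E] [Module ℂ E]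
    [NormedAddCommGroup H] [NormedSpace ℂ H] {D D' : H →L[ℂ] H}
    (hD : FiniteDimensional ℂ (LinearMap.range D.toLinearMap))
    (hD' : FiniteDimensional ℂ (LinearMap.range D'.toLinearMap)) {L : E →ₗ[ℂ] (H →L[ℂ] H)}
    (hL : ∀ e, ∃ T : H →L[ℂ] H, L e = D * T * D') : FiniteDimensional ℂ (LinearMap.range L) := by
  let R := LinearMap.range D.toLinearMap
  let R' := LinearMap.range D'.toLinearMap
  let p : H →L[ℂ] R' := D'.codRestrict R' fun x => ⟨x, rfl⟩
  let sandwich : (R' →ₗ[ℂ] R) →ₗ[ℂ] (H →L[ℂ] H) :=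
    { toFun := fun Z => R.subtypeL.comp ((LinearMap.toContinuousLinearMap Z).comp p)
      map_add' := fun Z Z' => by ext x; simp
      map_smul' := fun c Z => by ext x; simp }
  refine Submodule.finiteDimensional_of_le (S₂ := LinearMap.range sandwich) ?_
  rintro _ ⟨e, rfl⟩
  obtain ⟨T, hT⟩ := hL e
  refine ⟨D.toLinearMap.rangeRestrict ∘ₗ T.toLinearMap ∘ₗ R'.subtype, ?_⟩
  rw [hT]
  rfl

end FiniteRank

section Spectrum

variable {A : Type u} [NonUnitalRing A] [StarRing A] [Module ℂ A]

theorem CStarDual.isClosed_iff {Z : Set (CStarDual A)} :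
    IsClosed Z ↔ ∃ I : TwoSidedIdeal A, Z = {x | I ≤ x.ker} := by
  rw [← isOpen_compl_iff]
  change Zᶜᶜ ∈ {Z : Set (CStarDual A) | ∃ I : TwoSidedIdeal A, Z = {x | I ≤ x.ker}} ↔ _
  rw [compl_compl]
  rfl

namespace IrrRep

theorem mem_ker {ρ : IrrRep A} {a : A} : a ∈ ρ.ker ↔ ρ.rep a = 0 := TwoSidedIdeal.mem_ker _

theorem toDual_eq_toDual {ρ x : IrrRep A} : ρ.toDual = x.toDual ↔ ρ ≈ x := Quotient.eq

theorem ker_eq_of_equiv {ρ x : IrrRep A} (h : ρ ≈ x) : ρ.ker = x.ker :=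
  congrArg CStarDual.ker (toDual_eq_toDual.2 h)

theorem apply_ne_zero_of_equiv {ρ x : IrrRep A} (h : ρ ≈ x) {a : A} (ha : ρ.rep a ≠ 0) :
    x.rep a ≠ 0 := by
  rwa [Ne, ← mem_ker, ← ker_eq_of_equiv h, mem_ker]

theorem isClosed_singleton_toDual {ρ : IrrRep A} (h : ∀ x : IrrRep A, ρ.ker ≤ x.ker → ρ ≈ x) :
    IsClosed {ρ.toDual} := by
  refine CStarDual.isClosed_iff.2 ⟨ρ.ker, Set.ext fun z => ?_⟩
  induction z using Quotient.inductionOn with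
  | h x =>
    change x.toDual = ρ.toDual ↔ ρ.ker ≤ x.ker
    exact ⟨fun h => (ker_eq_of_equiv (toDual_eq_toDual.1 h)).ge,
      fun hx => (toDual_eq_toDual.2 (h x hx)).symm⟩

theorem isOpen_singleton_toDual {ρ : IrrRep A} {y : A} (hy : ρ.rep y ≠ 0)
    (h : ∀ x : IrrRep A, x.rep y ≠ 0 → ρ ≈ x) : IsOpen {ρ.toDual} := by
  refine isClosed_compl_iff.1 (CStarDual.isClosed_iff.2 ⟨TwoSidedIdeal.span {y}, ?_⟩)
  ext z
  induction z using Quotient.inductionOn with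
  | h x =>
    change ¬ x.toDual = ρ.toDual ↔ TwoSidedIdeal.span {y} ≤ x.ker
    rw [TwoSidedIdeal.span_le, Set.singleton_subset_iff, SetLike.mem_coe, mem_ker,
      toDual_eq_toDual]
    exact ⟨fun hx => by_contra fun h0 => hx (Setoid.symm (h x h0)),
      fun h0 hx => apply_ne_zero_of_equiv (Setoid.symm hx) hy h0⟩

theorem exists_ideal_of_isOpen {A : Type u} [NonUnitalCStarAlgebra A] {E : Type*}
    [NormedAddCommGroup E] [InnerProductSpace ℂ E] [CompleteSpace E] {θ : A →⋆ₙₐ[ℂ] (E →L[ℂ] E)}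
    (hθ : Function.Injective θ) {ρ : IrrRep A} (hopen : IsOpen {ρ.toDual}) :
    ∃ I : TwoSidedIdeal A, (∃ i ∈ I, ρ.rep i ≠ 0) ∧ ∀ z ∈ I, ρ.rep z = 0 → z = 0 := by
  obtain ⟨I, hI⟩ := CStarDual.isClosed_iff.1 hopen.isClosed_compl
  have equiv_iff : ∀ x : IrrRep A, x ≈ ρ ↔ ¬ I ≤ x.ker := fun x => by
    have h : x.toDual ∈ ({ρ.toDual} : Set (CStarDual A))ᶜ ↔ I ≤ x.ker := by rw [hI]; rfl
    rw [← h, ← toDual_eq_toDual, Set.mem_compl_iff, not_not, Set.mem_singleton_iff]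
  refine ⟨I, ?_, fun z hz h0 => ?_⟩
  · obtain ⟨i, hi, hi0⟩ := Set.not_subset.1 ((equiv_iff ρ).1 (Setoid.refl ρ))
    exact ⟨i, hi, fun h => hi0 (mem_ker.2 h)⟩
  · by_contra hz0
    obtain ⟨x, hx⟩ := exists_irrRep_apply_ne_zero θ (map_zero θ ▸ hθ.ne hz0)
    exact apply_ne_zero_of_equiv ((equiv_iff x).2 fun h => hx (mem_ker.1 (h hz))) hx h0

end IrrRep

end Spectrum

section FiniteCorners

variable {B : Type u} [NonUnitalCStarAlgebra B] {S : NonUnitalStarSubalgebra ℂ B}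

/-- Right multiplication by an element of the idealizer of `S`, as a linear map on `S`. -/
def idealizerMulRight (T : idealizer S) : S →ₗ[ℂ] S where
  toFun a := ⟨a * T, (T.2 a a.2).2⟩
  map_add' _ _ := Subtype.ext (add_mul _ _ _)
  map_smul' _ _ := Subtype.ext (smul_mul_assoc _ _ _)

theorem mul_idealizerMulRight (T : idealizer S) (a b : S) :
    a * idealizerMulRight T b = idealizerMulRight T (a * b) :=
  Subtype.ext (mul_assoc _ _ _).symm

/-- All the corners `c S T`, for `T ∈ 𝒯`, are finite-dimensional. -/
def HasFiniteCorners (𝒯 : Set (idealizer S)) (c : S) : Prop :=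
  ∀ T ∈ 𝒯, FiniteDimensional ℂ (LinearMap.range (idealizerMulRight T ∘ₗ LinearMap.mulLeft ℂ c))

variable [IsClosed (S : Set B)]

/-- A self-adjoint family of multipliers of `S` which, in every irreducible representation of `S`,
has no common kernel. -/
structure IsNondegenerate (𝒯 : Set (idealizer S)) : Prop where
  star_mem : ∀ T ∈ 𝒯, star T ∈ 𝒯
  exists_apply_ne_zero : ∀ (σ : IrrRep S) (ξ : σ.H), ξ ≠ 0 → ∃ T ∈ 𝒯, σ.idealizerRep T ξ ≠ 0

namespace IrrRep

theorem rep_idealizerMulRight (σ : IrrRep S) (T : idealizer S) (a : S) :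
    σ.rep (idealizerMulRight T a) = σ.rep a * σ.idealizerRep T := by
  rw [← σ.idealizerRep_of_mem, ← σ.idealizerRep_of_mem, ← map_mul]
  rfl

variable {𝒯 : Set (idealizer S)} {σ : IrrRep S}

theorem exists_rep_idealizerMulRight_ne_zero (h𝒯 : IsNondegenerate 𝒯) {b : S}
    (hb : σ.rep b ≠ 0) : ∃ T ∈ 𝒯, σ.rep (idealizerMulRight T b) ≠ 0 := by
  obtain ⟨ξ, hξ⟩ := σ.exists_apply_ne_zero (a := star b) (by rwa [map_star, star_ne_zero])
  obtain ⟨T, hT, hTξ⟩ := h𝒯.exists_apply_ne_zero σ _ hξ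
  refine ⟨star T, h𝒯.star_mem T hT, fun h0 => hTξ ?_⟩
  have hstar := congrArg star h0
  rw [rep_idealizerMulRight, star_mul, map_star, star_star, star_zero, ← map_star] at hstar
  exact DFunLike.congr_fun hstar ξ

/-- On the dense orbit of `σ(c*) η`, the operator `σ(T)` takes values in
`σ((c S T*)*) η`. -/
theorem finiteDimensional_range_idealizerRep (h𝒯 : IsNondegenerate 𝒯) {c : S}
    (hc : σ.rep c ≠ 0) (hfin : HasFiniteCorners 𝒯 c) {T : idealizer S} (hT : T ∈ 𝒯) :
    FiniteDimensional ℂ (LinearMap.range (σ.idealizerRep T).toLinearMap) := by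
  obtain ⟨η, hη⟩ := σ.exists_apply_ne_zero (a := star c) (by rwa [map_star, star_ne_zero])
  refine finiteDimensional_range_of_denseRange (σ.denseRange_orbit hη) ?_
  let starOrbit : S →ₗ⋆[ℂ] σ.H := (σ.orbit η).comp (starLinearEquiv ℂ (A := S)).toLinearMap
  let corner := LinearMap.range (idealizerMulRight (star T) ∘ₗ LinearMap.mulLeft ℂ c)
  have corner_fg : corner.FG :=
    (Submodule.fg_iff_finiteDimensional _).2 (hfin _ (h𝒯.star_mem T hT))
  have := (Submodule.fg_iff_finiteDimensional _).1 (corner_fg.map starOrbit)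
  refine Submodule.finiteDimensional_of_le (S₂ := corner.map starOrbit) ?_
  rintro _ ⟨b, rfl⟩
  refine ⟨_, ⟨star b, rfl⟩, ?_⟩
  change σ.rep (star (idealizerMulRight (star T) (c * star b))) η
    = σ.idealizerRep T (σ.rep b (σ.rep (star c) η))
  rw [map_star, rep_idealizerMulRight, star_mul, ← map_star, ← map_star, star_star, star_mul,
    star_star, map_mul]
  rfl

theorem isClosed_singleton_of_finiteDimensional_range (h𝒯 : IsNondegenerate 𝒯)
    (hfin : ∀ T ∈ 𝒯, FiniteDimensional ℂ (LinearMap.range (σ.idealizerRep T).toLinearMap)) :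
    IsClosed {σ.toDual} := by
  refine isClosed_singleton_toDual fun x hker => ?_
  obtain ⟨b, hb⟩ := x.ne_zero
  obtain ⟨T, hT, hd⟩ := exists_rep_idealizerMulRight_ne_zero h𝒯 hb
  have finrank_d := finiteDimensional_range_mul (σ.rep b) (hfin T hT)
  rw [← rep_idealizerMulRight] at finrank_d
  refine equiv_of_ker_le hker hd hd (finiteDimensional_range_sandwich finrank_d finrank_d
    fun a => ⟨σ.rep a, ?_⟩)
  rw [cornerMap_apply, map_mul, map_mul]

theorem isOpen_singleton_of_hasFiniteCorners (h𝒯 : IsNondegenerate 𝒯) {c : S}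
    (hc : σ.rep c ≠ 0) (hfin : HasFiniteCorners 𝒯 c) : IsOpen {σ.toDual} := by
  obtain ⟨T, hT, hd⟩ := exists_rep_idealizerMulRight_ne_zero h𝒯 hc
  have := hfin T hT
  obtain ⟨y, hy, hyx⟩ := exists_isolating_element hc hd <| by
    refine Submodule.finiteDimensional_of_le
      (S₂ := LinearMap.range (idealizerMulRight T ∘ₗ LinearMap.mulLeft ℂ c)) ?_
    rintro _ ⟨a, rfl⟩
    refine ⟨a * c, ?_⟩
    change idealizerMulRight T (c * (a * c)) = c * a * idealizerMulRight T c
    rw [mul_idealizerMulRight, mul_assoc]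
  exact isOpen_singleton_toDual hy hyx

theorem exists_hasFiniteCorners_of_isOpen {E : Type*} [NormedAddCommGroup E]
    [InnerProductSpace ℂ E] [CompleteSpace E] {θ : S →⋆ₙₐ[ℂ] (E →L[ℂ] E)}
    (hθ : Function.Injective θ) (h𝒯 : IsNondegenerate 𝒯) (hopen : IsOpen {σ.toDual})
    (hfin : ∀ T ∈ 𝒯, FiniteDimensional ℂ (LinearMap.range (σ.idealizerRep T).toLinearMap)) :
    ∃ c, σ.rep c ≠ 0 ∧ HasFiniteCorners 𝒯 c := by
  obtain ⟨I, ⟨i, hi, hi0⟩, hinj⟩ := exists_ideal_of_isOpen hθ hopen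
  obtain ⟨a, ha⟩ := σ.exists_mul_mul_ne_zero hi0 hi0
  rw [mul_assoc] at ha
  obtain ⟨T, hT, hc⟩ := exists_rep_idealizerMulRight_ne_zero h𝒯 ha
  set c := idealizerMulRight T (i * (a * i)) with hc_def
  have hcI : ∀ T' b, idealizerMulRight T' (c * b) ∈ I := fun T' b => by
    rw [hc_def, ← mul_idealizerMulRight, ← mul_idealizerMulRight, mul_assoc]
    exact I.mul_mem_right _ _ hi
  have finrank_c := finiteDimensional_range_mul (σ.rep (i * (a * i))) (hfin T hT)
  rw [← rep_idealizerMulRight] at finrank_c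
  refine ⟨c, hc, fun T' hT' => finiteDimensional_range_of_ker_le
    (L := (σ.rep : S →ₗ[ℂ] σ.H →L[ℂ] σ.H) ∘ₗ idealizerMulRight T' ∘ₗ LinearMap.mulLeft ℂ c)
    (fun b hb => hinj _ (hcI T' b) hb)
    (finiteDimensional_range_sandwich finrank_c (hfin T' hT') fun b => ⟨σ.rep b, ?_⟩)⟩
  change σ.rep (idealizerMulRight T' (c * b)) = _
  rw [rep_idealizerMulRight, map_mul]

theorem exists_hasFiniteCorners_iff {E : Type*} [NormedAddCommGroup E]
    [InnerProductSpace ℂ E] [CompleteSpace E] {θ : S →⋆ₙₐ[ℂ] (E →L[ℂ] E)}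
    (hθ : Function.Injective θ) (h𝒯 : IsNondegenerate 𝒯) :
    (∃ c, σ.rep c ≠ 0 ∧ HasFiniteCorners 𝒯 c) ↔ IsClopen {σ.toDual} ∧
      ∀ T ∈ 𝒯, FiniteDimensional ℂ (LinearMap.range (σ.idealizerRep T).toLinearMap) := by
  constructor
  · rintro ⟨c, hc, hcorner⟩
    have hfin := fun T (hT : T ∈ 𝒯) => finiteDimensional_range_idealizerRep h𝒯 hc hcorner hT
    exact ⟨⟨isClosed_singleton_of_finiteDimensional_range h𝒯 hfin,
      isOpen_singleton_of_hasFiniteCorners h𝒯 hc hcorner⟩, hfin⟩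
  · rintro ⟨hclopen, hfin⟩
    exact exists_hasFiniteCorners_of_isOpen hθ h𝒯 hclopen.isOpen hfin

theorem exists_fixed_of_ideal {A : Type u} [NonUnitalCStarAlgebra A] {ρ : IrrRep A}
    {J : NonUnitalStarSubalgebra ℂ A} (hJ : IsStarIdeal J) (h : ∃ j ∈ J, ρ.rep j ≠ 0) :
    ∃ c, ρ.rep c ≠ 0 ∧ ∃ b ∈ J, b * c = c := by
  obtain ⟨j, hj, hj0⟩ := h
  have star_mul_ne_zero : ρ.rep (star j * j) ≠ 0 := by
    rw [map_mul, map_star]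
    exact mt (CStarRing.star_mul_self_eq_zero_iff _).1 hj0
  have hpos := norm_pos_iff.2 star_mul_ne_zero
  obtain ⟨c, g, hc, hgc, -⟩ :=
    exists_truncation_of_isSelfAdjoint (IsSelfAdjoint.star_mul_self j) (half_pos hpos)
  refine ⟨c, fun h0 => ?_, g * (star j * j), hJ _ _ (hJ _ _ hj), hgc⟩
  have hle := (NonUnitalStarAlgHom.norm_apply_le ρ.rep (c - star j * j)).trans hc
  rw [map_sub, h0, zero_sub, norm_neg] at hle
  linarith

end IrrRep

end FiniteCorners

/-! ### Haar measures invariant under inversion -/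

section Haar

variable {G : Type*} [Group G] [TopologicalSpace G] [IsTopologicalGroup G] [LocallyCompactSpace G]
  [MeasurableSpace G] [BorelSpace G]

theorem isInvInvariant_of_isMulRightInvariant (μ : Measure G) [μ.IsHaarMeasure] [μ.Regular]
    [μ.IsMulRightInvariant] : μ.IsInvInvariant := by
  let c : ℝ≥0∞ := Measure.haarScalarFactor μ.inv μ
  have hinv : μ.inv = c • μ := Measure.isMulLeftInvariant_eq_smul_of_regular μ.inv μ
  have hsq : c ^ 2 • μ = μ := by
    rw [pow_two, ← smul_smul, ← hinv, ← Measure.inv_inv μ, Measure.inv_inv, Measure.inv_def μ.inv,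
      hinv, Measure.map_smul, ← Measure.inv_def, hinv]
  let Q : TopologicalSpace.PositiveCompacts G := Classical.arbitrary _
  have hsq_apply : c ^ 2 * μ Q = 1 * μ Q := by
    rw [one_mul, ← smul_eq_mul, ← Measure.smul_apply, hsq]
  have hsq_one : c ^ 2 = 1 := (ENNReal.mul_left_inj
    (Measure.measure_pos_of_nonempty_interior _ Q.interior_nonempty).ne'
    Q.isCompact.measure_lt_top.ne).1 hsq_apply
  have hone : c = 1 := (ENNReal.pow_right_strictMono two_ne_zero).injective (by simpa using hsq_one)
  exact ⟨by rw [hinv, hone, one_smul]⟩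

variable [CompactSpace G] (ν : Measure G) [ν.IsHaarMeasure]

theorem isMulRightInvariant_of_compactSpace : ν.IsMulRightInvariant := by
  refine ⟨fun g => ?_⟩
  have hmap := Measure.isMulLeftInvariant_eq_smul_of_regular (ν.map (· * g)) ν
  have map_univ : (ν.map (· * g)) Set.univ = ν Set.univ := by
    rw [Measure.map_apply (continuous_mul_const g).measurable MeasurableSet.univ, Set.preimage_univ]
  have factor_mul : (Measure.haarScalarFactor (ν.map (· * g)) ν : ℝ≥0∞) * ν Set.univ
      = 1 * ν Set.univ := by
    rw [one_mul]
    exact (congrArg (fun m => m Set.univ) hmap).symm.trans map_univ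
  have factor_eq_one := (ENNReal.mul_left_inj (NeZero.ne _) (measure_ne_top _ _)).1 factor_mul
  rw [hmap, ENNReal.coe_eq_one.1 factor_eq_one, one_smul]

theorem isInvInvariant_of_compactSpace : ν.IsInvInvariant :=
  have := isMulRightInvariant_of_compactSpace ν
  isInvInvariant_of_isMulRightInvariant ν

end Haar

/-! ### Translates of compactly supported functions -/

section Translates

variable {G : Type*} [Group G] [TopologicalSpace G] [IsTopologicalGroup G]

/-- The left translate `x ↦ f(g⁻¹ x)` of `f`. -/
def leftTranslate (g : G) (f : C_c(G, ℂ)) : C_c(G, ℂ) :=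
  f.comp (Homeomorph.mulLeft g⁻¹).toCocompactMap

/-- The right translate `x ↦ f(x g)` of `f`. -/
def rightTranslate (g : G) (f : C_c(G, ℂ)) : C_c(G, ℂ) :=
  f.comp (Homeomorph.mulRight g).toCocompactMap

/-- The inversion `x ↦ f(x⁻¹)` of `f`. -/
def inversion (f : C_c(G, ℂ)) : C_c(G, ℂ) := f.comp (Homeomorph.inv G).toCocompactMap

theorem leftTranslate_apply (g : G) (f : C_c(G, ℂ)) (x : G) :
    leftTranslate g f x = f (g⁻¹ * x) := rfl

theorem rightTranslate_apply (g : G) (f : C_c(G, ℂ)) (x : G) :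
    rightTranslate g f x = f (x * g) := rfl

theorem inversion_apply (f : C_c(G, ℂ)) (x : G) : inversion f x = f x⁻¹ := rfl

theorem inversion_inversion (f : C_c(G, ℂ)) : inversion (inversion f) = f := by
  ext x
  simp [inversion_apply]

open scoped Pointwise in
theorem tendsto_integral_norm_leftTranslate_sub [LocallyCompactSpace G]
    [MeasurableSpace G] [BorelSpace G] (μ : Measure G) [IsFiniteMeasureOnCompacts μ]
    (f : C_c(G, ℂ)) (g₀ : G) :
    Filter.Tendsto (fun g => ∫ x, ‖leftTranslate g f x - leftTranslate g₀ f x‖ ∂μ) (nhds g₀)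
      (nhds 0) := by
  obtain ⟨s, hs, hsg⟩ := exists_compact_mem_nhds g₀
  have apply_eq_zero : ∀ g ∈ s, ∀ x, x ∉ s * tsupport f → leftTranslate g f x = 0 :=
    fun g hg x hx => by
      by_contra h
      exact hx ⟨g, hg, g⁻¹ * x, subset_tsupport _ h, by simp⟩
  have integral_cont : ContinuousOn
      (fun g => ∫ x, ‖leftTranslate g f x - leftTranslate g₀ f x‖ ∂μ) s := by
    refine continuousOn_integral_of_compact_support (hs.mul f.hasCompactSupport) ?_
      fun g x hg hx => ?_
    · have := f.continuous
      change ContinuousOn (fun p : G × G => ‖f (p.1⁻¹ * p.2) - f (g₀⁻¹ * p.2)‖) _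
      fun_prop
    · rw [apply_eq_zero g hg x hx, apply_eq_zero g₀ (mem_of_mem_nhds hsg) x hx, sub_zero, norm_zero]
  simpa using (integral_cont.continuousAt hsg).tendsto

namespace UnitaryRep

variable [MeasurableSpace G] [BorelSpace G] (μ : Measure G) [IsFiniteMeasureOnCompacts μ]
  {H : Type*} [NormedAddCommGroup H] [InnerProductSpace ℂ H] [CompleteSpace H]

theorem integrated_leftTranslate [μ.IsMulLeftInvariant] (π : UnitaryRep G H) (g : G)
    (f : C_c(G, ℂ)) (ξ : H) :
    π.integrated μ (leftTranslate g f) ξ = π.toHom g (π.integrated μ f ξ) := by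
  calc π.integrated μ (leftTranslate g f) ξ
      = ∫ x, leftTranslate g f (g * x) • π.toHom (g * x) ξ ∂μ :=
        (integral_mul_left_eq_self _ g).symm
    _ = ∫ x, π.toHom g (f x • π.toHom x ξ) ∂μ := by
        simp only [leftTranslate_apply, inv_mul_cancel_left, map_mul_apply, map_smul]
    _ = π.toHom g (π.integrated μ f ξ) :=
        (π.toHom g).toContinuousLinearEquiv.toContinuousLinearMap.integral_comp_comm
          (π.integrable_smul μ f ξ)

theorem integrated_rightTranslate [μ.IsMulRightInvariant] (π : UnitaryRep G H) (g : G)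
    (f : C_c(G, ℂ)) (ξ : H) :
    π.integrated μ (rightTranslate g f) ξ = π.integrated μ f (π.toHom g⁻¹ ξ) := by
  rw [integrated_apply, integrated_apply,
    ← integral_mul_right_eq_self (fun x => f x • π.toHom x (π.toHom g⁻¹ ξ)) g]
  simp only [rightTranslate_apply, ← map_mul_apply, mul_inv_cancel_right]

theorem star_integrated [μ.IsInvInvariant] (π : UnitaryRep G H) (f : C_c(G, ℂ)) :
    star (π.integrated μ f) = π.integrated μ (star (inversion f)) := by
  rw [ContinuousLinearMap.star_eq_adjoint, eq_comm, ContinuousLinearMap.eq_adjoint_iff]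
  exact π.inner_integrated_left μ fun g => by simp [inversion_apply]

theorem continuous_integrated_leftTranslate [LocallyCompactSpace G]
    (π : UnitaryRep G H) (f : C_c(G, ℂ)) :
    Continuous fun g => π.integrated μ (leftTranslate g f) := by
  refine continuous_iff_continuousAt.2 fun g₀ => tendsto_iff_norm_sub_tendsto_zero.2
    (squeeze_zero (fun _ => norm_nonneg _) (fun g => ?_)
      (tendsto_integral_norm_leftTranslate_sub μ f g₀))
  simp only [← integratedₗ_apply, ← map_sub]
  exact π.norm_integrated_le μ (leftTranslate g f - leftTranslate g₀ f)

end UnitaryRep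

end Translates

/-! ### Unitary representations by multipliers -/

theorem continuous_apply_of_mem_closure {X E F : Type*} [TopologicalSpace X]
    [NormedAddCommGroup E] [NormedSpace ℂ E] [NormedAddCommGroup F] [NormedSpace ℂ F]
    {T : X → E →ₗ[ℂ] F} (hT : ∀ x e, ‖T x e‖ ≤ ‖e‖) {s : Set E}
    (hs : ∀ e ∈ s, Continuous fun x => T x e) {e : E} (he : e ∈ closure s) :
    Continuous fun x => T x e := by
  refine continuous_of_uniform_approx_of_continuous fun u hu => ?_
  obtain ⟨ε, hε, hεu⟩ := Metric.mem_uniformity_dist.1 hu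
  obtain ⟨e', he', hd⟩ := Metric.mem_closure_iff.1 he ε hε
  refine ⟨fun x => T x e', hs e' he', fun x => hεu ?_⟩
  rw [dist_eq_norm, ← map_sub]
  exact (hT x _).trans_lt (by rwa [← dist_eq_norm])

theorem star_unitary_eq_map_inv {G B : Type*} [Group G] [Monoid B] [StarMul B] (u : G →* unitary B)
    (g : G) : star (u g : B) = u g⁻¹ := by
  rw [map_inv, ← Unitary.star_eq_inv, Unitary.coe_star]

section Multiplier

variable {G : Type*} [Group G] [TopologicalSpace G] {B : Type u} [CStarAlgebra B]
  {u : G →* unitary B} {S : NonUnitalStarSubalgebra ℂ B}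

/-- The unitaries `u g` are multipliers of `S`, strictly continuously in `g`. -/
structure IsMultiplier (u : G →* unitary B) (S : NonUnitalStarSubalgebra ℂ B) : Prop where
  mul_mem : ∀ g, ∀ a ∈ S, u g * a ∈ S
  continuous_mul : ∀ a ∈ S, Continuous fun g => u g * a

namespace IsMultiplier

theorem restrict (h : IsMultiplier u S) (K : Subgroup G) : IsMultiplier (u.comp K.subtype) S :=
  ⟨fun k => h.mul_mem k, fun a ha => (h.continuous_mul a ha).comp continuous_subtype_val⟩

theorem mem_idealizer (h : IsMultiplier u S) (g : G) : (u g : B) ∈ idealizer S := fun a ha =>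
  ⟨h.mul_mem g a ha, by
    have := star_mem (h.mul_mem g⁻¹ (star a) (star_mem ha))
    rwa [star_mul, star_star, star_unitary_eq_map_inv, inv_inv] at this⟩

/-- The unitary `u g` as an element of the idealizer of `S`. -/
def toIdealizer (h : IsMultiplier u S) (g : G) : idealizer S := ⟨u g, h.mem_idealizer g⟩

theorem toIdealizer_mul (h : IsMultiplier u S) (g g' : G) :
    h.toIdealizer (g * g') = h.toIdealizer g * h.toIdealizer g' :=
  Subtype.ext (by simp [toIdealizer])

theorem star_toIdealizer (h : IsMultiplier u S) (g : G) :
    star (h.toIdealizer g) = h.toIdealizer g⁻¹ :=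
  Subtype.ext (star_unitary_eq_map_inv u g)

theorem continuous_idealizerMulLeft (h : IsMultiplier u S) (a : S) :
    Continuous fun g => idealizerMulLeft (h.toIdealizer g) a :=
  (h.continuous_mul a a.2).subtype_mk _

variable [IsClosed (S : Set B)] (h : IsMultiplier u S) (σ : IrrRep S)

theorem idealizerRep_one : σ.idealizerRep (h.toIdealizer 1) = 1 :=
  IrrRep.clm_ext fun a η => by
    have h_one : idealizerMulLeft (h.toIdealizer 1) a = a :=
      Subtype.ext (by simp [coe_idealizerMulLeft, toIdealizer])
    rw [σ.idealizerRep_apply, h_one, one_apply_eq_self]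

theorem idealizerRep_mul (g g' : G) :
    σ.idealizerRep (h.toIdealizer (g * g')) =
      σ.idealizerRep (h.toIdealizer g) * σ.idealizerRep (h.toIdealizer g') := by
  rw [toIdealizer_mul, map_mul]

theorem idealizerRep_mem_unitary (g : G) :
    σ.idealizerRep (h.toIdealizer g) ∈ unitary (σ.H →L[ℂ] σ.H) := by
  simp only [Unitary.mem_iff, ← map_star, star_toIdealizer, ← idealizerRep_mul, inv_mul_cancel,
    mul_inv_cancel, idealizerRep_one, and_self]

theorem continuous_idealizerRep_apply (ξ : σ.H) :
    Continuous fun g => σ.idealizerRep (h.toIdealizer g) ξ := by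
  obtain ⟨η, hη⟩ := σ.exists_ne_zero
  refine continuous_apply_of_mem_closure
    (T := fun g => (σ.idealizerRep (h.toIdealizer g)).toLinearMap)
    (fun g ζ => (Unitary.norm_map ⟨_, h.idealizerRep_mem_unitary σ g⟩ ζ).le)
    (s := Set.range (σ.orbit η)) ?_ (σ.denseRange_orbit hη ξ)
  rintro _ ⟨a, rfl⟩
  simpa only [ContinuousLinearMap.coe_coe, σ.orbit_apply, σ.idealizerRep_apply] using!
    (σ.continuous_rep.comp (h.continuous_idealizerMulLeft a)).clm_apply continuous_const

/-- The unitary representation of `G` on the space of an irreducible representation `σ` of `S`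
characterized by `π_σ(g) σ(a) = σ(u(g) a)`. -/
def multiplierRep : UnitaryRep G σ.H where
  toHom := Unitary.linearIsometryEquiv.toMonoidHom.comp
    { toFun := fun g => ⟨σ.idealizerRep (h.toIdealizer g), h.idealizerRep_mem_unitary σ g⟩
      map_one' := Subtype.ext (h.idealizerRep_one σ)
      map_mul' := fun g g' => Subtype.ext (h.idealizerRep_mul σ g g') }
  strongly_continuous := h.continuous_idealizerRep_apply σ

theorem multiplierRep_apply (g : G) (a : S) (η : σ.H) :
    (h.multiplierRep σ).toHom g (σ.rep a η) = σ.rep (idealizerMulLeft (h.toIdealizer g) a) η :=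
  σ.idealizerRep_apply _ a η

variable [MeasurableSpace G] [BorelSpace G] {μ : Measure G} [IsFiniteMeasureOnCompacts μ]

theorem idealizerRep_eq_integrated {T : idealizer S} {f : C_c(G, ℂ)}
    (hT : ∀ a ∈ S, T * a = ∫ g, f g • (u g * a) ∂μ) :
    σ.idealizerRep T = (h.multiplierRep σ).integrated μ f :=
  IrrRep.clm_ext fun a η => by
    let ugMul (g : G) : S := idealizerMulLeft (h.toIdealizer g) a
    let orbit : S →L[ℂ] σ.H := ⟨σ.orbit η, σ.continuous_rep.clm_apply continuous_const⟩
    have hint : Integrable (fun g => f g • ugMul g) μ :=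
      (f.continuous.smul (h.continuous_idealizerMulLeft a)).integrable_of_hasCompactSupport
        f.hasCompactSupport.smul_right
    have hTa : idealizerMulLeft T a = ∫ g, f g • ugMul g ∂μ :=
      Subtype.ext ((hT a a.2).trans (S.toSubmodule.subtypeL.integral_comp_comm hint))
    rw [σ.idealizerRep_apply, hTa, UnitaryRep.integrated_apply]
    refine (orbit.integral_comp_comm hint).symm.trans (integral_congr_ae (ae_of_all _ fun g => ?_))
    exact (map_smul orbit _ _).trans (congrArg _ (h.multiplierRep_apply σ g a η).symm)

end IsMultiplier

end Multiplier

/-! ### Multipliers from unitary representations -/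

namespace UnitaryRep

variable {G : Type*} [Group G] [TopologicalSpace G]
  {E : Type u} [NormedAddCommGroup E] [InnerProductSpace ℂ E] [CompleteSpace E]

/-- A unitary representation as a homomorphism to the unitary group of the algebra of bounded
operators. -/
def unitaryHom (π : UnitaryRep G E) : G →* unitary (E →L[ℂ] E) :=
  Unitary.linearIsometryEquiv.symm.toMonoidHom.comp π.toHom

variable [MeasurableSpace G] [BorelSpace G] (μ : Measure G) [IsFiniteMeasureOnCompacts μ]
  (π : UnitaryRep G E) (f : C_c(G, ℂ)) {S : NonUnitalStarSubalgebra ℂ (E →L[ℂ] E)}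

theorem integrable_smul_unitaryHom_mul {a : E →L[ℂ] E}
    (ha : Continuous fun g => (π.unitaryHom g * a : E →L[ℂ] E)) :
    Integrable (fun g => f g • (π.unitaryHom g * a : E →L[ℂ] E)) μ :=
  (f.continuous.smul ha).integrable_of_hasCompactSupport f.hasCompactSupport.smul_right

theorem integrated_mul {a : E →L[ℂ] E}
    (ha : Continuous fun g => (π.unitaryHom g * a : E →L[ℂ] E)) :
    π.integrated μ f * a = ∫ g, f g • (π.unitaryHom g * a : E →L[ℂ] E) ∂μ := by
  ext ξ
  rw [ContinuousLinearMap.integral_apply (π.integrable_smul_unitaryHom_mul μ f ha)]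
  rfl

theorem integrated_mul_mem [IsClosed (S : Set (E →L[ℂ] E))] (h : IsMultiplier π.unitaryHom S)
    {a : E →L[ℂ] E} (ha : a ∈ S) : π.integrated μ f * a ∈ S := by
  rw [π.integrated_mul μ f (h.continuous_mul a ha)]
  exact integral_mem_of_isClosed S.toSubmodule ‹_›
    (π.integrable_smul_unitaryHom_mul μ f (h.continuous_mul a ha))
    fun g => S.toSubmodule.smul_mem _ (h.mul_mem g a ha)

theorem integrated_mem_idealizer [IsTopologicalGroup G] [μ.IsInvInvariant]
    [IsClosed (S : Set (E →L[ℂ] E))] (h : IsMultiplier π.unitaryHom S) :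
    π.integrated μ f ∈ idealizer S := fun a ha => by
  refine ⟨π.integrated_mul_mem μ f h ha, ?_⟩
  have hstar := star_mem (π.integrated_mul_mem μ (star (inversion f)) h (star_mem ha))
  rwa [← star_integrated, star_mul, star_star, star_star] at hstar

variable {f} in
theorem idealizerRep_eq_integrated [IsClosed (S : Set (E →L[ℂ] E))]
    (h : IsMultiplier π.unitaryHom S) (σ : IrrRep S) {T : idealizer S}
    (hT : (T : E →L[ℂ] E) = π.integrated μ f) :
    σ.idealizerRep T = (h.multiplierRep σ).integrated μ f :=
  h.idealizerRep_eq_integrated σ fun a ha => by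
    rw [hT, π.integrated_mul μ f (h.continuous_mul a ha)]

end UnitaryRep

section IntegratedProducts

variable {G : Type*} [Group G] [TopologicalSpace G] [IsTopologicalGroup G] [MeasurableSpace G]
  [BorelSpace G] (μ : Measure G) [μ.IsHaarMeasure]
  {H : Type u} [NormedAddCommGroup H] [InnerProductSpace ℂ H] [CompleteSpace H]
  (π : UnitaryRep G H)

theorem UnitaryRep.unitaryHom_mul_integrated (g : G) (f : C_c(G, ℂ)) :
    (π.unitaryHom g * π.integrated μ f : H →L[ℂ] H) = π.integrated μ (leftTranslate g f) :=
  ContinuousLinearMap.ext fun ξ => (π.integrated_leftTranslate μ g f ξ).symm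

variable [LocallyCompactSpace G]

theorem UnitaryRep.integrated_mul_integrated_mem_closure (f f' : C_c(G, ℂ)) :
    π.integrated μ f * π.integrated μ f' ∈ closure (Set.range (π.integrated μ)) := by
  let N := (LinearMap.range (π.integratedₗ μ)).topologicalClosure
  have hcont : Continuous fun g => (π.unitaryHom g * π.integrated μ f' : H →L[ℂ] H) := by
    simpa only [unitaryHom_mul_integrated] using π.continuous_integrated_leftTranslate μ f'
  rw [π.integrated_mul μ f hcont]
  refine integral_mem_of_isClosed N (Submodule.isClosed_topologicalClosure _)
    (π.integrable_smul_unitaryHom_mul μ f hcont) fun g => N.smul_mem _ ?_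
  rw [unitaryHom_mul_integrated]
  exact Submodule.le_topologicalClosure _ ⟨_, rfl⟩

end IntegratedProducts

section Representative

variable {K : Type u} [Group K] [TopologicalSpace K] [IsTopologicalGroup K] [CompactSpace K]

theorem IsRepresentative.star_inversion {φ : C_c(K, ℂ)} (h : IsRepresentative φ) :
    IsRepresentative (star (inversion φ)) := by
  obtain ⟨V, _, _, _, τ, v, w, rfl⟩ := h
  exact ⟨V, _, _, inferInstance, τ, w, v,
    CompactlySupportedContinuousMap.ext fun k => (matrixCoeff_swap τ v w k).symm⟩

variable [MeasurableSpace K] [BorelSpace K] (ν : Measure K) [ν.IsHaarMeasure]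
  {E : Type u} [NormedAddCommGroup E] [InnerProductSpace ℂ E] [CompleteSpace E]

/-- The multipliers of `S` of the form `∫ φ(k) κ(k) dk` with a representative function `φ`. -/
def representativeMultipliers (κ : UnitaryRep K E) (S : NonUnitalStarSubalgebra ℂ (E →L[ℂ] E)) :
    Set (idealizer S) :=
  {T | ∃ φ, IsRepresentative φ ∧ (T : E →L[ℂ] E) = κ.integrated ν φ}

variable {κ : UnitaryRep K E} {S : NonUnitalStarSubalgebra ℂ (E →L[ℂ] E)}
  [IsClosed (S : Set (E →L[ℂ] E))]

theorem isNondegenerate_representativeMultipliers (h : IsMultiplier κ.unitaryHom S) :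
    IsNondegenerate (representativeMultipliers ν κ S) where
  star_mem := by
    rintro T ⟨φ, hφ, hT⟩
    have := isInvInvariant_of_compactSpace ν
    exact ⟨_, hφ.star_inversion, (congrArg star hT).trans (κ.star_integrated ν φ)⟩
  exists_apply_ne_zero σ ξ hξ := by
    have := isInvInvariant_of_compactSpace ν
    obtain ⟨φ, hφ, hφξ⟩ := exists_isRepresentative_apply_ne_zero ν (h.multiplierRep σ) hξ
    refine ⟨⟨_, κ.integrated_mem_idealizer ν φ h⟩, ⟨φ, hφ, rfl⟩, ?_⟩
    rwa [κ.idealizerRep_eq_integrated ν h σ rfl]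

theorem finiteDimensional_range_representativeMultipliers_iff (h : IsMultiplier κ.unitaryHom S)
    (σ : IrrRep S) :
    (∀ T ∈ representativeMultipliers ν κ S,
        FiniteDimensional ℂ (LinearMap.range (σ.idealizerRep T).toLinearMap)) ↔
      ∀ φ, IsRepresentative φ → FiniteDimensional ℂ
        (LinearMap.range ((h.multiplierRep σ).integrated ν φ).toLinearMap) := by
  have := isInvInvariant_of_compactSpace ν
  constructor
  · intro hfin φ hφ
    rw [← κ.idealizerRep_eq_integrated ν (T := ⟨_, κ.integrated_mem_idealizer ν φ h⟩) h σ rfl]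
    exact hfin _ ⟨φ, hφ, rfl⟩
  · rintro hfin T ⟨φ, hφ, hT⟩
    rw [κ.idealizerRep_eq_integrated ν h σ hT]
    exact hfin φ hφ

theorem UnitaryRep.isAdmissible_iff {G : Type u} [Group G] [TopologicalSpace G]
    [IsTopologicalGroup G] [MeasurableSpace G] [BorelSpace G] {K : Subgroup G} [CompactSpace K]
    (ν : Measure K) [ν.IsHaarMeasure] (π : UnitaryRep G E) :
    π.IsAdmissible K ↔ ∀ φ, IsRepresentative φ →
      FiniteDimensional ℂ (LinearMap.range ((π.restrict K).integrated ν φ).toLinearMap) :=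
  ⟨fun hπ _ hφ => finiteDimensional_range_integrated ν hπ hφ,
    fun hπ _ _ _ _ _ hτ => finiteDimensional_intertwiners_of_isIrreducible ν hπ hτ⟩

end Representative

/-! ### Disintegration -/

section Integration

variable {G : Type u} [Group G] [TopologicalSpace G] [MeasurableSpace G]
  [BorelSpace G] (μ : Measure G) [IsFiniteMeasureOnCompacts μ]

/-- `ρ` is unitarily equivalent to the integrated form of `π`, where a function on `G` is seen as
an element of `A` through `conv`. For `conv = leftConv μ` this is `IsIntegratedForm`. -/
def IntegratesTo {A : Type u} [NonUnitalRing A] [StarRing A] [Module ℂ A] (conv : C_c(G, ℂ) → A)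
    (ρ : IrrRep A) (π : IrrUnitaryRep G) : Prop :=
  ∃ U : π.H ≃ₗᵢ[ℂ] ρ.H, ∀ (f : C_c(G, ℂ)) (ξ : π.H),
    U (π.rep.integrated μ f ξ) = ρ.rep (conv f) (U ξ)

variable {μ} {A : Type u} [NonUnitalCStarAlgebra A] {conv : C_c(G, ℂ) → A} {ρ ρ' : IrrRep A}

theorem UnitaryRep.isIrreducible_of_rep_eq_integrated (hconv : DenseRange conv)
    {π : UnitaryRep G ρ.H} (hπ : ∀ f, ρ.rep (conv f) = π.integrated μ f) : π.IsIrreducible := by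
  obtain ⟨ξ₀, hξ₀⟩ := ρ.exists_ne_zero
  refine ⟨⟨ξ₀, 0, hξ₀⟩, fun W hW hWπ => ρ.irreducible W hW fun a ξ hξ => ?_⟩
  refine hconv.induction_on (p := fun a => ρ.rep a ξ ∈ W) a
    (hW.preimage (ρ.continuous_rep.clm_apply continuous_const)) fun f => ?_
  rw [hπ]
  exact integral_mem_of_isClosed W hW (π.integrable_smul μ f ξ)
    fun g => W.smul_mem _ (hWπ g ξ hξ)

namespace IntegratesTo

variable {π π' : IrrUnitaryRep G}

theorem congr_left (h : IntegratesTo μ conv ρ π) (hρ : ρ ≈ ρ') : IntegratesTo μ conv ρ' π := by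
  obtain ⟨U, hU⟩ := h
  obtain ⟨W, hW⟩ := hρ
  exact ⟨U.trans W, fun f ξ => by simp [hU, hW]⟩

theorem congr_right (h : IntegratesTo μ conv ρ π) (hπ : π' ≈ π) : IntegratesTo μ conv ρ π' := by
  obtain ⟨U, hU⟩ := h
  obtain ⟨W, hW⟩ := hπ
  refine ⟨W.trans U, fun f ξ => ?_⟩
  have hWf : W (π'.rep.integrated μ f ξ) = π.rep.integrated μ f (W ξ) :=
    UnitaryRep.map_integrated μ (T := W.toContinuousLinearEquiv.toContinuousLinearMap) hW f ξ
  rw [LinearIsometryEquiv.trans_apply, hWf, hU]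
  rfl

theorem equiv_left (hconv : DenseRange conv) (h : IntegratesTo μ conv ρ π)
    (h' : IntegratesTo μ conv ρ' π) : ρ ≈ ρ' := by
  obtain ⟨U, hU⟩ := h
  obtain ⟨W, hW⟩ := h'
  refine ⟨U.symm.trans W, fun a ξ => ?_⟩
  refine hconv.induction_on
    (p := fun a => W (U.symm (ρ.rep a ξ)) = ρ'.rep a (W (U.symm ξ))) a
    (isClosed_eq (W.continuous.comp (U.symm.continuous.comp
      (ρ.continuous_rep.clm_apply continuous_const)))
      (ρ'.continuous_rep.clm_apply continuous_const)) fun f => ?_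
  rw [← hW, EmbeddingLike.apply_eq_iff_eq, LinearIsometryEquiv.symm_apply_eq, hU,
    LinearIsometryEquiv.apply_symm_apply]

theorem denseRange_integrated_apply (hconv : DenseRange conv) (h : IntegratesTo μ conv ρ π)
    {ξ : π.H} (hξ : ξ ≠ 0) :
    DenseRange fun f => π.rep.integrated μ f ξ := by
  obtain ⟨U, hU⟩ := h
  have hdense : DenseRange fun f => ρ.rep (conv f) (U ξ) :=
    (ρ.denseRange_orbit (U.map_eq_zero_iff.not.2 hξ)).comp hconv
      (ρ.continuous_rep.clm_apply continuous_const)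
  simpa [Function.comp_def, ← hU] using
    U.symm.surjective.denseRange.comp hdense U.symm.continuous

variable [IsTopologicalGroup G] [μ.IsMulLeftInvariant]

theorem equiv_right (hconv : DenseRange conv) (h : IntegratesTo μ conv ρ π)
    (h' : IntegratesTo μ conv ρ π') : π ≈ π' := by
  obtain ⟨ξ₀, ζ, hξζ⟩ := π.irreducible.1
  have hdense := h.denseRange_integrated_apply hconv (sub_ne_zero.2 hξζ)
  obtain ⟨U, hU⟩ := h
  obtain ⟨W, hW⟩ := h'
  let V := U.trans W.symm
  have hV : ∀ f ξ, V (π.rep.integrated μ f ξ) = π'.rep.integrated μ f (V ξ) := fun f ξ => by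
    rw [LinearIsometryEquiv.trans_apply, LinearIsometryEquiv.symm_apply_eq, hU, hW,
      LinearIsometryEquiv.trans_apply, LinearIsometryEquiv.apply_symm_apply]
  refine ⟨V, fun g ξ => ?_⟩
  refine congrFun (hdense.equalizer (g := fun ξ => V (π.rep.toHom g ξ))
    (h := fun ξ => π'.rep.toHom g (V ξ)) (V.continuous.comp (π.rep.toHom g).continuous)
    ((π'.rep.toHom g).continuous.comp V.continuous) (funext fun f => ?_)) ξ
  rw [Function.comp_apply, Function.comp_apply, ← π.rep.integrated_leftTranslate μ, hV, hV,
    π'.rep.integrated_leftTranslate μ]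

end IntegratesTo

end Integration

section ReducedAlgebra

variable {G : Type u} [Group G] [TopologicalSpace G] [IsTopologicalGroup G]
  [LocallyCompactSpace G] [MeasurableSpace G] [BorelSpace G]
  (μ : Measure G) [μ.IsHaarMeasure] [μ.Regular]

instance isClosed_reducedCStar :
    IsClosed (reducedCStar μ : Set (Lp ℂ 2 μ →L[ℂ] Lp ℂ 2 μ)) :=
  NonUnitalStarSubalgebra.isClosed_topologicalClosure _

variable [μ.IsMulRightInvariant]

theorem mem_closure_range_integrated {a : Lp ℂ 2 μ →L[ℂ] Lp ℂ 2 μ} (ha : a ∈ reducedCStar μ) :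
    a ∈ closure (Set.range ((leftRegular μ).integrated μ)) := by
  have := isInvInvariant_of_isMulRightInvariant μ
  let N := (LinearMap.range ((leftRegular μ).integratedₗ μ)).topologicalClosure
  refine closure_minimal (t := N) (fun T hT => ?_) (Submodule.isClosed_topologicalClosure _) ha
  induction hT using NonUnitalStarAlgebra.adjoin_induction with
  | mem T hT => exact subset_closure hT
  | add S T _ _ hS hT => exact N.add_mem hS hT
  | zero => exact N.zero_mem
  | smul c T _ hT => exact N.smul_mem c hT
  | mul S T _ _ hS hT =>
    refine isClosed_closure.closure_subset (map_mem_closure₂ continuous_mul hS hT ?_)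
    rintro _ ⟨f, rfl⟩ _ ⟨f', rfl⟩
    exact (leftRegular μ).integrated_mul_integrated_mem_closure μ f f'
  | star T _ hT =>
    refine map_mem_closure continuous_star hT ?_
    rintro _ ⟨f, rfl⟩
    exact ⟨star (inversion f), ((leftRegular μ).star_integrated μ f).symm⟩

theorem denseRange_leftConv : DenseRange (leftConv μ) := fun a => by
  rw [closure_subtype, ← Set.range_comp]
  exact mem_closure_range_integrated μ a.2

theorem isMultiplier_leftRegular : IsMultiplier (leftRegular μ).unitaryHom (reducedCStar μ) where
  mul_mem g a ha := by
    refine (isClosed_reducedCStar μ).closure_subset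
      (map_mem_closure (continuous_const_mul _) (mem_closure_range_integrated μ ha) ?_)
    rintro _ ⟨f, rfl⟩
    rw [UnitaryRep.unitaryHom_mul_integrated]
    exact (leftConv μ _).2
  continuous_mul a ha := by
    refine continuous_apply_of_mem_closure
      (T := fun g => LinearMap.mulLeft ℂ ((leftRegular μ).unitaryHom g : Lp ℂ 2 μ →L[ℂ] Lp ℂ 2 μ))
      (fun g b => (CStarRing.norm_coe_unitary_mul _ b).le) ?_ (mem_closure_range_integrated μ ha)
    rintro _ ⟨f, rfl⟩
    simpa only [LinearMap.mulLeft_apply, UnitaryRep.unitaryHom_mul_integrated] using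
      (leftRegular μ).continuous_integrated_leftTranslate μ f

theorem IrrRep.rep_leftConv (ρ : IrrRep (reducedCStar μ)) (f : C_c(G, ℂ)) :
    ρ.rep (leftConv μ f) = ((isMultiplier_leftRegular μ).multiplierRep ρ).integrated μ f := by
  rw [← ρ.idealizerRep_of_mem]
  exact (leftRegular μ).idealizerRep_eq_integrated μ _ ρ rfl

/-- The irreducible representation of `G` whose integrated form is `ρ`. -/
def IrrRep.disintegrate (ρ : IrrRep (reducedCStar μ)) : IrrUnitaryRep G where
  H := ρ.H
  rep := (isMultiplier_leftRegular μ).multiplierRep ρ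
  irreducible :=
    UnitaryRep.isIrreducible_of_rep_eq_integrated (denseRange_leftConv μ) (ρ.rep_leftConv μ)

theorem isIntegratedForm_disintegrate (ρ : IrrRep (reducedCStar μ)) :
    IsIntegratedForm μ ρ (ρ.disintegrate μ) :=
  ⟨LinearIsometryEquiv.refl ℂ ρ.H, fun f ξ => DFunLike.congr_fun (ρ.rep_leftConv μ f).symm ξ⟩

end ReducedAlgebra

/-! ### Density of the continuous functions with compact support in `L²` -/

section ToL2

theorem norm_smul_sub_indicator_le {X E : Type*} [NormedAddCommGroup E] [NormedSpace ℝ E]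
    {s t V : Set X} {g : X → ℝ} (hs : Set.EqOn g 1 s) (hV : Set.EqOn g 0 Vᶜ)
    (hg : ∀ x, g x ∈ Set.Icc 0 1) (hst : s ⊆ t) (c : E) (x : X) :
    ‖g x • c - t.indicator (fun _ => c) x‖ ≤ ‖(V \ s ∪ t \ s).indicator (fun _ => c) x‖ := by
  by_cases hxs : x ∈ s
  · simp [hs hxs, hst hxs]
  by_cases hxt : x ∈ t
  · have hle : ‖g x - 1‖ ≤ 1 := Real.norm_eq_abs _ ▸
      abs_le.2 ⟨by linarith [(hg x).1], by linarith [(hg x).2]⟩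
    rw [Set.indicator_of_mem hxt, Set.indicator_of_mem (.inr ⟨hxt, hxs⟩)]
    calc ‖g x • c - c‖ = ‖g x - 1‖ * ‖c‖ := by rw [← norm_smul, sub_smul, one_smul]
      _ ≤ ‖c‖ := mul_le_of_le_one_left (norm_nonneg c) hle
  by_cases hxV : x ∈ V
  · rw [Set.indicator_of_notMem hxt, sub_zero, Set.indicator_of_mem (.inl ⟨hxV, hxs⟩), norm_smul,
      Real.norm_of_nonneg (hg x).1]
    exact mul_le_of_le_one_left (norm_nonneg c) (hg x).2
  · simp [hxt, hV hxV]

variable {X : Type*} [TopologicalSpace X] [MeasurableSpace X] [BorelSpace X] (μ : Measure X)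

/-- Mathlib's `MemLp.exists_hasCompactSupport_eLpNorm_sub_le` needs a normal space, which a locally
compact group is not known to be there. -/
theorem exists_hasCompactSupport_eLpNorm_sub_indicator_le [T2Space X] [LocallyCompactSpace X]
    [μ.Regular] {E : Type*} [NormedAddCommGroup E] [NormedSpace ℝ E] {p : ℝ≥0∞} (hp : p ≠ ∞) (c : E)
    {t : Set X} (ht : MeasurableSet t) (htμ : μ t < ∞) {ε : ℝ≥0∞} (hε : ε ≠ 0) :
    ∃ g : X → E, eLpNorm (g - t.indicator fun _ => c) p μ ≤ ε ∧ Continuous g ∧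
      HasCompactSupport g := by
  obtain ⟨η, hη_pos, hη⟩ := exists_eLpNorm_indicator_le (μ := μ) hp c hε
  have half_ne_zero : (η : ℝ≥0∞) / 2 ≠ 0 := by simpa using hη_pos.ne'
  obtain ⟨s, hst, hs, hts⟩ := ht.exists_isCompact_sdiff_lt htμ.ne half_ne_zero
  obtain ⟨V, hsV, hV, -, hVs⟩ := hs.measurableSet.exists_isOpen_sdiff_lt
    ((measure_mono hst).trans_lt htμ).ne half_ne_zero
  obtain ⟨g, hg_one, hg_zero, hg_supp, hg⟩ := exists_continuous_one_zero_of_isCompact hs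
    hV.isClosed_compl (Set.disjoint_compl_right_iff_subset.2 hsV)
  refine ⟨fun x => g x • c, ?_, g.continuous.smul continuous_const, hg_supp.smul_right⟩
  refine (eLpNorm_mono (norm_smul_sub_indicator_le hg_one hg_zero hg hst c)).trans (hη _ ?_)
  calc μ (V \ s ∪ t \ s) ≤ μ (V \ s) + μ (t \ s) := measure_union_le _ _
    _ ≤ η / 2 + η / 2 := add_le_add hVs.le hts.le
    _ = η := ENNReal.add_halves _

variable [IsFiniteMeasureOnCompacts μ]

/-- The class in `L²` of a continuous function with compact support. -/
def toL2 : C_c(X, ℂ) →ₗ[ℂ] Lp ℂ 2 μ where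
  toFun f := MemLp.toLp f (f.continuous.memLp_of_hasCompactSupport f.hasCompactSupport)
  map_add' _ _ := rfl
  map_smul' _ _ := rfl

theorem coeFn_toL2 (f : C_c(X, ℂ)) : toL2 μ f =ᵐ[μ] f :=
  MemLp.coeFn_toLp (f.continuous.memLp_of_hasCompactSupport f.hasCompactSupport)

theorem inner_toL2 (k h : C_c(X, ℂ)) :
    inner ℂ (toL2 μ k) (toL2 μ h) = ∫ x, inner ℂ (k x) (h x) ∂μ := by
  rw [L2.inner_def]
  refine integral_congr_ae ?_
  filter_upwards [coeFn_toL2 μ k, coeFn_toL2 μ h] with x hk hh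
  rw [hk, hh]

end ToL2

theorem denseRange_toL2 {X : Type*} [TopologicalSpace X] [T2Space X] [LocallyCompactSpace X]
    [MeasurableSpace X] [BorelSpace X] (μ : Measure X) [μ.Regular] : DenseRange (toL2 μ) := by
  refine fun ξ => EMetric.mem_closure_iff.2 fun ε hε => ?_
  obtain ⟨δ, hδ, hδε⟩ := exists_between hε
  obtain ⟨g, hgδ, hg, hg_supp⟩ := (Lp.memLp ξ).induction_dense (by simp)
    (fun g => Continuous g ∧ HasCompactSupport g)
    (fun c s hs hμs ε hε =>
      exists_hasCompactSupport_eLpNorm_sub_indicator_le (E := ℂ) (p := 2) μ (by simp) c hs hμs hε)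
    (fun f g hf hg => ⟨hf.1.add hg.1, hf.2.add hg.2⟩)
    (fun f hf => (hf.1.memLp_of_hasCompactSupport (p := 2) hf.2).aestronglyMeasurable) hδ.ne'
  refine ⟨_, ⟨⟨⟨g, hg⟩, hg_supp⟩, rfl⟩, lt_of_le_of_lt ?_ hδε⟩
  rw [Lp.edist_def]
  refine le_of_eq_of_le (eLpNorm_congr_ae ?_) hgδ
  filter_upwards [coeFn_toL2 μ ⟨⟨g, hg⟩, hg_supp⟩] with x hx
  simp only [Pi.sub_apply, hx]
  rfl

/-! ### The right regular representation -/

section RightRegular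

variable {G : Type u} [Group G] [TopologicalSpace G] [MeasurableSpace G] [BorelSpace G]
  (μ : Measure G)

theorem inner_integrated_toL2 [IsFiniteMeasureOnCompacts μ] {π : UnitaryRep G (Lp ℂ 2 μ)}
    {h : C_c(G, ℂ)} {t : G → C_c(G, ℂ)} (ht : ∀ g, π.toHom g (toL2 μ h) = toL2 μ (t g))
    (ht_cont : Continuous fun p : G × G => t p.1 p.2) (f k : C_c(G, ℂ)) :
    inner ℂ (toL2 μ k) (π.integrated μ f (toL2 μ h))
      = ∫ x, ∫ g, f g * inner ℂ (k x) (t g x) ∂μ ∂μ := by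
  have hsupp : HasCompactSupport (Function.uncurry fun g x => f g * inner ℂ (k x) (t g x)) := by
    refine HasCompactSupport.intro' (f.hasCompactSupport.isCompact.prod
      k.hasCompactSupport.isCompact) ((isClosed_tsupport f).prod (isClosed_tsupport k)) ?_
    rintro ⟨g, x⟩ hgx
    change f g * inner ℂ (k x) (t g x) = 0
    rcases not_and_or.1 hgx with hg | hx
    · rw [image_eq_zero_of_notMem_tsupport hg, zero_mul]
    · rw [image_eq_zero_of_notMem_tsupport hx, inner_zero_left, mul_zero]
  rw [← integral_integral_swap_of_hasCompactSupport (by unfold Function.uncurry; fun_prop) hsupp]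
  refine (integral_inner (π.integrable_smul μ f (toL2 μ h)) _).symm.trans ?_
  simp only [inner_smul_right, ht, inner_toL2, integral_const_mul]

variable [IsTopologicalGroup G]

theorem rightTranslation_one [μ.IsMulRightInvariant] (ξ : Lp ℂ 2 μ) :
    rightTranslation μ 1 ξ = ξ := by
  apply Lp.ext
  filter_upwards [Lp.coeFn_compMeasurePreserving ξ (measurePreserving_mul_right μ (1 : G))]
    with x hx
  exact hx.trans (by simp)

theorem rightTranslation_mul [μ.IsMulRightInvariant] (g h : G) (ξ : Lp ℂ 2 μ) :
    rightTranslation μ (g * h) ξ = rightTranslation μ g (rightTranslation μ h ξ) := by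
  apply Lp.ext
  filter_upwards [Lp.coeFn_compMeasurePreserving ξ (measurePreserving_mul_right μ (g * h)),
    Lp.coeFn_compMeasurePreserving (rightTranslation μ h ξ) (measurePreserving_mul_right μ g),
    (measurePreserving_mul_right μ g).quasiMeasurePreserving.ae_eq_comp
      (Lp.coeFn_compMeasurePreserving ξ (measurePreserving_mul_right μ h))] with x hgh hg hh
  exact hgh.trans (.trans (by simp [mul_assoc]) (hg.trans hh).symm)

theorem leftTranslation_toL2 [μ.IsMulLeftInvariant] [IsFiniteMeasureOnCompacts μ] (g : G)
    (f : C_c(G, ℂ)) : leftTranslation μ g (toL2 μ f) = toL2 μ (leftTranslate g f) := by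
  apply Lp.ext
  filter_upwards [Lp.coeFn_compMeasurePreserving (toL2 μ f) (measurePreserving_mul_left μ g⁻¹),
    (measurePreserving_mul_left μ g⁻¹).quasiMeasurePreserving.ae_eq_comp (coeFn_toL2 μ f),
    coeFn_toL2 μ (leftTranslate g f)] with x hcomp hf htranslate
  exact (hcomp.trans hf).trans htranslate.symm

theorem rightTranslation_toL2 [μ.IsMulRightInvariant] [IsFiniteMeasureOnCompacts μ] (g : G)
    (f : C_c(G, ℂ)) : rightTranslation μ g (toL2 μ f) = toL2 μ (rightTranslate g f) := by
  apply Lp.ext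
  filter_upwards [Lp.coeFn_compMeasurePreserving (toL2 μ f) (measurePreserving_mul_right μ g),
    (measurePreserving_mul_right μ g).quasiMeasurePreserving.ae_eq_comp (coeFn_toL2 μ f),
    coeFn_toL2 μ (rightTranslate g f)] with x hcomp hf htranslate
  exact (hcomp.trans hf).trans htranslate.symm

variable [LocallyCompactSpace G] [μ.IsHaarMeasure] [μ.Regular] [μ.IsMulRightInvariant]

/-- The right regular representation of `G` on `L²(G)`. -/
def rightRegular : UnitaryRep G (Lp ℂ 2 μ) where
  toHom :=
    { toFun := fun g =>
        { (rightTranslation μ g).toLinearMap with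
          invFun := rightTranslation μ g⁻¹
          left_inv := fun ξ => by
            change rightTranslation μ g⁻¹ (rightTranslation μ g ξ) = ξ
            rw [← rightTranslation_mul, inv_mul_cancel, rightTranslation_one]
          right_inv := rightTranslation_inv μ g
          norm_map' := (rightTranslation μ g).norm_map }
      map_one' := LinearIsometryEquiv.ext (rightTranslation_one μ)
      map_mul' := fun g h => LinearIsometryEquiv.ext (rightTranslation_mul μ g h) }
  strongly_continuous ξ := by
    have : Fact ((2 : ℝ≥0∞) ≠ ∞) := ⟨by simp⟩
    let c : C(G, C(G, G)) := (ContinuousMap.mk (fun p : G × G => p.2 * p.1) (by fun_prop)).curry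
    exact (continuous_const (y := ξ)).compMeasurePreservingLp (g := c) c.continuous
      (fun g => measurePreserving_mul_right μ g) Fact.out

variable [T2Space G]

/-- Both sides are the convolution `f * h`. -/
theorem leftRegular_integrated_toL2 (f h : C_c(G, ℂ)) :
    (leftRegular μ).integrated μ f (toL2 μ h)
      = (rightRegular μ).integrated μ (inversion h) (toL2 μ f) := by
  refine (denseRange_toL2 μ).eq_of_inner_right ℂ fun k => ?_
  rw [inner_integrated_toL2 μ (t := fun g => leftTranslate g h)
      (fun g => leftTranslation_toL2 μ g h) (by simp only [leftTranslate_apply]; fun_prop),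
    inner_integrated_toL2 μ (t := fun g => rightTranslate g f)
      (fun g => rightTranslation_toL2 μ g f) (by simp only [rightTranslate_apply]; fun_prop)]
  congr 1 with x
  rw [← integral_mul_left_eq_self (fun g => f g * inner ℂ (k x) (leftTranslate g h x)) x]
  congr 1 with g
  simp only [leftTranslate_apply, rightTranslate_apply, inversion_apply, mul_inv_rev,
    inv_mul_cancel_right, RCLike.inner_apply]
  ring

theorem leftRegular_integrated_translate_toL2 (f h : C_c(G, ℂ)) (g : G) :
    (leftRegular μ).integrated μ f ((leftRegular μ).toHom g (toL2 μ h))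
      = (rightRegular μ).integrated μ (inversion h) ((rightRegular μ).toHom g⁻¹ (toL2 μ f)) := by
  have htranslate := (leftRegular μ).integrated_rightTranslate μ g⁻¹ f (toL2 μ h)
  rw [inv_inv] at htranslate
  rw [← htranslate, leftRegular_integrated_toL2]
  exact congrArg _ (rightTranslation_toL2 μ g⁻¹ f).symm

end RightRegular

/-! ### Finite-dimensional corners and finite-rank operators -/

theorem finiteDimensional_range_iff_of_ker_eq {E F F' X X' : Type*} [AddCommGroup E] [Module ℂ E]
    [AddCommGroup X] [Module ℂ X] [TopologicalSpace X] [AddCommGroup F] [Module ℂ F]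
    [TopologicalSpace F] [IsTopologicalAddGroup F] [ContinuousSMul ℂ F] [T2Space F]
    [AddCommGroup X'] [Module ℂ X'] [TopologicalSpace X'] [AddCommGroup F'] [Module ℂ F']
    [TopologicalSpace F'] [IsTopologicalAddGroup F'] [ContinuousSMul ℂ F'] [T2Space F']
    {e : E →ₗ[ℂ] X} (he : DenseRange e) {T : X →L[ℂ] F}
    {e' : E →ₗ[ℂ] X'} (he' : DenseRange e') {T' : X' →L[ℂ] F'}
    (h : ∀ x, T (e x) = 0 ↔ T' (e' x) = 0) :
    FiniteDimensional ℂ (LinearMap.range T.toLinearMap) ↔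
      FiniteDimensional ℂ (LinearMap.range T'.toLinearMap) := by
  have hker : LinearMap.ker (T.toLinearMap ∘ₗ e) = LinearMap.ker (T'.toLinearMap ∘ₗ e') :=
    Submodule.ext h
  constructor
  · exact fun hT => finiteDimensional_range_of_denseRange he'
      (finiteDimensional_range_of_ker_le hker.le
        (Submodule.finiteDimensional_of_le (LinearMap.range_comp_le_range _ _)))
  · exact fun hT => finiteDimensional_range_of_denseRange he
      (finiteDimensional_range_of_ker_le hker.ge
        (Submodule.finiteDimensional_of_le (LinearMap.range_comp_le_range _ _)))

theorem UnitaryRep.exists_integrated_apply_ne_zero {G H : Type*} [Group G] [TopologicalSpace G]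
    [IsTopologicalGroup G] [LocallyCompactSpace G] [MeasurableSpace G] [BorelSpace G]
    [NormedAddCommGroup H] [InnerProductSpace ℂ H] [CompleteSpace H] (μ : Measure G)
    [IsFiniteMeasureOnCompacts μ] [μ.IsOpenPosMeasure] (π : UnitaryRep G H) {ξ : H} (hξ : ξ ≠ 0) :
    ∃ f : C_c(G, ℂ), π.integrated μ f ξ ≠ 0 := by
  obtain ⟨h, hone, -, hsupp, hh⟩ := exists_continuous_one_zero_of_isCompact
    (isCompact_singleton (x := (1 : G))) isClosed_empty (Set.disjoint_empty _)
  have hcont : Continuous fun g => (h g : ℂ) * inner ℂ (π.toHom g ξ) ξ :=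
    (Complex.continuous_ofReal.comp h.continuous).mul
      ((π.strongly_continuous ξ).inner continuous_const)
  exact ⟨⟨⟨_, hcont⟩, (hsupp.comp_left Complex.ofReal_zero).mul_right⟩,
    π.integrated_apply_ne_zero μ hξ h.continuous hsupp (fun g => (hh g).1)
      (by simp [hone rfl]) fun _ => rfl⟩

theorem UnitaryRep.apply_integrated {G H E : Type*} [Group G] [TopologicalSpace G]
    [MeasurableSpace G] [BorelSpace G] [NormedAddCommGroup H] [InnerProductSpace ℂ H]
    [CompleteSpace H] [NormedAddCommGroup E] [NormedSpace ℂ E] [CompleteSpace E] (μ : Measure G)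
    [IsFiniteMeasureOnCompacts μ] (π : UnitaryRep G H) (T : H →L[ℂ] E) (f : C_c(G, ℂ)) (ξ : H) :
    T (π.integrated μ f ξ) = ∫ g, f g • T (π.toHom g ξ) ∂μ := by
  rw [integrated_apply, ← T.integral_comp_comm (π.integrable_smul μ f ξ)]
  simp only [map_smul]

theorem continuous_idealizerMulRight {B : Type u} [NonUnitalCStarAlgebra B]
    {S : NonUnitalStarSubalgebra ℂ B} (T : idealizer S) : Continuous (idealizerMulRight T) :=
  continuous_induced_rng.2 (continuous_subtype_val.mul continuous_const)

section Corners

variable {G : Type u} [Group G] [TopologicalSpace G] [IsTopologicalGroup G] [LocallyCompactSpace G]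
  [MeasurableSpace G] [BorelSpace G] [T2Space G] (μ : Measure G) [μ.IsHaarMeasure] [μ.Regular]
  [μ.IsMulRightInvariant] {K : Subgroup G} (ν : Measure K) [IsFiniteMeasureOnCompacts ν]

/-- Right convolution by `φ` on `L²(G)`, the operator `∫ φ(k) r(k⁻¹) dk`. -/
def rightConv (φ : C_c(K, ℂ)) : Lp ℂ 2 μ →L[ℂ] Lp ℂ 2 μ :=
  ((rightRegular μ).restrict K).integrated ν (inversion φ)

/-- The operators `λ(f)`, as a linear map on `C_c(G)`. -/
def leftConvₗ : C_c(G, ℂ) →ₗ[ℂ] reducedCStar μ where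
  toFun := leftConv μ
  map_add' f g := Subtype.ext (map_add ((leftRegular μ).integratedₗ μ) f g)
  map_smul' c f := Subtype.ext (map_smul ((leftRegular μ).integratedₗ μ) c f)

variable [ν.IsInvInvariant]

theorem leftRegular_integrated_restrict_toL2 (f h : C_c(G, ℂ)) (φ : C_c(K, ℂ)) :
    (leftRegular μ).integrated μ f (((leftRegular μ).restrict K).integrated ν φ (toL2 μ h))
      = (rightRegular μ).integrated μ (inversion h) (rightConv μ ν φ (toL2 μ f)) := by
  rw [rightConv, UnitaryRep.apply_integrated ν, UnitaryRep.apply_integrated ν,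
    ← integral_inv_eq_self _ ν]
  refine integral_congr_ae (.of_forall fun k => congrArg (φ k⁻¹ • ·) ?_)
  have htranslate := leftRegular_integrated_translate_toL2 μ f h (k : G)⁻¹
  rwa [inv_inv] at htranslate

variable {c : reducedCStar μ} {φ : C_c(K, ℂ)}
  {T : idealizer (reducedCStar μ)}

theorem coe_idealizerMulRight_leftConv_toL2
    (hT : (T : Lp ℂ 2 μ →L[ℂ] Lp ℂ 2 μ) = ((leftRegular μ).restrict K).integrated ν φ)
    (f h : C_c(G, ℂ)) :
    (idealizerMulRight T (c * leftConvₗ μ f) : Lp ℂ 2 μ →L[ℂ] Lp ℂ 2 μ) (toL2 μ h)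
      = (rightRegular μ).integrated μ (inversion h)
        ((c : Lp ℂ 2 μ →L[ℂ] Lp ℂ 2 μ) (rightConv μ ν φ (toL2 μ f))) := by
  rw [← UnitaryRep.map_integrated μ (π := rightRegular μ) (reducedCStar_commute μ c),
    ← leftRegular_integrated_restrict_toL2, ← hT]
  rfl

theorem idealizerMulRight_leftConv_eq_zero_iff
    (hT : (T : Lp ℂ 2 μ →L[ℂ] Lp ℂ 2 μ) = ((leftRegular μ).restrict K).integrated ν φ)
    (f : C_c(G, ℂ)) :
    idealizerMulRight T (c * leftConvₗ μ f) = 0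
      ↔ (c : Lp ℂ 2 μ →L[ℂ] Lp ℂ 2 μ) (rightConv μ ν φ (toL2 μ f)) = 0 := by
  have hconv := coe_idealizerMulRight_leftConv_toL2 μ ν (c := c) hT f
  generalize idealizerMulRight T (c * leftConvₗ μ f) = b at hconv ⊢
  constructor
  · rintro rfl
    by_contra hne
    obtain ⟨k, hk⟩ := (rightRegular μ).exists_integrated_apply_ne_zero μ hne
    have hzero := hconv (inversion k)
    rw [inversion_inversion] at hzero
    exact hk hzero.symm
  · intro hzero
    refine Subtype.ext (DFunLike.coe_injective ((denseRange_toL2 μ).equalizer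
      (ContinuousLinearMap.continuous _) (ContinuousLinearMap.continuous _) (funext fun h => ?_)))
    exact (hconv h).trans (by rw [hzero, map_zero]; rfl)

theorem finiteDimensional_corner_iff_rightConv
    (hT : (T : Lp ℂ 2 μ →L[ℂ] Lp ℂ 2 μ) = ((leftRegular μ).restrict K).integrated ν φ) :
    FiniteDimensional ℂ (LinearMap.range (idealizerMulRight T ∘ₗ LinearMap.mulLeft ℂ c)) ↔
      FiniteDimensional ℂ
        (LinearMap.range ((c : Lp ℂ 2 μ →L[ℂ] Lp ℂ 2 μ) * rightConv μ ν φ).toLinearMap) :=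
  finiteDimensional_range_iff_of_ker_eq (e := leftConvₗ μ) (denseRange_leftConv μ)
    (T := ⟨idealizerMulRight T ∘ₗ LinearMap.mulLeft ℂ c,
      (continuous_idealizerMulRight T).comp (continuous_const_mul c)⟩)
    (denseRange_toL2 μ) (idealizerMulRight_leftConv_eq_zero_iff μ ν hT)

end Corners

/-! ### Slices of tensor products and invariant vectors -/

section Slice

variable {E V : Type*} [NormedAddCommGroup E] [InnerProductSpace ℂ E]
  [NormedAddCommGroup V] [InnerProductSpace ℂ V]

variable (E) in
/-- The slice `ξ ⊗ v ↦ ⟨w, v⟩ ξ`, a bounded operator depending antilinearly on `w`. -/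
def slice : V →L⋆[ℂ] E ⊗[ℂ] V →L[ℂ] E :=
  LinearMap.mkContinuous
    { toFun w := (TensorProduct.ridIsometry ℂ E).toContinuousLinearEquiv.toContinuousLinearMap.comp
        ((innerSL ℂ w).lTensor E)
      map_add' w w' := by
        rw [map_add, ContinuousLinearMap.lTensor_add, ContinuousLinearMap.comp_add]
      map_smul' a w := by
        rw [map_smulₛₗ, ContinuousLinearMap.lTensor_smul, ContinuousLinearMap.comp_smul] }
    1 fun w => ContinuousLinearMap.opNorm_le_bound _ (by positivity) fun x => by
      rw [one_mul, ← innerSL_apply_norm ℂ w]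
      refine (LinearIsometryEquiv.norm_map (TensorProduct.ridIsometry ℂ E) _).trans_le ?_
      exact (ContinuousLinearMap.le_opNorm _ x).trans (mul_le_mul_of_nonneg_right
        (ContinuousLinearMap.norm_lTensor_le E _) (norm_nonneg x))

theorem slice_tmul (w v : V) (ξ : E) : slice E w (ξ ⊗ₜ[ℂ] v) = inner ℂ w v • ξ := by
  simp [slice]

theorem slice_rTensor (T : E →L[ℂ] E) (w : V) (x : E ⊗[ℂ] V) :
    slice E w (T.rTensor V x) = T (slice E w x) := by
  induction x using TensorProduct.induction_on with
  | zero => simp only [map_zero]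
  | add x y hx hy => simp only [map_add, hx, hy]
  | tmul ξ v => rw [ContinuousLinearMap.rTensor_tmul, slice_tmul, slice_tmul, map_smul]

theorem sum_slice_tmul {ι : Type*} [Fintype ι] (b : OrthonormalBasis ι ℂ V) (x : E ⊗[ℂ] V) :
    ∑ i, slice E (b i) x ⊗ₜ[ℂ] b i = x := by
  induction x using TensorProduct.induction_on with
  | zero => simp only [map_zero, TensorProduct.zero_tmul, Finset.sum_const_zero]
  | add x y hx hy => simp only [map_add, TensorProduct.add_tmul, Finset.sum_add_distrib, hx, hy]
  | tmul ξ v =>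
    conv_rhs => rw [← b.sum_repr v]
    simp only [slice_tmul, TensorProduct.smul_tmul, TensorProduct.tmul_sum, b.repr_apply_apply]

variable [FiniteDimensional ℂ V]

theorem ext_slice {x y : E ⊗[ℂ] V} (h : ∀ w, slice E w x = slice E w y) : x = y := by
  rw [← sum_slice_tmul (stdOrthonormalBasis ℂ V) x, ← sum_slice_tmul (stdOrthonormalBasis ℂ V) y]
  simp only [h]

theorem finiteDimensional_of_forall_map_slice {M : Submodule ℂ (E ⊗[ℂ] V)}
    (h : ∀ w, FiniteDimensional ℂ (M.map (slice E w).toLinearMap)) : FiniteDimensional ℂ M := by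
  let b := stdOrthonormalBasis ℂ V
  let e : M →ₗ[ℂ] ∀ i, M.map (slice E (b i)).toLinearMap :=
    LinearMap.pi fun i => (slice E (b i)).toLinearMap.submoduleMap M
  refine FiniteDimensional.of_injective e fun y y' hyy => Subtype.ext ?_
  have hslice (i) : slice E (b i) (y : E ⊗[ℂ] V) = slice E (b i) (y' : E ⊗[ℂ] V) :=
    congrArg Subtype.val (congrFun hyy i)
  rw [← sum_slice_tmul b (y : E ⊗[ℂ] V), ← sum_slice_tmul b (y' : E ⊗[ℂ] V)]
  simp only [hslice]

end Slice

section Invariants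

variable {K : Type u} [Group K] [TopologicalSpace K]
variable {E : Type*} [NormedAddCommGroup E] [InnerProductSpace ℂ E] {V : Type u}
  [NormedAddCommGroup V] [InnerProductSpace ℂ V]
variable (r : UnitaryRep K E) (τ : UnitaryRep K V)

/-- The space `[E ⊗ V]^K` of invariant vectors in a tensor product of representations; for the
right regular representation on `E = L²(G)` it is `L²(G/K; V)`. -/
def tensorInvariants : Submodule ℂ (E ⊗[ℂ] V) where
  carrier := {x | ∀ k, TensorProduct.map (r.toHom k).toLinearEquiv.toLinearMap
    (τ.toHom k).toLinearEquiv.toLinearMap x = x}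
  add_mem' {x y} hx hy k := by rw [map_add, hx k, hy k]
  zero_mem' k := map_zero _
  smul_mem' c x hx k := by rw [map_smul, hx k]

theorem slice_map (k : K) (w : V) (x : E ⊗[ℂ] V) :
    slice E w (TensorProduct.map (r.toHom k).toLinearEquiv.toLinearMap
      (τ.toHom k).toLinearEquiv.toLinearMap x) = r.toHom k (slice E (τ.toHom k⁻¹ w) x) := by
  induction x using TensorProduct.induction_on with
  | zero => simp only [map_zero]
  | add x y hx hy => simp only [map_add, hx, hy]
  | tmul ξ v =>
    rw [TensorProduct.map_tmul, slice_tmul, slice_tmul, map_smul, τ.inner_map_left, inv_inv]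
    rfl

variable {r τ} in
theorem map_slice_of_mem {x : E ⊗[ℂ] V} (hx : x ∈ tensorInvariants r τ) (k : K) (w : V) :
    r.toHom k (slice E w x) = slice E (τ.toHom k w) x := by
  have h := slice_map r τ k (τ.toHom k w) x
  rwa [hx k, τ.map_inv_map, eq_comm] at h

variable [MeasurableSpace K] [BorelSpace K] (ν : Measure K) [ν.IsHaarMeasure] [CompleteSpace E]

variable {r τ} in
theorem slice_integrated_of_mem [CompleteSpace V] {x : E ⊗[ℂ] V} (hx : x ∈ tensorInvariants r τ)
    (φ : C_c(K, ℂ)) (w : V) :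
    slice E (τ.integrated ν φ w) x = r.integrated ν (star φ) (slice E w x) := by
  refine (ContinuousLinearMap.integral_comp_commSL (by simp) ((slice E).flip x)
    (τ.integrable_smul ν φ w)).symm.trans (integral_congr_ae (.of_forall fun k => ?_))
  change slice E (φ k • τ.toHom k w) x = star (φ k) • r.toHom k (slice E w x)
  rw [map_slice_of_mem hx, map_smulₛₗ]
  rfl

variable [IsTopologicalGroup K]

theorem eq_top_of_integrated_mem [CompactSpace K] [FiniteDimensional ℂ V] [CompleteSpace V]
    [ν.IsInvInvariant] {N : Submodule ℂ V}
    (hN : ∀ φ, IsRepresentative φ → ∀ w, τ.integrated ν φ w ∈ N) : N = ⊤ := by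
  refine Submodule.orthogonal_eq_bot_iff.1 ((Submodule.eq_bot_iff _).2 fun w hw => ?_)
  by_contra! hw0
  obtain ⟨φ, hφ, hφw⟩ := exists_isRepresentative_apply_ne_zero ν τ hw0
  refine hφw (inner_self_eq_zero (𝕜 := ℂ).1 ?_)
  rw [τ.inner_integrated_left ν (f' := star (inversion φ)) fun _ => rfl]
  exact Submodule.inner_left_of_mem_orthogonal (hN _ hφ.star_inversion _) hw

/-- The average `∫ r(k) ξ ⊗ τ(k) v dk`, an invariant vector of `E ⊗ V`. -/
def averageTensor (v : V) (ξ : E) : E ⊗[ℂ] V :=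
  ∫ k, r.toHom k ξ ⊗ₜ[ℂ] τ.toHom k v ∂ν

variable [CompactSpace K] [FiniteDimensional ℂ V]

theorem slice_averageTensor (v w : V) (ξ : E) :
    slice E w (averageTensor r τ ν v ξ) = r.integrated ν (inversion (matrixCoeff τ w v)) ξ := by
  have := tensor_complete (E := E) (V := V)
  have hr := r.strongly_continuous ξ
  have hτ := τ.strongly_continuous v
  have hcont : Continuous fun k => r.toHom k ξ ⊗ₜ[ℂ] τ.toHom k v := by fun_prop
  refine ((slice E w).integral_comp_comm (hcont.integrable_of_hasCompactSupport
    (.of_compactSpace _))).symm.trans (integral_congr_ae (.of_forall fun k => ?_))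
  change slice E w (r.toHom k ξ ⊗ₜ[ℂ] τ.toHom k v)
    = inner ℂ (τ.toHom k⁻¹ w) v • r.toHom k ξ
  rw [slice_tmul, τ.inner_map_left, inv_inv]

theorem averageTensor_mem (v : V) (ξ : E) : averageTensor r τ ν v ξ ∈ tensorInvariants r τ := by
  refine fun k => ext_slice fun w => ?_
  rw [slice_map, slice_averageTensor, slice_averageTensor, ← r.integrated_leftTranslate ν]
  congr 2
  ext h
  simp only [leftTranslate_apply, inversion_apply, matrixCoeff_apply, ← τ.map_mul_apply,
    mul_inv_rev, inv_inv, mul_inv_cancel_right]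

variable {r τ} in
theorem finiteDimensional_range_of_invariants {c : E →L[ℂ] E}
    (h : FiniteDimensional ℂ ((tensorInvariants r τ).map (c.rTensor V).toLinearMap)) (w v : V) :
    FiniteDimensional ℂ
      (LinearMap.range (c * r.integrated ν (inversion (matrixCoeff τ w v))).toLinearMap) := by
  refine Submodule.finiteDimensional_of_le (S₂ :=
    ((tensorInvariants r τ).map (c.rTensor V).toLinearMap).map (slice E w).toLinearMap) ?_
  rintro _ ⟨ξ, rfl⟩
  refine ⟨_, ⟨averageTensor r τ ν v ξ, averageTensor_mem r τ ν v ξ, rfl⟩, ?_⟩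
  exact (slice_rTensor c w _).trans (congrArg c (slice_averageTensor r τ ν v w ξ))

variable {r} in
/-- On invariant vectors, slicing by `τ(φ) w` amounts to applying `r(star φ)` to the slice by `w`,
and the vectors `τ(φ) w` span `V`. -/
theorem finiteDimensional_map_rTensor_tensorInvariants [CompleteSpace V] [ν.IsInvInvariant]
    {c : E →L[ℂ] E} (h : ∀ φ, IsRepresentative φ →
      FiniteDimensional ℂ (LinearMap.range (c * r.integrated ν (inversion φ)).toLinearMap)) :
    FiniteDimensional ℂ ((tensorInvariants r τ).map (c.rTensor V).toLinearMap) := by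
  let sliceImage : V →ₛₗ[starRingEnd ℂ] tensorInvariants r τ →ₗ[ℂ] E :=
    { toFun w := (c ∘L slice E w).toLinearMap.domRestrict _
      map_add' w w' := by ext x; simp
      map_smul' a w := by ext x; simp }
  have htop : (LinearMap.finiteRange ℂ (tensorInvariants r τ) E).comap sliceImage = ⊤ := by
    refine eq_top_of_integrated_mem τ ν fun φ hφ w => ?_
    have hfin := h _ hφ.star_inversion
    rw [show inversion (star (inversion φ)) = star φ by ext k; simp [inversion_apply]] at hfin
    refine LinearMap.mem_finiteRange_iff_hasFiniteRange.2 ((Submodule.fg_iff_finiteDimensional _).2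
      (Submodule.finiteDimensional_of_le ?_ (S₂ := (c * r.integrated ν (star φ)).range)))
    rintro _ ⟨x, rfl⟩
    exact ⟨slice E w x, congrArg c (slice_integrated_of_mem ν x.2 φ w).symm⟩
  refine finiteDimensional_of_forall_map_slice fun w => ?_
  have hw : w ∈ (LinearMap.finiteRange ℂ (tensorInvariants r τ) E).comap sliceImage :=
    htop ▸ Submodule.mem_top
  have : FiniteDimensional ℂ (sliceImage w).range :=
    (Submodule.fg_iff_finiteDimensional _).1 (LinearMap.mem_finiteRange_iff_hasFiniteRange.1 hw)
  refine Submodule.finiteDimensional_of_le (S₂ := (sliceImage w).range) ?_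
  rintro _ ⟨_, ⟨x, hx, rfl⟩, rfl⟩
  exact ⟨⟨x, hx⟩, (slice_rTensor c w x).symm⟩

end Invariants

/-! ### The compact ideal -/

theorem isCompactOperator_of_finiteDimensional_range {E F : Type*} [NormedAddCommGroup E]
    [NormedSpace ℂ E] [NormedAddCommGroup F] [NormedSpace ℂ F] (T : E →L[ℂ] F)
    (hT : FiniteDimensional ℂ (LinearMap.range T.toLinearMap)) : IsCompactOperator T := by
  have : ProperSpace (LinearMap.range T.toLinearMap) := FiniteDimensional.proper ℂ _
  have hrange : IsCompactOperator (T.codRestrict T.range fun x => ⟨x, rfl⟩) :=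
    isCompactOperator_of_locallyCompactSpace_dom _
  exact hrange.clm_comp (Submodule.subtypeL _)

theorem isClosed_setOf_isCompactOperator_of_norm_apply_le {A F : Type*} [SeminormedAddCommGroup A]
    [NormedAddCommGroup F] [NormedSpace ℂ F] [CompleteSpace F] {f : A → F →L[ℂ] F}
    (hadd : ∀ a b, f (a + b) = f a + f b) (hf : ∀ a x, ‖f a x‖ ≤ ‖a‖ * ‖x‖) :
    IsClosed {a | IsCompactOperator (f a)} := by
  refine isClosed_setOfPred_isCompactOperator.preimage
    (AddMonoidHomClass.continuous_of_bound (AddMonoidHom.mk' f hadd) 1 fun a => ?_)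
  rw [one_mul]
  exact ContinuousLinearMap.opNorm_le_bound _ (norm_nonneg a) (hf a)

theorem IrrRep.exists_mem_ideal_apply_ne_zero_iff {A : Type u} [NonUnitalCStarAlgebra A]
    {ρ : IrrRep A} {J : NonUnitalStarSubalgebra ℂ A} (hJ : IsStarIdeal J) {p : A → Prop}
    (hp : ∀ c, p c → c ∈ J) (hfix : ∀ b c, b ∈ J → b * c = c → p c) :
    (∃ j ∈ J, ρ.rep j ≠ 0) ↔ ∃ c, ρ.rep c ≠ 0 ∧ p c := by
  constructor
  · intro h
    obtain ⟨c, hc, b, hb, hbc⟩ := exists_fixed_of_ideal hJ h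
    exact ⟨c, hc, hfix b c hb hbc⟩
  · rintro ⟨c, hc, hpc⟩
    exact ⟨c, hp c hpc, hc⟩

section CompactIdealCorners

variable {G : Type u} [Group G] [TopologicalSpace G] [IsTopologicalGroup G]
  [LocallyCompactSpace G] [MeasurableSpace G] [BorelSpace G]
variable (μ : Measure G) [μ.IsHaarMeasure] [μ.Regular] [μ.IsMulRightInvariant]
variable {K : Subgroup G}

section BundleAction

variable {V : Type u} [NormedAddCommGroup V] [InnerProductSpace ℂ V] (τ : UnitaryRep K V)

theorem finiteDimensional_range_bundleAction_iff (c : reducedCStar μ) :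
    FiniteDimensional ℂ (LinearMap.range (bundleAction μ τ c).toLinearMap) ↔
      FiniteDimensional ℂ ((tensorInvariants ((rightRegular μ).restrict K) τ).map
        ((c : Lp ℂ 2 μ →L[ℂ] Lp ℂ 2 μ).rTensor V).toLinearMap) := by
  have hmap : (LinearMap.range (bundleAction μ τ c).toLinearMap).map (bundleL2 μ τ).subtype
      = (tensorInvariants ((rightRegular μ).restrict K) τ).map
        ((c : Lp ℂ 2 μ →L[ℂ] Lp ℂ 2 μ).rTensor V).toLinearMap := by
    rw [← LinearMap.range_comp]
    ext y
    exact ⟨fun ⟨x, hx⟩ => ⟨x, x.2, hx⟩, fun ⟨x, hx, hxy⟩ => ⟨⟨x, hx⟩, hxy⟩⟩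
  rw [← hmap, ← Submodule.fg_iff_finiteDimensional, ← Submodule.fg_iff_finiteDimensional,
    Submodule.fg_map_iff _ (bundleL2 μ τ).injective_subtype]

end BundleAction

instance isClosed_compactIdeal : IsClosed (compactIdeal μ K : Set (reducedCStar μ)) := by
  refine isClosed_of_closure_subset fun a ha V _ _ _ τ => ?_
  have := bundleL2_complete μ τ
  have hclosed : IsClosed {b : reducedCStar μ | IsCompactOperator (bundleAction μ τ b)} :=
    isClosed_setOf_isCompactOperator_of_norm_apply_le (F := bundleL2 μ τ)
      (bundleAction_add μ τ) fun b x => (ContinuousLinearMap.le_opNorm _ _).trans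
        (mul_le_mul_of_nonneg_right (ContinuousLinearMap.norm_rTensor_le V _) (norm_nonneg x))
  exact closure_minimal (fun b (hb : b ∈ compactIdeal μ K) => hb V τ) hclosed ha

theorem isStarIdeal_compactIdeal : IsStarIdeal (compactIdeal μ K) := fun a b hb V _ _ _ τ => by
  rw [bundleAction_mul]
  exact (hb V τ).clm_comp (bundleAction μ τ a)

variable [T2Space G] [CompactSpace K] (ν : Measure K) [ν.IsHaarMeasure]

theorem hasFiniteCorners_iff_rightConv {c : reducedCStar μ} :
    HasFiniteCorners (representativeMultipliers ν ((leftRegular μ).restrict K) (reducedCStar μ)) c ↔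
      ∀ φ : C_c(K, ℂ), IsRepresentative φ → FiniteDimensional ℂ
        (LinearMap.range ((c : Lp ℂ 2 μ →L[ℂ] Lp ℂ 2 μ) * rightConv μ ν φ).toLinearMap) := by
  have := isInvInvariant_of_compactSpace ν
  constructor
  · intro hc φ hφ
    let T : idealizer (reducedCStar μ) := ⟨((leftRegular μ).restrict K).integrated ν φ,
      ((leftRegular μ).restrict K).integrated_mem_idealizer ν φ
        ((isMultiplier_leftRegular μ).restrict K)⟩
    exact (finiteDimensional_corner_iff_rightConv μ ν (T := T) rfl).1 (hc T ⟨φ, hφ, rfl⟩)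
  · rintro hc T ⟨φ, hφ, hT⟩
    exact (finiteDimensional_corner_iff_rightConv μ ν hT).2 (hc φ hφ)

theorem hasFiniteCorners_iff_bundleAction {c : reducedCStar μ} :
    HasFiniteCorners (representativeMultipliers ν ((leftRegular μ).restrict K) (reducedCStar μ)) c ↔
      ∀ (V : Type u) [NormedAddCommGroup V] [InnerProductSpace ℂ V] [FiniteDimensional ℂ V]
        (τ : UnitaryRep K V),
        FiniteDimensional ℂ (LinearMap.range (bundleAction μ τ c).toLinearMap) := by
  have := isInvInvariant_of_compactSpace ν
  rw [hasFiniteCorners_iff_rightConv]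
  constructor
  · intro hc V _ _ _ τ
    have : CompleteSpace V := FiniteDimensional.complete ℂ V
    exact (finiteDimensional_range_bundleAction_iff μ τ c).2
      (finiteDimensional_map_rTensor_tensorInvariants τ ν hc)
  · rintro hc _ ⟨V, _, _, _, τ, w, v, rfl⟩
    exact finiteDimensional_range_of_invariants ν
      ((finiteDimensional_range_bundleAction_iff μ τ c).1 (hc V τ)) w v

theorem mem_compactIdeal_of_hasFiniteCorners {c : reducedCStar μ} (hc : HasFiniteCorners
      (representativeMultipliers ν ((leftRegular μ).restrict K) (reducedCStar μ)) c) :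
    c ∈ compactIdeal μ K := by
  intro V _ _ _ τ
  have hcompact := isCompactOperator_of_finiteDimensional_range (E := bundleL2 μ τ)
    (F := bundleL2 μ τ) (bundleAction μ τ c)
  exact hcompact ((hasFiniteCorners_iff_bundleAction μ ν).1 hc V τ)

/-- A compact operator fixing the range of another operator forces it to have finite rank. -/
theorem hasFiniteCorners_of_mem_compactIdeal_of_mul_eq {b c : reducedCStar μ}
    (hb : b ∈ compactIdeal μ K) (hbc : b * c = c) : HasFiniteCorners
      (representativeMultipliers ν ((leftRegular μ).restrict K) (reducedCStar μ)) c := by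
  refine (hasFiniteCorners_iff_bundleAction μ ν).2 fun V _ _ _ τ => ?_
  have hfix (x) : bundleAction μ τ b (bundleAction μ τ c x) = bundleAction μ τ c x := by
    have hmul := DFunLike.congr_fun (bundleAction_mul μ τ b c) x
    rwa [hbc, eq_comm] at hmul
  exact finiteDimensional_range_of_compact_fixing (H := bundleL2 μ τ) (T := bundleAction μ τ b)
    (hb V τ) (S := (bundleAction μ τ c).toLinearMap) hfix

theorem exists_mem_compactIdeal_apply_ne_zero_iff (ρ : IrrRep (reducedCStar μ)) :
    (∃ j ∈ compactIdeal μ K, ρ.rep j ≠ 0) ↔ ∃ c, ρ.rep c ≠ 0 ∧ HasFiniteCorners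
      (representativeMultipliers ν ((leftRegular μ).restrict K) (reducedCStar μ)) c :=
  IrrRep.exists_mem_ideal_apply_ne_zero_iff (isStarIdeal_compactIdeal μ)
    (fun _ => mem_compactIdeal_of_hasFiniteCorners μ ν)
    fun _ _ => hasFiniteCorners_of_mem_compactIdeal_of_mul_eq μ ν

end CompactIdealCorners

/-! ### The correspondence for an ideal -/

section Correspondence

variable {G : Type u} [Group G] [TopologicalSpace G] [IsTopologicalGroup G] [MeasurableSpace G]
  [BorelSpace G] {μ : Measure G} [IsFiniteMeasureOnCompacts μ] [μ.IsMulLeftInvariant]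
variable {A : Type u} [NonUnitalCStarAlgebra A] {conv : C_c(G, ℂ) → A}
  {J : NonUnitalStarSubalgebra ℂ A}

theorem equiv_iff_of_isExtension_of_integratesTo (hconv : DenseRange conv) (hJ : IsStarIdeal J)
    {ρ ρ' : IrrRep A} {σ σ' : IrrRep J} {π π' : IrrUnitaryRep G} (hσ : IsExtension J ρ σ)
    (hπ : IntegratesTo μ conv ρ π) (hσ' : IsExtension J ρ' σ') (hπ' : IntegratesTo μ conv ρ' π') :
    σ ≈ σ' ↔ π ≈ π' :=
  ⟨fun h => hπ.equiv_right hconv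
      (hπ'.congr_left (IsExtension.equiv_left hJ hσ' (hσ.congr_right h))),
    fun h => hσ.equiv_right
      (hσ'.congr_left (hπ'.equiv_left hconv (hπ.congr_right (Setoid.symm h))))⟩

theorem exists_injective_correspondence [IsClosed (J : Set A)] (hconv : DenseRange conv)
    (hdis : ∀ ρ : IrrRep A, ∃ π : IrrUnitaryRep G, IntegratesTo μ conv ρ π) (hJ : IsStarIdeal J) :
    ∃ Φ : CStarDual J → UnitaryDual G,
      (∀ (σ : IrrRep J) (π : IrrUnitaryRep G),
        Φ σ.toDual = ⟦π⟧ ↔ ∃ ρ, IsExtension J ρ σ ∧ IntegratesTo μ conv ρ π) ∧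
      Function.Injective Φ ∧
      Set.range Φ = {c | ∃ π : IrrUnitaryRep G, ⟦π⟧ = c ∧
        ∃ ρ, IntegratesTo μ conv ρ π ∧ ∃ j ∈ J, ρ.rep j ≠ 0} := by
  choose extension hext using fun σ : IrrRep J => σ.exists_isExtension hJ
  choose disintegration hdisint using hdis
  let Ψ (σ : IrrRep J) : IrrUnitaryRep G := disintegration (extension σ)
  have hΨ (σ σ' : IrrRep J) : σ ≈ σ' ↔ Ψ σ ≈ Ψ σ' :=
    equiv_iff_of_isExtension_of_integratesTo hconv hJ (hext σ) (hdisint _) (hext σ') (hdisint _)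
  have hcorr (σ : IrrRep J) (π : IrrUnitaryRep G) :
      (⟦Ψ σ⟧ : UnitaryDual G) = ⟦π⟧ ↔ ∃ ρ, IsExtension J ρ σ ∧ IntegratesTo μ conv ρ π := by
    refine Quotient.eq.trans ⟨fun h => ⟨_, hext σ, (hdisint _).congr_right (Setoid.symm h)⟩, ?_⟩
    rintro ⟨ρ, hρ, hπ⟩
    exact (equiv_iff_of_isExtension_of_integratesTo hconv hJ (hext σ) (hdisint _) hρ hπ).1
      (Setoid.refl σ)
  refine ⟨Quotient.lift (fun σ => ⟦Ψ σ⟧) fun σ σ' h => Quotient.sound ((hΨ σ σ').1 h),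
    hcorr, ?_, ?_⟩
  · rintro ⟨σ⟩ ⟨σ'⟩ h
    exact Quotient.sound ((hΨ σ σ').2 (Quotient.exact h))
  · ext c
    constructor
    · rintro ⟨⟨σ⟩, rfl⟩
      exact ⟨Ψ σ, rfl, _, hdisint _, (hext σ).exists_apply_ne_zero⟩
    · rintro ⟨π, rfl, ρ, hρ, hne⟩
      exact ⟨(ρ.restrictIdeal hJ hne).toDual,
        (hcorr _ π).2 ⟨ρ, ρ.isExtension_restrictIdeal hJ hne, hρ⟩⟩

end Correspondence

/-! ### Admissible discrete series -/

theorem UnitaryRep.IsAdmissible.congr {G H H' : Type u} [Group G] [TopologicalSpace G]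
    [NormedAddCommGroup H] [InnerProductSpace ℂ H] [NormedAddCommGroup H']
    [InnerProductSpace ℂ H'] {K : Subgroup G} {π : UnitaryRep G H} {π' : UnitaryRep G H'}
    (h : π.IsAdmissible K) (U : H ≃ₗᵢ[ℂ] H') (hU : ∀ g ξ, U (π.toHom g ξ) = π'.toHom g (U ξ)) :
    π'.IsAdmissible K := by
  intro V _ _ _ τ hτ
  have := h V τ hτ
  have hUsymm (g : G) (ζ : H') : U.symm (π'.toHom g ζ) = π.toHom g (U.symm ζ) := by
    rw [LinearIsometryEquiv.symm_apply_eq, hU, LinearIsometryEquiv.apply_symm_apply]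
  let e : τ.intertwiners (π'.restrict K) →ₗ[ℂ] τ.intertwiners (π.restrict K) :=
    { toFun T := ⟨(U.symm : H' →L[ℂ] H) ∘L T, fun k ξ =>
        (congrArg U.symm (T.2 k ξ)).trans (hUsymm k _)⟩
      map_add' S T := Subtype.ext (ContinuousLinearMap.comp_add _ _ _)
      map_smul' c T := Subtype.ext (ContinuousLinearMap.comp_smul _ _ _) }
  refine FiniteDimensional.of_injective e ((injective_iff_map_eq_zero e).2 fun T hT => ?_)
  ext ξ
  have hTξ : U.symm ((T : V →L[ℂ] H') ξ) = 0 :=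
    congrArg (fun S : τ.intertwiners (π.restrict K) => (S : V →L[ℂ] H) ξ) hT
  exact (map_eq_zero_iff _ U.symm.injective).1 hTξ

theorem isAdmissible_iff_of_equiv {G : Type u} [Group G] [TopologicalSpace G] {K : Subgroup G}
    {π π' : IrrUnitaryRep G} (h : π ≈ π') : π.rep.IsAdmissible K ↔ π'.rep.IsAdmissible K := by
  have hcongr {π π' : IrrUnitaryRep G} (h : π ≈ π') (hπ : π.rep.IsAdmissible K) :
      π'.rep.IsAdmissible K := by
    obtain ⟨U, hU⟩ := h
    exact hπ.congr U hU
  exact ⟨hcongr h, hcongr (Setoid.symm h)⟩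

theorem exists_hasFiniteCorners_representativeMultipliers_iff {K E : Type u} [Group K]
    [TopologicalSpace K] [IsTopologicalGroup K] [CompactSpace K] [MeasurableSpace K]
    [BorelSpace K] (ν : Measure K) [ν.IsHaarMeasure] [NormedAddCommGroup E]
    [InnerProductSpace ℂ E] [CompleteSpace E] {κ : UnitaryRep K E}
    {S : NonUnitalStarSubalgebra ℂ (E →L[ℂ] E)} [IsClosed (S : Set (E →L[ℂ] E))]
    (h : IsMultiplier κ.unitaryHom S) (σ : IrrRep S) :
    (∃ c, σ.rep c ≠ 0 ∧ HasFiniteCorners (representativeMultipliers ν κ S) c) ↔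
      IsClopen {σ.toDual} ∧ ∀ φ, IsRepresentative φ → FiniteDimensional ℂ
        (LinearMap.range ((h.multiplierRep σ).integrated ν φ).toLinearMap) := by
  rw [IrrRep.exists_hasFiniteCorners_iff (θ := NonUnitalStarSubalgebraClass.subtype S)
      Subtype.coe_injective (isNondegenerate_representativeMultipliers ν h),
    finiteDimensional_range_representativeMultipliers_iff ν h σ]

section DiscreteSeries

variable {G : Type u} [Group G] [TopologicalSpace G] [IsTopologicalGroup G]
  [LocallyCompactSpace G] [MeasurableSpace G] [BorelSpace G]
  {μ : Measure G} [μ.IsHaarMeasure] [μ.Regular] [μ.IsMulRightInvariant]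
  {K : Subgroup G} [CompactSpace K]

theorem exists_hasFiniteCorners_iff_isAdmissible (ν : Measure K) [ν.IsHaarMeasure]
    (ρ : IrrRep (reducedCStar μ)) :
    (∃ c, ρ.rep c ≠ 0 ∧ HasFiniteCorners
      (representativeMultipliers ν ((leftRegular μ).restrict K) (reducedCStar μ)) c) ↔
      IsClopen {ρ.toDual} ∧ (ρ.disintegrate μ).rep.IsAdmissible K := by
  have hcorners := exists_hasFiniteCorners_representativeMultipliers_iff ν
    (κ := (leftRegular μ).restrict K) ((isMultiplier_leftRegular μ).restrict K) ρ
  have hadmissible := UnitaryRep.isAdmissible_iff ν (ρ.disintegrate μ).rep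
  exact hcorners.trans (and_congr_right' hadmissible.symm)

variable [T2Space G]

theorem exists_mem_compactIdeal_apply_ne_zero_iff_isAdmissible {ρ : IrrRep (reducedCStar μ)}
    {π : IrrUnitaryRep G} (hπ : IsIntegratedForm μ ρ π) :
    (∃ j ∈ compactIdeal μ K, ρ.rep j ≠ 0) ↔ IsClopen {ρ.toDual} ∧ π.rep.IsAdmissible K := by
  have hdisintegrate : ρ.disintegrate μ ≈ π :=
    IntegratesTo.equiv_right (denseRange_leftConv μ) (isIntegratedForm_disintegrate μ ρ) hπ
  rw [exists_mem_compactIdeal_apply_ne_zero_iff μ Measure.haar,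
    exists_hasFiniteCorners_iff_isAdmissible, isAdmissible_iff_of_equiv hdisintegrate]

theorem exists_mem_compactIdeal_apply_ne_zero_iff_isTopologicalDiscreteSeries
    (π : IrrUnitaryRep G) :
    (∃ ρ, IsIntegratedForm μ ρ π ∧ ∃ j ∈ compactIdeal μ K, ρ.rep j ≠ 0) ↔
      IsTopologicalDiscreteSeries μ π ∧ π.rep.IsAdmissible K := by
  refine (exists_congr fun ρ => and_congr_right fun hρ =>
    exists_mem_compactIdeal_apply_ne_zero_iff_isAdmissible hρ).trans ?_
  simp only [IsTopologicalDiscreteSeries, ← and_assoc, exists_and_right]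

end DiscreteSeries

end

/-- The spectrum of the compact ideal, identified (by extending representations to `C*_r(G)` and
disintegrating them to `G`) with a set of classes of irreducible unitary representations of `G`,
consists exactly of the `K`-admissible topological discrete series representations. -/
theorem mainTheorem3 {G : Type u} [Group G] [TopologicalSpace G] [IsTopologicalGroup G]
    [LocallyCompactSpace G] [T2Space G] [MeasurableSpace G] [BorelSpace G]
    (μ : Measure G) [μ.IsHaarMeasure] [μ.Regular] [μ.IsMulRightInvariant]
    (K : Subgroup G) (hK : IsCompact (K : Set G)) :
    ∃ Φ : CStarDual (compactIdeal μ K) → UnitaryDual G,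
      (∀ (σ : IrrRep (compactIdeal μ K)) (π : IrrUnitaryRep G),
        Φ σ.toDual = ⟦π⟧ ↔ CorrespondsTo μ (compactIdeal μ K) σ π) ∧
      Function.Injective Φ ∧
      Set.range Φ = {c : UnitaryDual G | ∃ π : IrrUnitaryRep G, ⟦π⟧ = c ∧
        IsTopologicalDiscreteSeries μ π ∧ π.rep.IsAdmissible K} := by
  have : CompactSpace K := isCompact_iff_compactSpace.1 hK
  obtain ⟨Φ, hΦ, hinj, hrange⟩ := exists_injective_correspondence (denseRange_leftConv μ)
    (fun ρ => ⟨ρ.disintegrate μ, isIntegratedForm_disintegrate μ ρ⟩)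
    (isStarIdeal_compactIdeal μ (K := K))
  refine ⟨Φ, hΦ, hinj, hrange.trans (Set.ext fun c => exists_congr fun π => ?_)⟩
  exact and_congr_right'
    (exists_mem_compactIdeal_apply_ne_zero_iff_isTopologicalDiscreteSeries π)
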